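/- Let $m>0$ and let $s\ge 0$ be an integer. Let $\eta=\mathrm{diag}(1,-1,-1,-1)$, write $d\mu_m(p)=\frac{d^4p}{(2\pi)^3}\delta(p^2-m^2)\theta(p^0)$ for the invariant measure on the mass shell, $p\cdot x=\eta_{\mu\nu}p^\mu x^\nu$ and $X\overset{\leftrightarrow}{\partial_\sigma}Y=X\,\partial_\sigma Y-(\partial_\sigma X)\,Y$. Consider the bosonic Fock space over the Wigner representation of mass $m$ and spin $s$: one-particle vectors are functions $\psi_{\mu_1\dots\mu_s}(p)$ on the mass shell whose values are symmetric, traceless tensors with $p^{\mu_1}\psi_{\mu_1\dots\mu_s}(p)=0$, with scalar product $(-1)^s\int d\mu_m(p)\,\overline{\varphi_{\mu_1\dots\mu_s}(p)}\,\psi^{\mu_1\dots\mu_s}(p)$; and $U(a,\Lambda)$ is the second quantization of $(U(a,\Lambda)\psi)_{\mu_1\dots\mu_s}(p)=e^{ip\cdot a}(\Lambda^{-1})^{\alpha_1}{}_{\mu_1}\cdots(\Lambda^{-1})^{\alpha_s}{}_{\mu_s}\,\psi_{\alpha_1\dots\alpha_s}(\Lambda^{-1}p)$. Let $\mathcal D$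 be the space of finite-particle vectors with smooth, compactly supported wave functions. The spin-$s$ Proca field is $$A_{\mu_1\dots\mu_s}(x)=\int d\mu_m(p)\,\big[e^{ip\cdot x}a^*_{\mu_1\dots\mu_s}(p)+e^{-ip\cdot x}a_{\mu_1\dots\mu_s}(p)\big],$$ where $a_{\mu_1\dots\mu_s}(p)$ is the annihilation operator that evaluates one particle of the wave function at $p$ and $\mu_1\dots\mu_s$. Fields at a point and their normal ordered products (normal ordering is understood below) are sesquilinear forms on $\mathcal D$, and the identities below hold in the sense of such forms; all spatial integrals of matrix elements are absolutely convergent. The symbol $\times$ stands for $s-1$ contracted indices. There are symmetric operators $P_\sigma$ and $M_{\sigma\tau}$ on $\mathcal D$ that are the generators of the Poincaré transformations: $\mathcal D$ is invariant under $U(te_\sigma,1)$ and $U(0,e^{t\omega_{\sigma\tau}})$, and for $\Psi\in\mathcal D$, at $t=0$ in the norm of Fock space, $$\tfrac{d}{dt}U(te_\sigma,1)\Psi=iP_\sigma\Psi,\qquad \tfrac{d}{dt}U(0,e^{t\omega_{\sigma\tau}})\Psi=iM_{\sigma\tau}\Psi,\qquad (\omega_{\sigma\tau})^\alpha{}_\beta=\delta^\alpha_\tau\eta_{\sigma\beta}-\delta^\alpha_\sigma\eta_{\tau\beta}.$$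 They have the following properties. (1) At every time $x^0=t$, $$P_\sigma=(-1)^s\int d^3\vec x\,\Big[-\tfrac14 A_{\mu_1\dots\mu_s}\overset{\leftrightarrow}{\partial_\sigma}\overset{\leftrightarrow}{\partial_0}A^{\mu_1\dots\mu_s}\Big],$$ $$M_{\sigma\tau}=(-1)^s\int d^3\vec x\,\Big[-\tfrac14\Big(x_\sigma\, A_{\mu\times}\overset{\leftrightarrow}{\partial_0}\overset{\leftrightarrow}{\partial_\tau}A^{\mu\times}-(\sigma\leftrightarrow\tau)\Big)-s\,A_{\sigma\times}\overset{\leftrightarrow}{\partial_0}A_\tau{}^{\times}\Big].$$ (2) They implement the infinitesimal Poincaré transformations of the field: $$[P_\sigma,A_{\nu_1\dots\nu_s}(y)]=-i\,\partial_\sigma A_{\nu_1\dots\nu_s}(y),$$ $$[M_{\sigma\tau},A_{\nu_1\dots\nu_s}(y)]=-i(y_\sigma\partial_\tau-y_\tau\partial_\sigma)A_{\nu_1\dots\nu_s}(y)-i\sum_{k=1}^s\big(\eta_{\sigma\nu_k}A_{\nu_1\dots\tau\dots\nu_s}(y)-\eta_{\tau\nu_k}A_{\nu_1\dots\sigma\dots\nu_s}(y)\big),$$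 with $\tau$, respectively $\sigma$, in place of $\nu_k$. (3) With the reduced stress-energy tensor $$T^{\mathrm{red}}_{\rho\sigma}=(-1)^s\Big[-\tfrac14A_{\mu\times}\overset{\leftrightarrow}{\partial_\rho}\overset{\leftrightarrow}{\partial_\sigma}A^{\mu\times}-\tfrac s2\,\partial^\mu\Big(A_{\rho\times}\overset{\leftrightarrow}{\partial_\sigma}A_\mu{}^{\times}+(\rho\leftrightarrow\sigma)\Big)\Big]$$ one has, at every time $x^0=t$, $$P_\sigma=\int d^3\vec x\,T^{\mathrm{red}}_{0\sigma},\qquad M_{\sigma\tau}=\int d^3\vec x\,\big(x_\sigma T^{\mathrm{red}}_{0\tau}-x_\tau T^{\mathrm{red}}_{0\sigma}\big).$$ -/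

import Mathlib

open MeasureTheory Filter Topology
open scoped ComplexConjugate ContDiff Matrix

noncomputable section

namespace Proca

/-! ### Minkowski space, signature `(+,-,-,-)` -/

/-- Points of Minkowski space, given by their contravariant components `x^μ`. -/
abbrev Spacetime := Fin 4 → ℝ

/-- Physical space, and also the space of momenta that parametrizes the mass shell. -/
abbrev Space := EuclideanSpace ℝ (Fin 3)

/-- The Minkowski metric `η_{μν} = η^{μν}`. -/
def η : Matrix (Fin 4) (Fin 4) ℝ := Matrix.diagonal ![1, -1, -1, -1]

/-- Lowering an index: `v_σ = η_{σν} v^ν`. -/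
def lowerIndex (v : Spacetime) (σ : Fin 4) : ℝ := ∑ ν, η σ ν * v ν

/-- The Minkowski product `v · w`. -/
def mdot (v w : Spacetime) : ℝ := ∑ μ, lowerIndex v μ * w μ

/-- The point `(t, x)`. -/
def point (t : ℝ) (x : Space) : Spacetime := Matrix.vecCons t (fun i : Fin 3 => x i)

/-- The partial derivative `∂_σ = ∂/∂x^σ`. -/
def pd (σ : Fin 4) (f : Spacetime → ℂ) (x : Spacetime) : ℂ :=
  fderiv ℝ f x (Pi.single σ 1)

/-! ### The mass shell -/

/-- The energy `p^0 = √(m² + |p|²)`. -/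
def energy (m : ℝ) (p : Space) : ℝ := Real.sqrt (m ^ 2 + ∑ i, p i ^ 2)

/-- The point of the mass shell with spatial momentum `p`. -/
def onShell (m : ℝ) (p : Space) : Spacetime := point (energy m p) p

/-- The density of the invariant measure
`dμ_m = (2π)⁻³ δ(p² - m²) θ(p⁰) d⁴p = d³p / ((2π)³ 2 p⁰)` on the mass shell. -/
def shellDensity (m : ℝ) (p : Space) : ℝ := ((2 * Real.pi) ^ 3 * (2 * energy m p))⁻¹

/-! ### Fock space over the Wigner representation of mass `m` and spin `s` -/

/-- Sequences of `n`-particle wave functions `Ψ_n(p_1, μ_1; …; p_n, μ_n)`, where every `μ_i` is a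
multi-index `μ_{i1} … μ_{is}` of (covariant) tensor indices. -/
abbrev WaveFun (s : ℕ) :=
  (n : ℕ) → (Fin n → Space) → (Fin n → Fin s → Fin 4) → ℂ

/-- Finite-particle vectors of the bosonic Fock space, with smooth and compactly supported wave
functions. The one-particle space is the Wigner representation of mass `m` and spin `s` in its
covariant form: sections over the mass shell of the bundle of symmetric, traceless tensors that
are transversal to the momentum. -/
structure IsFockVector (m : ℝ) (s : ℕ) (Ψ : WaveFun s) : Prop where
  finite : ∃ N, ∀ n, N < n → Ψ n = 0
  smooth : ∀ n μ, ContDiff ℝ ∞ (fun p => Ψ n p μ)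
  compact : ∀ n μ, HasCompactSupport (fun p => Ψ n p μ)
  bose : ∀ n (e : Equiv.Perm (Fin n)) p μ, Ψ n (p ∘ e) (μ ∘ e) = Ψ n p μ
  symm : ∀ n p μ (i : Fin n) (e : Equiv.Perm (Fin s)),
    Ψ n p (Function.update μ i (μ i ∘ e)) = Ψ n p μ
  traceless : ∀ n p μ (i : Fin n) (j k : Fin s), j ≠ k →
    ∑ α, ∑ β, (η α β : ℂ) *
      Ψ n p (Function.update μ i (Function.update (Function.update (μ i) j α) k β)) = 0
  transversal : ∀ n p μ (i : Fin n) (j : Fin s),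
    ∑ α, (onShell m (p i) α : ℂ) *
      Ψ n p (Function.update μ i (Function.update (μ i) j α)) = 0

/-- The vectors of `IsFockVector` as a complex vector space. It is dense in Fock space and
invariant under the Poincaré group, hence a core for all Poincaré generators. -/
def fockDomain (m : ℝ) (s : ℕ) : Submodule ℂ (WaveFun s) where
  carrier := {Ψ | IsFockVector m s Ψ}
  zero_mem' :=
    { finite := ⟨0, fun _ _ => rfl⟩
      smooth := fun _ _ => contDiff_const
      compact := fun _ _ => HasCompactSupport.zero
      bose := fun _ _ _ _ => rfl
      symm := fun _ _ _ _ _ => rfl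
      traceless := fun _ _ _ _ _ _ _ => by simp
      transversal := fun _ _ _ _ _ => by simp }
  add_mem' := fun {Φ Ψ} hΦ hΨ =>
    { finite := by
        obtain ⟨N, hN⟩ := hΦ.finite
        obtain ⟨K, hK⟩ := hΨ.finite
        refine ⟨max N K, fun n hn => ?_⟩
        rw [Pi.add_apply, hN n (lt_of_le_of_lt (le_max_left _ _) hn),
          hK n (lt_of_le_of_lt (le_max_right _ _) hn), add_zero]
      smooth := fun n μ => (hΦ.smooth n μ).add (hΨ.smooth n μ)
      compact := fun n μ => (hΦ.compact n μ).add (hΨ.compact n μ)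
      bose := fun n e p μ => by simp only [Pi.add_apply, hΦ.bose, hΨ.bose]
      symm := fun n p μ i e => by simp only [Pi.add_apply, hΦ.symm, hΨ.symm]
      traceless := fun n p μ i j k h => by
        simp only [Pi.add_apply, mul_add, Finset.sum_add_distrib, hΦ.traceless n p μ i j k h,
          hΨ.traceless n p μ i j k h, add_zero]
      transversal := fun n p μ i j => by
        simp only [Pi.add_apply, mul_add, Finset.sum_add_distrib, hΦ.transversal n p μ i j,
          hΨ.transversal n p μ i j, add_zero] }
  smul_mem' := fun c {Ψ} hΨ =>
    { finite := by
        obtain ⟨N, hN⟩ := hΨ.finite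
        exact ⟨N, fun n hn => by rw [Pi.smul_apply, hN n hn, smul_zero]⟩
      smooth := fun n μ => contDiff_const.mul (hΨ.smooth n μ)
      compact := fun n μ => (hΨ.compact n μ).mul_left
      bose := fun n e p μ => by simp only [Pi.smul_apply, hΨ.bose]
      symm := fun n p μ i e => by simp only [Pi.smul_apply, hΨ.symm]
      traceless := fun n p μ i j k h => by
        simp only [Pi.smul_apply, smul_eq_mul, mul_left_comm _ c, ← Finset.mul_sum,
          hΨ.traceless n p μ i j k h, mul_zero]
      transversal := fun n p μ i j => by
        simp only [Pi.smul_apply, smul_eq_mul, mul_left_comm _ c, ← Finset.mul_sum,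
          hΨ.transversal n p μ i j, mul_zero] }

/-- The scalar product of Fock space. On every particle the tensor indices are contracted with
`(-1)^s η^{⊗s}`, which is positive on tensors transversal to the momentum. -/
def fockInner (m : ℝ) {s : ℕ} (Φ Ψ : WaveFun s) : ℂ :=
  ∑' n, ∫ p : Fin n → Space, ((∏ i, shellDensity m (p i) : ℝ) : ℂ) *
    ∑ μ : Fin n → Fin s → Fin 4,
      ((∏ i, (-1) ^ s * ∏ j, η (μ i j) (μ i j) : ℝ) : ℂ) * (conj (Φ n p μ) * Ψ n p μ)

/-- The (second quantized) Wigner representation: on every particle,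
`(U(a,Λ)ψ)_{μ_1…μ_s}(p) = e^{ip·a} (Λ⁻¹)^{α_1}_{μ_1} ⋯ (Λ⁻¹)^{α_s}_{μ_s} ψ_{α_1…α_s}(Λ⁻¹p)`. -/
def wignerU (m : ℝ) {s : ℕ} (a : Spacetime) (Λ : Matrix (Fin 4) (Fin 4) ℝ) (Ψ : WaveFun s) :
    WaveFun s := fun n p μ =>
  (∏ i, Complex.exp (Complex.I * mdot (onShell m (p i)) a)) *
    ∑ α : Fin n → Fin s → Fin 4, ((∏ i, ∏ j, Λ⁻¹ (α i j) (μ i j) : ℝ) : ℂ) *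
      Ψ n (fun i => WithLp.toLp 2 fun k : Fin 3 => (Λ⁻¹ *ᵥ onShell m (p i)) k.succ) α

/-- The infinitesimal Lorentz transformation `ω_{στ}`, acting on points by
`(ω_{στ})^α_β x^β ∂_α = x_σ ∂_τ - x_τ ∂_σ`. -/
def lorentzGen (σ τ : Fin 4) : Matrix (Fin 4) (Fin 4) ℝ := fun α β =>
  (if α = τ then η σ β else 0) - (if α = σ then η τ β else 0)

/-- `G` is the generator on the domain of the one-parameter group `V(t) = e^{itG}` of operators
that leave the domain invariant: `G` is symmetric, and `(V(t)Ψ - Ψ)/t` converges to `iGΨ` in the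
norm of Fock space as `t → 0`. -/
def IsGenerator (m : ℝ) {s : ℕ} (V : ℝ → WaveFun s → WaveFun s)
    (G : fockDomain m s →ₗ[ℂ] fockDomain m s) : Prop :=
  (∀ (t : ℝ) (Ψ : fockDomain m s), V t Ψ ∈ fockDomain m s) ∧
  (∀ Φ Ψ : fockDomain m s, fockInner m (G Φ : WaveFun s) Ψ = fockInner m (Φ : WaveFun s) (G Ψ)) ∧
  ∀ Ψ : fockDomain m s,
    Tendsto (fun t : ℝ =>
        fockInner m (((t : ℂ)⁻¹ • (V t Ψ - (Ψ : WaveFun s))) - Complex.I • (G Ψ : WaveFun s))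
          (((t : ℂ)⁻¹ • (V t Ψ - (Ψ : WaveFun s))) - Complex.I • (G Ψ : WaveFun s)))
      (𝓝[≠] 0) (𝓝 0)

/-! ### The Proca field

The field is `A_μ(x) = ∫ dμ_m(p) [e^{ipx} a*_μ(p) + e^{-ipx} a_μ(p)]`, where `a_μ(p)` evaluates one
particle of the wave function at momentum `p` and multi-index `μ`, and `a*_μ(p)` is its adjoint.
The field at a point, and normal ordered products of fields, are sesquilinear forms on the domain,
that depend smoothly on the points. -/

/-- The annihilation part `∫ dμ_m(p) e^{-ipx} a_μ(p)` of the Proca field. -/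
def annihilate (m : ℝ) {s : ℕ} (μ : Fin s → Fin 4) (x : Spacetime) (Ψ : WaveFun s) :
    WaveFun s := fun n p ν =>
  (Real.sqrt (n + 1) : ℂ) * ∫ q : Space, (shellDensity m q : ℂ) *
    (Complex.exp (-(Complex.I * mdot (onShell m q) x)) *
      Ψ (n + 1) (Matrix.vecCons q p) (Matrix.vecCons μ ν))

/-- `⟨Φ, A_μ(x) Ψ⟩`. -/
def fieldForm (m : ℝ) {s : ℕ} (Φ Ψ : WaveFun s) (μ : Fin s → Fin 4) (x : Spacetime) : ℂ :=
  fockInner m Φ (annihilate m μ x Ψ) + fockInner m (annihilate m μ x Φ) Ψ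

/-- `⟨Φ, :A_μ(x) A_ν(y): Ψ⟩`. -/
def wickForm (m : ℝ) {s : ℕ} (Φ Ψ : WaveFun s) (μ ν : Fin s → Fin 4) (x y : Spacetime) : ℂ :=
  fockInner m Φ (annihilate m μ x (annihilate m ν y Ψ)) +
  fockInner m (annihilate m μ x Φ) (annihilate m ν y Ψ) +
  fockInner m (annihilate m ν y Φ) (annihilate m μ x Ψ) +
  fockInner m (annihilate m ν y (annihilate m μ x Φ)) Ψ

/-- The derivative `X ↔∂_σ Y = X ∂_σ Y - (∂_σ X) Y` of a bilocal product `W(x,y) = X(x) Y(y)`. -/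
def arrow (σ : Fin 4) (W : Spacetime → Spacetime → ℂ) (x y : Spacetime) : ℂ :=
  pd σ (fun y' => W x y') y - pd σ (fun x' => W x' y) x

/-- The multi-index `α κ_1 … κ_{s-1}`. -/
def headIndex {s : ℕ} (α : Fin 4) (κ : Fin (s - 1) → Fin 4) : Fin s → Fin 4 := fun i =>
  if h : (i : ℕ) = 0 then α else κ ⟨(i : ℕ) - 1, by omega⟩

/-- `⟨Φ, :A_{μ_1…μ_s} ↔∂_ρ ↔∂_σ A^{μ_1…μ_s}:(x) Ψ⟩`. -/
def quad₂ (m : ℝ) {s : ℕ} (Φ Ψ : WaveFun s) (ρ σ : Fin 4) (x : Spacetime) : ℂ :=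
  ∑ μ : Fin s → Fin 4, ((∏ j, η (μ j) (μ j) : ℝ) : ℂ) *
    arrow ρ (arrow σ (wickForm m Φ Ψ μ μ)) x x

/-- `⟨Φ, :A_{α×} ↔∂_σ A_β^×:(x) Ψ⟩`, where `×` stands for the contraction in the other `s - 1`
indices. For `s = 0` this occurs only with coefficient `0`. -/
def quad₁ (m : ℝ) {s : ℕ} (Φ Ψ : WaveFun s) (α σ β : Fin 4) (x : Spacetime) : ℂ :=
  ∑ κ : Fin (s - 1) → Fin 4, ((∏ j, η (κ j) (κ j) : ℝ) : ℂ) *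
    arrow σ (wickForm m Φ Ψ (headIndex α κ) (headIndex β κ)) x x

/-- The density `(-1)^s [-¼ A_{μ_1…μ_s} ↔∂_σ ↔∂_0 A^{μ_1…μ_s}]` of the momentum `P_σ`. -/
def momentumDensity (m : ℝ) {s : ℕ} (Φ Ψ : WaveFun s) (σ : Fin 4) (x : Spacetime) : ℂ :=
  (-1) ^ s * (-(1 / 4) * quad₂ m Φ Ψ σ 0 x)

/-- The density
`(-1)^s [-¼ (x_σ A_{μ×} ↔∂_0 ↔∂_τ A^{μ×} - (σ ↔ τ)) - s A_{σ×} ↔∂_0 A_τ^×]` of `M_{στ}`. -/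
def lorentzDensity (m : ℝ) {s : ℕ} (Φ Ψ : WaveFun s) (σ τ : Fin 4) (x : Spacetime) : ℂ :=
  (-1) ^ s * (-(1 / 4) * (lowerIndex x σ * quad₂ m Φ Ψ 0 τ x - lowerIndex x τ * quad₂ m Φ Ψ 0 σ x)
    - s * quad₁ m Φ Ψ σ 0 τ x)

/-- The reduced stress-energy tensor `T^red_{ρσ} =
(-1)^s [-¼ A_{μ×} ↔∂_ρ ↔∂_σ A^{μ×} - (s/2) ∂^μ (A_{ρ×} ↔∂_σ A_μ^× + (ρ ↔ σ))]`. -/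
def Tred (m : ℝ) {s : ℕ} (Φ Ψ : WaveFun s) (ρ σ : Fin 4) (x : Spacetime) : ℂ :=
  (-1) ^ s * (-(1 / 4) * quad₂ m Φ Ψ ρ σ x
    - (s / 2) * ∑ μ, (η μ μ : ℂ) *
        pd μ (fun z => quad₁ m Φ Ψ ρ σ μ z + quad₁ m Φ Ψ σ ρ μ z) x)

end Proca

end

open Proca

open scoped FourierTransform

namespace Proca

/-! ### Smooth functions with compact support -/

section TestFunctions

variable {E : Type} [NormedAddCommGroup E] [NormedSpace ℝ E]
  {F : Type} [NormedAddCommGroup F] [NormedSpace ℝ F]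
  {X : Type} [NormedAddCommGroup X] [NormedSpace ℝ X]

/-! Everything is reduced to one particle. Translations and Lorentz transformations are treated at
once through the derivative at `t = 0` of `U(ta, exp(tA))`, where `A` is antisymmetric after
lowering an index; the theorem needs `A = 0` and `a = 0`. The derivative is `i` times `gen`, the sum
over all particles of `oneGen`, which consists of multiplication by `p·a` and of `i` times the
derivative along the vector field `p ↦ Ap` on the mass shell together with the action of `A` on the
tensor indices.

The conditions that define the domain are Lorentz covariant, so `U` preserves them
(`IsFockVector.wignerU_exp`). They are closed under pointwise limits of difference quotients, so
`gen` preserves them too (`IsFockVector.gen`). For `|t| ≤ 1` the supports stay in a fixed compact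
set, and dominated convergence upgrades the pointwise derivative to one in Fock norm
(`tendsto_fockInner_slope`).

By Bose symmetry, `⟨Φ, gen Ψ⟩` is an integral over the mass shell of `oneGen` acting on the second
argument of the two-point function `⟨a_μ(q)Φ, a_ν(q')Ψ⟩`, taken at `q' = q` and contracted
(`IsTestVector.fockInner_gen`). It is symmetric in `Φ` and `Ψ` because `p·a` is real, the vector
field is divergence-free for the invariant measure, and the metric makes `A` antisymmetric. The same
integration by parts, applied to `exp(-iq·y) ⟨Φ, a_ν(q)Ψ⟩`, turns momentum derivatives into
derivatives of the field and gives the commutators (`fieldForm_gen`).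

For the charges, a normal ordered product of two fields is a sum over four choices of frequency
signs of double Fourier integrals (`wickForm_eq_bilocal`). A two-sided derivative multiplies the
amplitude by `i` times the difference of the signed momenta, and an ordinary derivative on the
diagonal by `i` times their sum. By Fourier inversion, the integral over space restricts the
amplitude to vanishing total spatial momentum. For two creation or two annihilation operators the
energies then agree and the factor of the two-sided time derivative vanishes. For one operator of
each kind one gets `q' = q`, the time dependence cancels, and `(2π)³ 2E` removes one of the two
densities, which leaves the invariant measure. A coordinate `x_σ` becomes a momentum derivative.
After antisymmetrization all terms cancel except the derivative of the two-point function along the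
Lorentz vector field, and the spin term supplies the action on the indices, each of the `s` slots
contributing the same because the tensors are symmetric.

In the reduced stress-energy tensor, conservation of the currents `A_α ↔∂_μ A_β`, which expresses
that both momenta have mass `m`, turns the additional term of the components `0σ` into a spatial
divergence (`Tred_eq`). It does not contribute to `P`. Its first moments are integrals of the
potential, whose symmetric part drops out of `M` and whose antisymmetric part is the spin term. -/

/-- Smooth functions with compact support. -/
structure IsTestFun (f : E → F) : Prop where
  smooth : ContDiff ℝ ∞ f
  compact : HasCompactSupport f

namespace IsTestFun

theorem continuous {f : E → F} (hf : IsTestFun f) : Continuous f := hf.smooth.continuous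

theorem differentiable {f : E → F} (hf : IsTestFun f) : Differentiable ℝ f :=
  hf.smooth.differentiable (by simp)

theorem zero : IsTestFun (fun _ : E => (0 : F)) := ⟨contDiff_const, HasCompactSupport.zero⟩

theorem add {f g : E → F} (hf : IsTestFun f) (hg : IsTestFun g) :
    IsTestFun (fun x => f x + g x) := ⟨hf.smooth.add hg.smooth, hf.compact.add hg.compact⟩

theorem sum {ι : Type*} {f : ι → E → F} (t : Finset ι) (hf : ∀ i ∈ t, IsTestFun (f i)) :
    IsTestFun (fun x => ∑ i ∈ t, f i x) := by
  classical
  induction t using Finset.induction_on with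
  | empty => simpa using zero
  | insert i t hi ih =>
    simp only [Finset.sum_insert hi]
    exact (hf i (by simp)).add (ih fun j hj => hf j (by simp [hj]))

theorem mul_left {c f : E → ℂ} (hc : ContDiff ℝ ∞ c) (hf : IsTestFun f) :
    IsTestFun (fun x => c x * f x) := ⟨hc.mul hf.smooth, hf.compact.mul_left⟩

theorem const_mul {f : E → ℂ} (hf : IsTestFun f) (c : ℂ) : IsTestFun (fun x => c * f x) :=
  mul_left contDiff_const hf

theorem star {f : E → ℂ} (hf : IsTestFun f) : IsTestFun (fun x => conj (f x)) :=
  ⟨Complex.conjCLE.contDiff.comp hf.smooth, hf.compact.comp_left (g := starRingEnd ℂ) (map_zero _)⟩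

theorem sub {f g : E → ℂ} (hf : IsTestFun f) (hg : IsTestFun g) :
    IsTestFun (fun x => f x - g x) := by
  simpa [sub_eq_add_neg] using hf.add (hg.const_mul (-1))

theorem fderiv_apply {f : E → F} (hf : IsTestFun f) (v : E) :
    IsTestFun (fun x => fderiv ℝ f x v) :=
  ⟨(hf.smooth.fderiv_right (m := ∞) (by simp)).clm_apply contDiff_const,
    hf.compact.fderiv_apply (𝕜 := ℝ) v⟩

theorem comp_homeomorph {f : E → F} (hf : IsTestFun f) (e : X ≃ₜ E) (he : ContDiff ℝ ∞ e) :
    IsTestFun (fun x => f (e x)) := ⟨hf.smooth.comp he, hf.compact.comp_homeomorph e⟩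

theorem integrable {f : E → F} (hf : IsTestFun f) [MeasurableSpace E] [BorelSpace E]
    (μ : Measure E) [IsFiniteMeasureOnCompacts μ] : Integrable f μ :=
  hf.continuous.integrable_of_hasCompactSupport hf.compact

theorem of_prod_mk {f : E × X → F} (hf : IsTestFun f) (e : E) : IsTestFun (fun x => f (e, x)) :=
  ⟨hf.smooth.comp (contDiff_const.prodMk contDiff_id),
    HasCompactSupport.intro (hf.compact.image continuous_snd) fun x hx =>
      image_eq_zero_of_notMem_tsupport fun h => hx ⟨(e, x), h, rfl⟩⟩

/-- Only one factor has compact support, so that the other may be a plane wave. -/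
theorem integral_mul_fderiv [FiniteDimensional ℝ E] [MeasurableSpace E] [BorelSpace E]
    {μ : Measure E} [μ.IsAddHaarMeasure] {f g : E → ℂ} (hf : ContDiff ℝ ∞ f) (hg : IsTestFun g)
    (v : E) : ∫ x, f x * fderiv ℝ g x v ∂μ = - ∫ x, fderiv ℝ f x v * g x ∂μ := by
  refine integral_mul_fderiv_eq_neg_fderiv_mul_of_integrable ?_ ?_ ?_
    (fun x _ => hf.differentiable (by simp) x) (fun x _ => hg.differentiable x)
  · exact (mul_left ((hf.fderiv_right (m := ∞) (by simp)).clm_apply contDiff_const) hg).integrable μ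
  · exact (mul_left hf (hg.fderiv_apply v)).integrable μ
  · exact (mul_left hf hg).integrable μ

end IsTestFun

end TestFunctions

/-! ### Integrals depending on a parameter -/

section Parametric

set_option linter.unusedSectionVars false

variable {E : Type} [NormedAddCommGroup E] [NormedSpace ℝ E]
  {X : Type} [NormedAddCommGroup X] [NormedSpace ℝ X] [MeasurableSpace X] [BorelSpace X]
  [SecondCountableTopology X]
  {μ : Measure X} [IsFiniteMeasureOnCompacts μ]

/-- The dominating function for the parametric integrals: the projection of the support to `X` is
compact, hence of finite measure, and the bound on it is uniform in the parameter. -/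
theorem exists_bound_indicator {F : Type} [NormedAddCommGroup F] {f : E × X → F}
    (hf : Continuous f) (hc : HasCompactSupport f) :
    ∃ b : X → ℝ, Integrable b μ ∧ ∀ e x, ‖f (e, x)‖ ≤ b x := by
  obtain ⟨C, hC⟩ := hc.exists_bound_of_continuous hf
  have hK : IsCompact (Prod.snd '' tsupport f) := hc.image continuous_snd
  refine ⟨(Prod.snd '' tsupport f).indicator fun _ => C, ?_, fun e x => ?_⟩
  · exact (integrable_indicator_iff hK.isClosed.measurableSet).2
      (integrableOn_const hK.measure_lt_top.ne)
  · by_cases hx : x ∈ Prod.snd '' tsupport f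
    · rw [Set.indicator_of_mem hx]; exact hC _
    · rw [Set.indicator_of_notMem hx, image_eq_zero_of_notMem_tsupport fun h => hx ⟨_, h, rfl⟩,
        norm_zero]

theorem continuous_integral_param {F : Type} [NormedAddCommGroup F] [NormedSpace ℝ F]
    {f : E × X → F} (hf : Continuous f) (hc : HasCompactSupport f) :
    Continuous fun e => ∫ x, f (e, x) ∂μ := by
  obtain ⟨b, hb, hfb⟩ := exists_bound_indicator (μ := μ) hf hc
  exact continuous_of_dominated
    (fun e => (hf.comp (Continuous.prodMk_right e)).aestronglyMeasurable)
    (fun e => Eventually.of_forall (hfb e)) hb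
    (Eventually.of_forall fun x => hf.comp (Continuous.prodMk_left x))

theorem hasFDerivAt_integral_param {F : Type} [NormedAddCommGroup F] [NormedSpace ℝ F]
    {f : E × X → F} (hf : ContDiff ℝ 1 f)
    (hc : HasCompactSupport f) (e : E) :
    HasFDerivAt (fun e => ∫ x, f (e, x) ∂μ)
      (∫ x, (fderiv ℝ f (e, x)).comp (ContinuousLinearMap.inl ℝ E X) ∂μ) e := by
  have hcont : Continuous fun z => (fderiv ℝ f z).comp (ContinuousLinearMap.inl ℝ E X) :=
    (hf.continuous_fderiv (by simp)).clm_comp continuous_const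
  have hcs : HasCompactSupport fun z => (fderiv ℝ f z).comp (ContinuousLinearMap.inl ℝ E X) :=
    (hc.fderiv ℝ).comp_left (g := fun L : E × X →L[ℝ] F => L.comp (ContinuousLinearMap.inl ℝ E X))
      (ContinuousLinearMap.zero_comp _)
  obtain ⟨b, hb, hfb⟩ := exists_bound_indicator (μ := μ) hcont hcs
  obtain ⟨b', hb', hfb'⟩ := exists_bound_indicator (μ := μ) hf.continuous hc
  have hm : ∀ e, AEStronglyMeasurable (fun x => f (e, x)) μ := fun e =>
    (hf.continuous.comp (Continuous.prodMk_right e)).aestronglyMeasurable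
  refine hasFDerivAt_integral_of_dominated_of_fderiv_le (s := Set.univ) (bound := b) univ_mem
    (Eventually.of_forall hm)
    (hb'.mono' (hm e) (Eventually.of_forall (hfb' e)))
    (hcont.comp (Continuous.prodMk_right e)).aestronglyMeasurable
    (Eventually.of_forall fun x e' _ => hfb e' x) hb
    (Eventually.of_forall fun x e' _ => ?_)
  have h1 : HasFDerivAt f (fderiv ℝ f (e', x)) (e', x) :=
    (hf.differentiable (by simp) _).hasFDerivAt
  exact h1.comp e' (hasFDerivAt_prodMk_left e' x)

/-- The induction quantifies over the target `F`, since the derivative of the integral is an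
integral of the same kind with values in `E →L[ℝ] F`. -/
theorem contDiff_integral_param_nat (n : ℕ) : ∀ {F : Type} [NormedAddCommGroup F] [NormedSpace ℝ F]
    {f : E × X → F} (_ : ContDiff ℝ ∞ f) (_ : HasCompactSupport f),
    ContDiff ℝ n fun e => ∫ x, f (e, x) ∂μ := by
  induction n with
  | zero =>
    intro F _ _ f hf hc
    exact contDiff_zero.2 (continuous_integral_param hf.continuous hc)
  | succ n ih =>
    intro F _ _ f hf hc
    have hd := hasFDerivAt_integral_param (μ := μ) (hf.of_le (by simp)) hc
    rw [show ((n + 1 : ℕ) : WithTop ℕ∞) = (n : WithTop ℕ∞) + 1 by simp]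
    refine contDiff_succ_iff_hasFDerivAt.2 ⟨_, ih (f := fun z =>
      (fderiv ℝ f z).comp (ContinuousLinearMap.inl ℝ E X)) ?_ ?_, hd⟩
    · exact (hf.fderiv_right (m := ∞) (by simp)).clm_comp contDiff_const
    · exact (hc.fderiv ℝ).comp_left (g := fun L : E × X →L[ℝ] F => L.comp (ContinuousLinearMap.inl ℝ E X))
        (ContinuousLinearMap.zero_comp _)

theorem IsTestFun.integral_param {F : Type} [NormedAddCommGroup F] [NormedSpace ℝ F]
    {f : E × X → F} (hf : IsTestFun f) : IsTestFun fun e => ∫ x, f (e, x) ∂μ := by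
  refine ⟨contDiff_infty.2 fun n => contDiff_integral_param_nat n hf.smooth hf.compact,
    HasCompactSupport.intro (hf.compact.image continuous_fst) fun e he => ?_⟩
  simp [fun x => image_eq_zero_of_notMem_tsupport (f := f) (x := (e, x))
    fun h => he ⟨_, h, rfl⟩]

theorem fderiv_integral_param {F : Type} [NormedAddCommGroup F] [NormedSpace ℝ F]
    [CompleteSpace F] {f : E × X → F} (hf : IsTestFun f) (e v : E) :
    fderiv ℝ (fun e => ∫ x, f (e, x) ∂μ) e v = ∫ x, fderiv ℝ (fun e' => f (e', x)) e v ∂μ := by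
  have h1 : ContDiff ℝ 1 f := hf.smooth.of_le (by simp)
  rw [(hasFDerivAt_integral_param h1 hf.compact e).fderiv, ContinuousLinearMap.integral_apply]
  · refine integral_congr_ae (Eventually.of_forall fun x => ?_)
    have h2 : HasFDerivAt f (fderiv ℝ f (e, x)) (e, x) := (hf.differentiable _).hasFDerivAt
    simp only
    rw [(show HasFDerivAt (fun e' => f (e', x)) _ e from
      HasFDerivAt.comp (g := f) e h2 (hasFDerivAt_prodMk_left e x)).fderiv]
  · have hcont : Continuous fun z => (fderiv ℝ f z).comp (ContinuousLinearMap.inl ℝ E X) :=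
      (h1.continuous_fderiv (by simp)).clm_comp continuous_const
    have hcs : HasCompactSupport fun z => (fderiv ℝ f z).comp (ContinuousLinearMap.inl ℝ E X) :=
      (hf.compact.fderiv ℝ).comp_left (g := fun L : E × X →L[ℝ] F => L.comp (ContinuousLinearMap.inl ℝ E X))
        (ContinuousLinearMap.zero_comp _)
    obtain ⟨b, hb, hfb⟩ := exists_bound_indicator (μ := μ) hcont hcs
    exact hb.mono' (hcont.comp (Continuous.prodMk_right e)).aestronglyMeasurable
      (Eventually.of_forall (hfb e))

end Parametric

/-! ### Spatial integrals of Fourier integrals -/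

/-- Fourier inversion at the origin. A test function is a Schwartz function, hence so is its
transform, which is therefore integrable. The constant `(2π)³` comes from rescaling to the
convention `exp(-2πi k·x)`. -/
theorem integrable_fourierIntegral {F : Space → ℂ} (hF : IsTestFun F) :
    Integrable (fun x : Space => ∫ k, F k * Complex.exp (-(Complex.I * (inner ℝ k x : ℝ)))) ∧
    ∫ x : Space, ∫ k, F k * Complex.exp (-(Complex.I * (inner ℝ k x : ℝ))) =
      (2 * Real.pi) ^ 3 * F 0 := by
  have h2 : (0 : ℝ) < 2 * Real.pi := by positivity
  set S := hF.compact.toSchwartzMap hF.smooth with hS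
  have hSF : ∀ k, S k = F k := fun k => rfl
  have key : ∀ x : Space, ∫ k, F k * Complex.exp (-(Complex.I * (inner ℝ k x : ℝ))) =
      (𝓕 S) ((2 * Real.pi)⁻¹ • x) := by
    intro x
    rw [SchwartzMap.fourier_coe, Real.fourier_eq']
    refine integral_congr_ae (Eventually.of_forall fun k => ?_)
    simp only [hSF, smul_eq_mul, inner_smul_right]
    rw [mul_comm]
    congr 2
    push_cast
    field_simp
  simp only [key]
  refine ⟨(SchwartzMap.integrable (𝓕 S)).comp_smul (inv_ne_zero h2.ne'), ?_⟩
  have h5 := Measure.integral_comp_smul (volume : Measure Space) (fun x => (𝓕 S) x)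
    (2 * Real.pi)⁻¹
  rw [h5]
  have h0 : ∫ x : Space, (𝓕 S) x = F 0 := by
    have h3 : 𝓕⁻ (𝓕 S) = S := FourierTransform.fourierInv_fourier_eq S
    have h4 : (𝓕⁻ (𝓕 S)) 0 = F 0 := by rw [h3, hSF]
    rw [← h4, SchwartzMap.fourierInv_coe, Real.fourierInv_eq]
    simp
  rw [h0]
  simp
  rw [abs_of_pos (by positivity)]
  left
  field_simp

/-- With the total momentum `k = ε₁ q₁ + ε₂ q₂` and `q = q₁` as new variables, and after integration
over `q`, this is a single Fourier integral in `k`. Inversion sets `k = 0`, that is, `q₂ = -ε₁ ε₂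
q₁`. -/
theorem integrable_bilocal_slice {f : Space × Space → ℂ} (hf : IsTestFun f) {ε₁ ε₂ : ℝ}
    (h₂ : ε₂ ^ 2 = 1) :
    Integrable (fun x : Space => ∫ z : Space × Space,
      f z * Complex.exp (-(Complex.I * (inner ℝ (ε₁ • z.1 + ε₂ • z.2) x : ℝ)))) ∧
    ∫ x : Space, ∫ z : Space × Space,
      f z * Complex.exp (-(Complex.I * (inner ℝ (ε₁ • z.1 + ε₂ • z.2) x : ℝ))) =
      (2 * Real.pi) ^ 3 * ∫ q : Space, f (q, -(ε₁ * ε₂) • q) := by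
  have h2 : ε₂ ≠ 0 := by rintro rfl; norm_num at h₂
  have habs : |ε₂| = 1 := by
    rcases sq_eq_one_iff.1 h₂ with h | h <;> simp [h]
  have h22 : ε₂ * ε₂ = 1 := by rw [← sq, h₂]
  let e : Space × Space ≃ₜ Space × Space :=
    { toFun := fun z => (z.2, ε₂ • (z.1 - ε₁ • z.2))
      invFun := fun z => (ε₁ • z.1 + ε₂ • z.2, z.1)
      left_inv := fun z => by ext <;> simp [smul_smul, h22]
      right_inv := fun z => by ext <;> simp [smul_smul, h22]
      continuous_toFun := by fun_prop
      continuous_invFun := by fun_prop }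
  have he : ∀ z, e z = (z.2, ε₂ • (z.1 - ε₁ • z.2)) := fun z => rfl
  have hF := (hf.comp_homeomorph e
    (contDiff_snd.prodMk ((contDiff_fst.sub (contDiff_snd.const_smul ε₁)).const_smul ε₂))).integral_param
    (μ := volume)
  have key : ∀ x : Space, ∫ z : Space × Space,
      f z * Complex.exp (-(Complex.I * (inner ℝ (ε₁ • z.1 + ε₂ • z.2) x : ℝ))) =
      ∫ k, (∫ q, f (e (k, q))) * Complex.exp (-(Complex.I * (inner ℝ k x : ℝ))) := by
    intro x
    have hexp : Continuous fun z : Space × Space =>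
        Complex.exp (-(Complex.I * (inner ℝ (ε₁ • z.1 + ε₂ • z.2) x : ℝ))) := by fun_prop
    have hi1 : Integrable (fun z : Space × Space =>
      f z * Complex.exp (-(Complex.I * (inner ℝ (ε₁ • z.1 + ε₂ • z.2) x : ℝ)))) :=
      (hf.continuous.mul hexp).integrable_of_hasCompactSupport hf.compact.mul_right
    have hi2 : Integrable (fun z : Space × Space =>
      f (e z) * Complex.exp (-(Complex.I * (inner ℝ z.1 x : ℝ)))) :=
      ((hf.continuous.comp e.continuous).mul (by fun_prop)).integrable_of_hasCompactSupport
        (hf.compact.comp_homeomorph e).mul_right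
    simp only [← integral_mul_const]
    rw [Measure.volume_eq_prod] at hi1 hi2 ⊢
    have h7 := integral_integral_swap (f := fun k q => f (e (k, q)) *
      Complex.exp (-(Complex.I * (inner ℝ k x : ℝ)))) hi2
    rw [integral_prod _ hi1, h7]
    refine integral_congr_ae (Eventually.of_forall fun q => ?_)
    simp only
    have h5 := integral_sub_right_eq_self (μ := (volume : Measure Space))
      (fun k => f (q, ε₂ • k) *
        Complex.exp (-(Complex.I * (inner ℝ (ε₁ • q + k) x : ℝ)))) (ε₁ • q)
    have h6 := Measure.integral_comp_smul (volume : Measure Space) (fun k => f (q, k) *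
        Complex.exp (-(Complex.I * (inner ℝ (ε₁ • q + ε₂ • k) x : ℝ)))) ε₂
    simp only [smul_smul, h22, one_smul] at h6
    rw [show (∫ k : Space, f (e (k, q)) * Complex.exp (-(Complex.I * (inner ℝ k x : ℝ)))) = _ from
      (integral_congr_ae (Eventually.of_forall fun k => by simp [he])).trans h5, h6]
    simp [habs]
  simp only [key]
  obtain ⟨ha, hb⟩ := integrable_fourierIntegral hF
  refine ⟨ha, hb.trans ?_⟩
  congr 1
  refine integral_congr_ae (Eventually.of_forall fun q => ?_)
  simp only [he]
  rw [zero_sub, smul_neg, smul_smul, neg_smul, mul_comm]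

/-! ### Kinematics on the mass shell -/

theorem eta_of_ne {σ ν : Fin 4} (h : σ ≠ ν) : η σ ν = 0 := Matrix.diagonal_apply_ne _ h

theorem eta_mul_self (σ : Fin 4) : η σ σ * η σ σ = 1 := by
  fin_cases σ <;> simp [η]

theorem eta_comm (σ ν : Fin 4) : η σ ν = η ν σ := by
  by_cases h : σ = ν
  · rw [h]
  · rw [eta_of_ne h, eta_of_ne (Ne.symm h)]

theorem lowerIndex_eq (v : Spacetime) (σ : Fin 4) : lowerIndex v σ = η σ σ * v σ := by
  unfold lowerIndex
  exact Finset.sum_eq_single σ (fun ν _ h => by rw [eta_of_ne h.symm, zero_mul]) (by simp)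

theorem lowerIndex_zero (v : Spacetime) : lowerIndex v 0 = v 0 := by
  rw [lowerIndex_eq]; simp [η]

theorem lowerIndex_succ (v : Spacetime) (k : Fin 3) : lowerIndex v k.succ = -v k.succ := by
  rw [lowerIndex_eq]; fin_cases k <;> simp [η]

theorem lowerIndex_add (v w : Spacetime) (σ : Fin 4) :
    lowerIndex (v + w) σ = lowerIndex v σ + lowerIndex w σ := by
  simp [lowerIndex_eq, mul_add]

theorem lowerIndex_sub (v w : Spacetime) (σ : Fin 4) :
    lowerIndex (v - w) σ = lowerIndex v σ - lowerIndex w σ := by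
  simp [lowerIndex_eq, mul_sub]

theorem lowerIndex_smul (c : ℝ) (v : Spacetime) (σ : Fin 4) :
    lowerIndex (c • v) σ = c * lowerIndex v σ := by
  simp [lowerIndex_eq, mul_left_comm]

theorem mdot_eq (v w : Spacetime) : mdot v w = ∑ σ, η σ σ * v σ * w σ := by
  simp [mdot, lowerIndex_eq]

theorem mdot_comm (v w : Spacetime) : mdot v w = mdot w v := by
  simp only [mdot_eq]; exact Finset.sum_congr rfl fun _ _ => by ring

theorem mdot_succ (v w : Spacetime) :
    mdot v w = v 0 * w 0 - ∑ k : Fin 3, v k.succ * w k.succ := by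
  simp only [mdot, Fin.sum_univ_succ (n := 3), lowerIndex_zero, lowerIndex_succ]
  rw [sub_eq_add_neg, ← Finset.sum_neg_distrib]
  simp

theorem mdot_smul_left (c : ℝ) (v w : Spacetime) : mdot (c • v) w = c * mdot v w := by
  simp only [mdot_eq, Finset.mul_sum]; exact Finset.sum_congr rfl fun _ _ => by simp; ring

theorem mdot_smul_right (c : ℝ) (v w : Spacetime) : mdot v (c • w) = c * mdot v w := by
  rw [mdot_comm, mdot_smul_left, mdot_comm]

theorem mdot_single (v : Spacetime) (σ : Fin 4) : mdot v (Pi.single σ 1) = lowerIndex v σ := by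
  simp [mdot, Pi.single_apply]

/-! ### Energy, on-shell momenta and the invariant density -/

variable {m : ℝ}

theorem energy_pos (hm : 0 < m) (q : Space) : 0 < energy m q := by
  have : 0 ≤ ∑ i, q i ^ 2 := Finset.sum_nonneg fun i _ => sq_nonneg _
  exact Real.sqrt_pos.2 (by positivity)

theorem energy_sq (q : Space) : energy m q ^ 2 = m ^ 2 + ∑ i, q i ^ 2 := by
  have : 0 ≤ ∑ i, q i ^ 2 := Finset.sum_nonneg fun i _ => sq_nonneg _
  exact Real.sq_sqrt (by positivity)

theorem energy_smul (ε : ℝ) (hε : ε ^ 2 = 1) (q : Space) : energy m (ε • q) = energy m q := by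
  simp [energy, mul_pow, hε]

theorem contDiff_coord (k : Fin 3) : ContDiff ℝ ∞ fun q : Space => q k :=
  (EuclideanSpace.proj k : Space →L[ℝ] ℝ).contDiff

theorem contDiff_energy (hm : 0 < m) : ContDiff ℝ ∞ (energy m) := by
  unfold energy
  refine ContDiff.sqrt (contDiff_const.add (ContDiff.sum fun i _ => (contDiff_coord i).pow 2))
    fun q => ?_
  have : 0 ≤ ∑ i, q i ^ 2 := Finset.sum_nonneg fun i _ => sq_nonneg _
  positivity

theorem onShell_zero (q : Space) : onShell m q 0 = energy m q := rfl

theorem onShell_succ (q : Space) (k : Fin 3) : onShell m q k.succ = q k := rfl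

theorem point_zero (t : ℝ) (x : Space) : point t x 0 = t := rfl

theorem point_succ (t : ℝ) (x : Space) (k : Fin 3) : point t x k.succ = x k := rfl

theorem contDiff_onShell (hm : 0 < m) (α : Fin 4) : ContDiff ℝ ∞ fun q => onShell m q α := by
  cases α using Fin.cases with
  | zero => exact contDiff_energy hm
  | succ k => exact contDiff_coord k

theorem continuous_onShell (hm : 0 < m) : Continuous (onShell m) :=
  continuous_pi fun α => (contDiff_onShell hm α).continuous

theorem contDiff_lowerIndex_onShell (hm : 0 < m) (σ : Fin 4) :
    ContDiff ℝ ∞ fun q => lowerIndex (onShell m q) σ := by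
  simp only [lowerIndex_eq]
  exact contDiff_const.mul (contDiff_onShell hm σ)

theorem contDiff_mdot_onShell (hm : 0 < m) (x : Spacetime) :
    ContDiff ℝ ∞ fun q => mdot (onShell m q) x := by
  unfold mdot
  exact ContDiff.sum fun σ _ => (contDiff_lowerIndex_onShell hm σ).mul contDiff_const

theorem shellDensity_eq (m : ℝ) (q : Space) :
    shellDensity m q = (2 * (2 * Real.pi) ^ 3)⁻¹ * (energy m q)⁻¹ := by
  rw [shellDensity, ← mul_inv]; ring_nf

theorem shellDensity_mul (hm : 0 < m) (q : Space) :
    (2 * Real.pi) ^ 3 * (2 * energy m q) * shellDensity m q = 1 := by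
  have := energy_pos hm q
  rw [shellDensity]
  exact mul_inv_cancel₀ (by positivity)

theorem contDiff_shellDensity (hm : 0 < m) : ContDiff ℝ ∞ (shellDensity m) := by
  have : shellDensity m = fun q => (2 * (2 * Real.pi) ^ 3)⁻¹ * (energy m q)⁻¹ :=
    funext (shellDensity_eq m)
  rw [this]
  exact contDiff_const.mul ((contDiff_energy hm).inv fun q => (energy_pos hm q).ne')

theorem contDiff_ofReal {E : Type*} [NormedAddCommGroup E] [NormedSpace ℝ E] {f : E → ℝ}
    (hf : ContDiff ℝ ∞ f) : ContDiff ℝ ∞ fun x => (f x : ℂ) :=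
  Complex.ofRealCLM.contDiff.comp hf

theorem fderiv_coord (q u : Space) (k : Fin 3) : fderiv ℝ (fun q : Space => q k) q u = u k := by
  have : HasFDerivAt (fun q : Space => q k)
      (EuclideanSpace.proj k : Space →L[ℝ] ℝ) q :=
    (EuclideanSpace.proj k : Space →L[ℝ] ℝ).hasFDerivAt
  rw [this.fderiv]
  rfl

theorem fderiv_energy (hm : 0 < m) (q u : Space) :
    fderiv ℝ (energy m) q u = (∑ k, q k * u k) / energy m q := by
  have hE := energy_pos hm q
  have h1 : fderiv ℝ (fun q => energy m q ^ 2) q u = 2 * ∑ k, q k * u k := by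
    simp only [energy_sq]
    rw [fderiv_const_add, fderiv_fun_sum fun k _ =>
      ((contDiff_coord k).pow 2).differentiable (by simp) q]
    simp only [_root_.sum_apply, Finset.mul_sum]
    refine Finset.sum_congr rfl fun k _ => ?_
    rw [fderiv_fun_pow 2 ((contDiff_coord k).differentiable (by simp) q)]
    simp [fderiv_coord]
    ring
  rw [fderiv_fun_pow 2 ((contDiff_energy hm).differentiable (by simp) q)] at h1
  simp at h1
  rw [eq_div_iff hE.ne']
  linarith

/-- Infinitesimal Lorentz transformations. -/
def IsLorentzGen (A : Matrix (Fin 4) (Fin 4) ℝ) : Prop :=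
  ∀ α β, η α α * A α β = -(η β β * A β α)

theorem isLorentzGen_zero : IsLorentzGen 0 := fun _ _ => by simp

theorem isLorentzGen_lorentzGen (σ τ : Fin 4) : IsLorentzGen (lorentzGen σ τ) := by
  have key : ∀ α β : Fin 4, η α α * lorentzGen σ τ α β = η τ α * η σ β - η σ α * η τ β := by
    intro α β
    have h : ∀ ρ κ : Fin 4, η α α * (if α = ρ then η κ β else 0) = η ρ α * η κ β := by
      intro ρ κ
      by_cases h : α = ρ
      · simp [h]
      · simp [h, eta_of_ne (Ne.symm h)]
    rw [lorentzGen, mul_sub, h, h]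
  intro α β
  rw [key, key]
  ring

/-- The velocity of spatial momenta under an infinitesimal Lorentz transformation. -/
noncomputable def velocity (m : ℝ) (A : Matrix (Fin 4) (Fin 4) ℝ) (q : Space) : Space :=
  WithLp.toLp 2 fun k : Fin 3 => (A *ᵥ onShell m q) k.succ

theorem velocity_apply (A : Matrix (Fin 4) (Fin 4) ℝ) (q : Space) (k : Fin 3) :
    velocity m A q k = A k.succ 0 * energy m q + ∑ l : Fin 3, A k.succ l.succ * q l := by
  simp only [velocity, Matrix.mulVec, dotProduct, Fin.sum_univ_succ (n := 3), onShell_zero,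
    onShell_succ]

theorem contDiff_velocity_apply (hm : 0 < m) (A : Matrix (Fin 4) (Fin 4) ℝ) (k : Fin 3) :
    ContDiff ℝ ∞ fun q => velocity m A q k := by
  simp only [velocity_apply]
  exact (contDiff_const.mul (contDiff_energy hm)).add
    (ContDiff.sum fun l _ => contDiff_const.mul (contDiff_coord l))

theorem contDiff_velocity (hm : 0 < m) (A : Matrix (Fin 4) (Fin 4) ℝ) :
    ContDiff ℝ ∞ (velocity m A) :=
  contDiff_euclidean.2 (contDiff_velocity_apply hm A)

theorem IsLorentzGen.spatial {A : Matrix (Fin 4) (Fin 4) ℝ} (hA : IsLorentzGen A) (k l : Fin 3) :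
    A k.succ l.succ = -A l.succ k.succ := by
  have h := hA k.succ l.succ
  have h1 : ∀ k : Fin 3, η k.succ k.succ = -1 := fun k => by fin_cases k <;> simp [η]
  rw [h1, h1] at h
  linarith

theorem IsLorentzGen.boost {A : Matrix (Fin 4) (Fin 4) ℝ} (hA : IsLorentzGen A) (k : Fin 3) :
    A k.succ 0 = A 0 k.succ := by
  have h := hA k.succ 0
  have h1 : η k.succ k.succ = -1 := by fin_cases k <;> simp [η]
  have h2 : η 0 0 = 1 := by simp [η]
  rw [h1, h2] at h
  linarith

theorem IsLorentzGen.diag {A : Matrix (Fin 4) (Fin 4) ℝ} (hA : IsLorentzGen A) (α : Fin 4) :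
    A α α = 0 := by
  have h := hA α α
  have h1 := eta_mul_self α
  have h2 : η α α * A α α = 0 := by linarith
  calc A α α = η α α * η α α * A α α := by rw [h1, one_mul]
    _ = 0 := by rw [mul_assoc, h2, mul_zero]

theorem sum_mul_antisymm {ι : Type*} [Fintype ι] (a : ι → ι → ℝ) (h : ∀ k l, a k l = -a l k)
    (x : ι → ℝ) : ∑ k, ∑ l, a k l * x l * x k = 0 := by
  have h1 : ∑ k, ∑ l, a k l * x l * x k = -∑ k, ∑ l, a k l * x l * x k := by
    conv_lhs => rw [Finset.sum_comm]
    simp only [← Finset.sum_neg_distrib]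
    refine Finset.sum_congr rfl fun k _ => Finset.sum_congr rfl fun l _ => ?_
    rw [h l k]; ring
  linarith

/-- The infinitesimal transformation is tangent to the mass shell: this is `p · Ap = 0`, solved for
the energy component. -/
theorem sum_mul_velocity {A : Matrix (Fin 4) (Fin 4) ℝ} (hA : IsLorentzGen A) (q : Space) :
    ∑ k, q k * velocity m A q k = energy m q * (A *ᵥ onShell m q) 0 := by
  have h0 := sum_mul_antisymm (fun k l : Fin 3 => A k.succ l.succ) (fun k l => hA.spatial k l)
    (fun k => q k)
  simp only [velocity_apply, mul_add, Finset.sum_add_distrib, Matrix.mulVec, dotProduct,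
    Fin.sum_univ_succ (n := 3), onShell_zero, onShell_succ, hA.diag 0, zero_mul, zero_add]
  have h1 : ∑ k : Fin 3, q k * ∑ l : Fin 3, A k.succ l.succ * q l = 0 := by
    rw [← h0]
    refine Finset.sum_congr rfl fun k _ => ?_
    rw [Finset.mul_sum]
    exact Finset.sum_congr rfl fun l _ => by ring
  rw [h1, add_zero, Finset.mul_sum]
  exact Finset.sum_congr rfl fun k _ => by rw [hA.boost]; ring

/-- The velocity prescribes only the spatial momentum; by tangency the energy follows, and the
four-momentum as a whole moves by `Ap`. -/
theorem fderiv_onShell_velocity (hm : 0 < m) {A : Matrix (Fin 4) (Fin 4) ℝ} (hA : IsLorentzGen A)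
    (q : Space) (α : Fin 4) :
    fderiv ℝ (fun q => onShell m q α) q (velocity m A q) = (A *ᵥ onShell m q) α := by
  cases α using Fin.cases with
  | zero =>
    have : (fun q => onShell m q 0) = energy m := rfl
    rw [this, fderiv_energy hm, sum_mul_velocity hA, mul_div_cancel_left₀ _ (energy_pos hm q).ne']
  | succ k =>
    have : (fun q => onShell m q k.succ) = fun q : Space => q k := rfl
    rw [this, fderiv_coord]
    rfl

theorem mdot_mulVec {A : Matrix (Fin 4) (Fin 4) ℝ} (hA : IsLorentzGen A) (v w : Spacetime) :
    mdot (A *ᵥ v) w = -mdot v (A *ᵥ w) := by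
  simp only [mdot_eq, Matrix.mulVec, dotProduct, Finset.mul_sum, Finset.sum_mul,
    ← Finset.sum_neg_distrib]
  rw [Finset.sum_comm]
  refine Finset.sum_congr rfl fun β _ => Finset.sum_congr rfl fun α _ => ?_
  linear_combination (v β * w α) * hA α β

theorem fderiv_mdot_onShell_velocity (hm : 0 < m) {A : Matrix (Fin 4) (Fin 4) ℝ}
    (hA : IsLorentzGen A) (q : Space) (x : Spacetime) :
    fderiv ℝ (fun q => mdot (onShell m q) x) q (velocity m A q) =
      -mdot (onShell m q) (A *ᵥ x) := by
  rw [← mdot_mulVec hA]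
  simp only [mdot_eq]
  rw [fderiv_fun_sum fun σ _ => ?_]
  · simp only [_root_.sum_apply]
    refine Finset.sum_congr rfl fun σ _ => ?_
    have hd := (contDiff_onShell hm σ).differentiable (by simp) q
    rw [fderiv_mul_const (hd.const_mul _), fderiv_const_mul hd]
    simp only [_root_.smul_apply, fderiv_onShell_velocity hm hA, smul_eq_mul]
    ring
  · exact ((contDiff_const.mul (contDiff_onShell hm σ)).mul contDiff_const).differentiable
      (by simp) q

theorem fderiv_energy_inv (hm : 0 < m) (q u : Space) :
    fderiv ℝ (fun q => (energy m q)⁻¹) q u = -(∑ k, q k * u k) / energy m q ^ 3 := by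
  have hE := energy_pos hm q
  have hd := (contDiff_energy hm).differentiable (by simp) q
  have h := ((hasDerivAt_inv hE.ne').comp_hasFDerivAt q hd.hasFDerivAt).fderiv
  have h' : fderiv ℝ (fun q => (energy m q)⁻¹) q u =
      -(energy m q ^ 2)⁻¹ * fderiv ℝ (energy m) q u := by
    rw [show (fun q => (energy m q)⁻¹) = (fun x => x⁻¹) ∘ energy m from rfl, h]
    simp
  rw [h', fderiv_energy hm]
  field_simp

/-- The Lorentz vector field is divergence-free for the invariant measure. After division by the
energy the boost part is constant, and the rotation part leaves `∑ A_{kl} (δ_{kl}/E - q_l q_k/E³)`,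
which vanishes because the spatial block of `A` is antisymmetric. -/
theorem sum_fderiv_shellDensity_mul_velocity (hm : 0 < m) {A : Matrix (Fin 4) (Fin 4) ℝ}
    (hA : IsLorentzGen A) (q : Space) :
    ∑ k, fderiv ℝ (fun q => shellDensity m q * velocity m A q k) q
      (EuclideanSpace.single k 1) = 0 := by
  have hE := energy_pos hm q
  have hdE : ∀ q, DifferentiableAt ℝ (energy m) q := (contDiff_energy hm).differentiable (by simp)
  have hdi : ∀ q, DifferentiableAt ℝ (fun q => (energy m q)⁻¹) q :=
    fun q => (hdE q).inv (energy_pos hm q).ne'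
  have h1 : ∀ k : Fin 3, fderiv ℝ (fun q => shellDensity m q * velocity m A q k) q
      (EuclideanSpace.single k 1) = (2 * (2 * Real.pi) ^ 3)⁻¹ * (-(energy m q ^ 3)⁻¹) *
        ∑ l : Fin 3, A k.succ l.succ * q l * q k := by
    intro k
    have h2 : (fun q => shellDensity m q * velocity m A q k) = fun q =>
        (2 * (2 * Real.pi) ^ 3)⁻¹ * (A k.succ 0 +
          ∑ l : Fin 3, A k.succ l.succ * ((energy m q)⁻¹ * q l)) := by
      funext q
      have := (energy_pos hm q).ne'
      rw [shellDensity_eq, velocity_apply, mul_assoc]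
      congr 1
      rw [mul_add, Finset.mul_sum]
      congr 1
      · field_simp
      · exact Finset.sum_congr rfl fun l _ => by ring
    have hl : ∀ l : Fin 3, DifferentiableAt ℝ (fun q : Space => (energy m q)⁻¹ * q l) q :=
      fun l => (hdi q).mul ((contDiff_coord l).differentiable (by simp) q)
    have hsum : DifferentiableAt ℝ
        (fun q : Space => ∑ l : Fin 3, A k.succ l.succ * ((energy m q)⁻¹ * q l)) q :=
      DifferentiableAt.fun_sum fun l _ => (hl l).const_mul _
    rw [h2, fderiv_const_mul (hsum.const_add _), fderiv_const_add,
      fderiv_fun_sum fun l _ => (hl l).const_mul _]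
    simp only [_root_.smul_apply, _root_.sum_apply, smul_eq_mul]
    rw [mul_assoc]
    congr 1
    rw [Finset.mul_sum]
    refine Finset.sum_congr rfl fun l _ => ?_
    rw [fderiv_const_mul (hl l), fderiv_fun_mul (hdi q)
      ((contDiff_coord l).differentiable (by simp) q)]
    simp only [_root_.smul_apply, _root_.add_apply, smul_eq_mul,
      fderiv_coord, fderiv_energy_inv hm]
    have h3 : ∑ j, q j * (EuclideanSpace.single k (1 : ℝ) : Space) j = q k := by
      simp [PiLp.single_apply]
    rw [h3, PiLp.single_apply]
    by_cases hkl : l = k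
    · subst hkl
      simp [hA.diag]
    · rw [if_neg hkl]
      ring
  simp only [h1]
  rw [← Finset.mul_sum, sum_mul_antisymm (fun k l : Fin 3 => A k.succ l.succ)
    (fun k l => hA.spatial k l) (fun k => q k), mul_zero]

theorem eq_sum_single (u : Space) : u = ∑ k, u k • EuclideanSpace.single k (1 : ℝ) := by
  ext i
  simp [Pi.single_apply]

theorem fderiv_ofReal {E : Type*} [NormedAddCommGroup E] [NormedSpace ℝ E] {f : E → ℝ} {x : E}
    (hf : DifferentiableAt ℝ f x) (v : E) :
    fderiv ℝ (fun x => (f x : ℂ)) x v = (fderiv ℝ f x v : ℂ) := by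
  have := (Complex.ofRealCLM.hasFDerivAt.comp x hf.hasFDerivAt).fderiv
  rw [show (fun x => (f x : ℂ)) = Complex.ofRealCLM ∘ f from rfl, this]
  rfl

/-- Invariance of the measure on the mass shell under Lorentz transformations. -/
theorem integral_shellDensity_fderiv_velocity (hm : 0 < m) {A : Matrix (Fin 4) (Fin 4) ℝ}
    (hA : IsLorentzGen A) {G : Space → ℂ} (hG : IsTestFun G) :
    ∫ q, (shellDensity m q : ℂ) * fderiv ℝ G q (velocity m A q) = 0 := by
  have hc : ∀ k, ContDiff ℝ ∞ fun q => shellDensity m q * velocity m A q k := fun k =>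
    (contDiff_shellDensity hm).mul (contDiff_velocity_apply hm A k)
  have h1 : ∀ q, (shellDensity m q : ℂ) * fderiv ℝ G q (velocity m A q) =
      ∑ k, ((shellDensity m q * velocity m A q k : ℝ) : ℂ) *
        fderiv ℝ G q (EuclideanSpace.single k 1) := by
    intro q
    conv_lhs => rw [eq_sum_single (velocity m A q)]
    rw [map_sum, Finset.mul_sum]
    refine Finset.sum_congr rfl fun k _ => ?_
    rw [map_smul, Complex.real_smul]
    push_cast
    ring
  simp only [h1]
  rw [integral_finsetSum _ fun k _ => (IsTestFun.mul_left (contDiff_ofReal (hc k))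
    (hG.fderiv_apply _)).integrable volume]
  simp only [IsTestFun.integral_mul_fderiv (contDiff_ofReal (hc _)) hG,
    fderiv_ofReal ((hc _).differentiable (by simp) _)]
  rw [Finset.sum_neg_distrib, ← integral_finsetSum]
  · simp only [← Finset.sum_mul, ← Complex.ofReal_sum,
      sum_fderiv_shellDensity_mul_velocity hm hA]
    simp
  · exact fun k _ => (IsTestFun.mul_left (contDiff_ofReal
      (((hc k).fderiv_right (m := ∞) (by simp)).clm_apply contDiff_const)) hG).integrable volume

/-! ### The one-parameter groups of Lorentz transformations -/

theorem exp_smul_mul_exp_neg_smul (A : Matrix (Fin 4) (Fin 4) ℝ) (t : ℝ) :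
    NormedSpace.exp (-(t • A)) * NormedSpace.exp (t • A) = 1 := by
  rw [← Matrix.exp_add_of_commute _ _ (Commute.neg_left (Commute.refl (t • A))), neg_add_cancel,
    NormedSpace.exp_zero]

theorem eta_mul_eta : η * η = 1 := by
  rw [η, Matrix.diagonal_mul_diagonal, ← Matrix.diagonal_one]
  congr 1
  funext i
  fin_cases i <;> simp

/-- The antisymmetry in the form of a conjugation, so that `Matrix.exp_conj` computes the transpose
of the exponential. -/
theorem IsLorentzGen.transpose_eq {A : Matrix (Fin 4) (Fin 4) ℝ} (hA : IsLorentzGen A) :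
    Aᵀ = η * (-A) * η⁻¹ := by
  rw [Matrix.inv_eq_left_inv eta_mul_eta]
  ext α β
  have h1 : (η * (-A) * η) α β = η α α * (-A α β) * η β β := by
    rw [η, Matrix.mul_diagonal, Matrix.diagonal_mul]
    simp
  rw [h1, Matrix.transpose_apply]
  have h := hA α β
  have h2 := eta_mul_self β
  linear_combination (η β β) * h - (A β α) * h2

/-- `exp(-A)` preserves the metric. -/
theorem IsLorentzGen.exp_isometry {A : Matrix (Fin 4) (Fin 4) ℝ} (hA : IsLorentzGen A) (t : ℝ) :
    (NormedSpace.exp (t • A))ᵀ * η * NormedSpace.exp (t • A) = η := by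
  have hu : IsUnit η := IsUnit.of_mul_eq_one _ eta_mul_eta
  have h1 : (t • A)ᵀ = η * (-(t • A)) * η⁻¹ := by
    rw [Matrix.transpose_smul, hA.transpose_eq]
    simp
  rw [← Matrix.exp_transpose, h1, Matrix.exp_conj _ _ hu, Matrix.inv_eq_left_inv eta_mul_eta,
    mul_assoc, mul_assoc, mul_assoc, ← mul_assoc η η, eta_mul_eta, one_mul,
    exp_smul_mul_exp_neg_smul, mul_one]

theorem mdot_eq_dotProduct (v w : Spacetime) : mdot v w = v ⬝ᵥ (η *ᵥ w) := by
  simp only [mdot_eq, dotProduct, η, Matrix.mulVec_diagonal, Matrix.diagonal_apply_eq]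
  exact Finset.sum_congr rfl fun _ _ => by ring

theorem IsLorentzGen.mdot_exp {A : Matrix (Fin 4) (Fin 4) ℝ} (hA : IsLorentzGen A) (t : ℝ)
    (v w : Spacetime) :
    mdot (NormedSpace.exp (t • A) *ᵥ v) (NormedSpace.exp (t • A) *ᵥ w) = mdot v w := by
  rw [mdot_eq_dotProduct, mdot_eq_dotProduct, ← Matrix.vecMul_transpose,
    ← Matrix.dotProduct_mulVec, Matrix.mulVec_mulVec, Matrix.mulVec_mulVec,
    hA.exp_isometry]

theorem mdot_onShell_self (q : Space) : mdot (onShell m q) (onShell m q) = m ^ 2 := by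
  have h := energy_sq (m := m) q
  rw [mdot_succ, onShell_zero]
  simp only [onShell_succ, ← sq]
  linarith

theorem contDiff_exp_smul_apply (A : Matrix (Fin 4) (Fin 4) ℝ) (α β : Fin 4) :
    ContDiff ℝ ∞ fun t : ℝ => NormedSpace.exp (t • A) α β := by
  -- A norm on matrices is chosen inside the proof only; the statement concerns a single entry and
  -- does not depend on the choice.
  let : NormedRing (Matrix (Fin 4) (Fin 4) ℝ) := Matrix.linftyOpNormedRing
  let : NormedAlgebra ℝ (Matrix (Fin 4) (Fin 4) ℝ) := Matrix.linftyOpNormedAlgebra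
  have h1 : ContDiff ℝ ∞ (NormedSpace.exp : Matrix (Fin 4) (Fin 4) ℝ → _) :=
    contDiff_iff_contDiffAt.2 fun x => (NormedSpace.exp_analytic (𝕂 := ℝ) x).contDiffAt
  have h2 : ContDiff ℝ ∞ fun t : ℝ => NormedSpace.exp (t • A) :=
    h1.comp (contDiff_id.smul contDiff_const)
  let L : Matrix (Fin 4) (Fin 4) ℝ →ₗ[ℝ] ℝ := Matrix.entryLinearMap ℝ ℝ α β
  exact (LinearMap.toContinuousLinearMap L).contDiff.comp h2

theorem hasDerivAt_exp_smul_apply (A : Matrix (Fin 4) (Fin 4) ℝ) (α β : Fin 4) :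
    HasDerivAt (fun t : ℝ => NormedSpace.exp (t • A) α β) (A α β) 0 := by
  let : NormedRing (Matrix (Fin 4) (Fin 4) ℝ) := Matrix.linftyOpNormedRing
  let : NormedAlgebra ℝ (Matrix (Fin 4) (Fin 4) ℝ) := Matrix.linftyOpNormedAlgebra
  have h2 := hasDerivAt_exp_smul_const (𝕂 := ℝ) A (0 : ℝ)
  let L : Matrix (Fin 4) (Fin 4) ℝ →ₗ[ℝ] ℝ := Matrix.entryLinearMap ℝ ℝ α β
  have h3 := (LinearMap.toContinuousLinearMap L).hasFDerivAt.comp_hasDerivAt (0 : ℝ) h2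
  rw [zero_smul, NormedSpace.exp_zero, one_mul] at h3
  exact h3

/-- The spatial part of `exp(tA)p` for `p` on the mass shell. -/
noncomputable def flow (m : ℝ) (A : Matrix (Fin 4) (Fin 4) ℝ) (t : ℝ) (q : Space) : Space :=
  WithLp.toLp 2 fun k : Fin 3 => (NormedSpace.exp (t • A) *ᵥ onShell m q) k.succ

theorem contDiff_exp_mulVec (hm : 0 < m) (A : Matrix (Fin 4) (Fin 4) ℝ) (α : Fin 4) :
    ContDiff ℝ ∞ fun z : ℝ × Space => (NormedSpace.exp (z.1 • A) *ᵥ onShell m z.2) α := by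
  unfold Matrix.mulVec dotProduct
  exact ContDiff.sum fun β _ => ((contDiff_exp_smul_apply A α β).comp contDiff_fst).mul
    ((contDiff_onShell hm β).comp contDiff_snd)

theorem contDiff_flow (hm : 0 < m) (A : Matrix (Fin 4) (Fin 4) ℝ) :
    ContDiff ℝ ∞ fun z : ℝ × Space => flow m A z.1 z.2 :=
  contDiff_euclidean.2 fun k => contDiff_exp_mulVec hm A k.succ

/-- The energy along the one-parameter group is continuous and positive at `t = 0`. It has no zero,
because a vector with vanishing time component cannot have the positive square `m²`. Hence the sign
never changes. -/
theorem IsLorentzGen.exp_mulVec_onShell_pos (hm : 0 < m) {A : Matrix (Fin 4) (Fin 4) ℝ}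
    (hA : IsLorentzGen A) (t : ℝ) (q : Space) :
    0 < (NormedSpace.exp (t • A) *ᵥ onShell m q) 0 := by
  set f : ℝ → ℝ := fun t => (NormedSpace.exp (t • A) *ᵥ onShell m q) 0 with hf
  have hcont : Continuous f := (contDiff_exp_mulVec hm A 0).continuous.comp
    (Continuous.prodMk_left q)
  have h0 : 0 < f 0 := by
    simp only [hf, zero_smul, NormedSpace.exp_zero, Matrix.one_mulVec, onShell_zero]
    exact energy_pos hm q
  have hne : ∀ t, f t ≠ 0 := by
    intro t ht
    have h1 := hA.mdot_exp t (onShell m q) (onShell m q)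
    rw [mdot_onShell_self, mdot_succ, show (NormedSpace.exp (t • A) *ᵥ onShell m q) 0 = 0 from ht]
      at h1
    have h2 : 0 ≤ ∑ k : Fin 3, (NormedSpace.exp (t • A) *ᵥ onShell m q) k.succ *
      (NormedSpace.exp (t • A) *ᵥ onShell m q) k.succ :=
      Finset.sum_nonneg fun k _ => mul_self_nonneg _
    nlinarith [pow_pos hm 2]
  by_contra hlt
  obtain ⟨s, hs⟩ := mem_range_of_exists_le_of_exists_ge hcont ⟨t, not_lt.1 hlt⟩ ⟨0, h0.le⟩
  exact hne s hs

/-- The square `m²` is preserved and determines the energy up to sign; the sign is fixed by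
`IsLorentzGen.exp_mulVec_onShell_pos`. -/
theorem IsLorentzGen.onShell_flow (hm : 0 < m) {A : Matrix (Fin 4) (Fin 4) ℝ}
    (hA : IsLorentzGen A) (t : ℝ) (q : Space) :
    onShell m (flow m A t q) = NormedSpace.exp (t • A) *ᵥ onShell m q := by
  funext α
  cases α using Fin.cases with
  | zero =>
    have hpos := hA.exp_mulVec_onShell_pos hm t q
    have h1 := hA.mdot_exp t (onShell m q) (onShell m q)
    rw [mdot_onShell_self, mdot_succ] at h1
    rw [onShell_zero, energy, Real.sqrt_eq_iff_mul_self_eq_of_pos hpos, ← h1]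
    simp [flow, sq]
  | succ k => rfl

theorem IsLorentzGen.flow_neg_flow (hm : 0 < m) {A : Matrix (Fin 4) (Fin 4) ℝ}
    (hA : IsLorentzGen A) (t : ℝ) (q : Space) : flow m A (-t) (flow m A t q) = q := by
  ext k
  rw [flow]
  simp only [hA.onShell_flow hm, Matrix.mulVec_mulVec, neg_smul, exp_smul_mul_exp_neg_smul,
    Matrix.one_mulVec, onShell_succ]

theorem flow_zero (A : Matrix (Fin 4) (Fin 4) ℝ) (q : Space) : flow m A 0 q = q := by
  ext k
  simp [flow, onShell_succ]

theorem hasDerivAt_flow (A : Matrix (Fin 4) (Fin 4) ℝ) (q : Space) :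
    HasDerivAt (fun t => flow m A t q) (velocity m A q) 0 := by
  rw [← hasDerivWithinAt_univ, hasDerivWithinAt_iff_hasFDerivWithinAt, hasFDerivWithinAt_euclidean]
  intro k
  have : HasDerivAt (fun t : ℝ => ∑ β, NormedSpace.exp (t • A) k.succ β * onShell m q β)
      (∑ β, A k.succ β * onShell m q β) 0 :=
    HasDerivAt.fun_sum fun β _ => (hasDerivAt_exp_smul_apply A k.succ β).mul_const _
  convert! this.hasFDerivAt.hasFDerivWithinAt using 1

/-! ### The scalar product of Fock space -/

variable {m : ℝ} {s : ℕ}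

/-- A continuous left inverse confines the support of the composition to the image of a compact set.
This covers inverse flows as well as closed embeddings such as the diagonal or the insertion of a
particle. -/
theorem IsTestFun.comp_of_leftInverse {E F X : Type} [NormedAddCommGroup E] [NormedSpace ℝ E]
    [NormedAddCommGroup F] [NormedSpace ℝ F] [NormedAddCommGroup X] [NormedSpace ℝ X]
    {f : E → F} (hf : IsTestFun f) {g : X → E} (hg : ContDiff ℝ ∞ g) {h : E → X}
    (hh : Continuous h) (hhg : ∀ x, h (g x) = x) : IsTestFun fun x => f (g x) :=
  ⟨hf.smooth.comp hg, HasCompactSupport.intro (hf.compact.image hh) fun x hx =>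
    image_eq_zero_of_notMem_tsupport fun hx' => hx ⟨g x, hx', hhg x⟩⟩

/-- The sign `(-1)^s η_{μ_1μ_1} ⋯ η_{μ_sμ_s}`. -/
noncomputable def gram (μ : Fin s → Fin 4) : ℝ := (-1) ^ s * ∏ j, η (μ j) (μ j)

/-- The integrand of the scalar product of `n`-particle wave functions. -/
noncomputable def pairDensity (m : ℝ) {n : ℕ}
    (c : (Fin n → Space) → (Fin n → Fin s → Fin 4) → ℂ) (p : Fin n → Space) : ℂ :=
  ((∏ i, shellDensity m (p i) : ℝ) : ℂ) *
    ∑ μ : Fin n → Fin s → Fin 4, ((∏ i, gram (μ i) : ℝ) : ℂ) * c p μ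

theorem fockInner_eq_tsum (Φ Ψ : WaveFun s) : fockInner m Φ Ψ =
    ∑' n, ∫ p, pairDensity m (fun p μ => conj (Φ n p μ) * Ψ n p μ) p := rfl

/-- The hypothesis is on products, so it is enough that one of the two vectors has finitely many
particles. -/
theorem fockInner_eq_sum {Φ Ψ : WaveFun s} {N : ℕ}
    (h : ∀ n, N ≤ n → ∀ p μ, conj (Φ n p μ) * Ψ n p μ = 0) : fockInner m Φ Ψ =
    ∑ n ∈ Finset.range N, ∫ p, pairDensity m (fun p μ => conj (Φ n p μ) * Ψ n p μ) p := by
  rw [fockInner_eq_tsum, tsum_eq_sum]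
  intro n hn
  have hn' : N ≤ n := by simpa using hn
  simp [pairDensity, h n hn']

theorem conj_pairDensity {n : ℕ} (c : (Fin n → Space) → (Fin n → Fin s → Fin 4) → ℂ)
    (p : Fin n → Space) :
    conj (pairDensity m c p) = pairDensity m (fun p μ => conj (c p μ)) p := by
  simp only [pairDensity, map_mul, Complex.conj_ofReal, map_sum]

theorem conj_fockInner (Φ Ψ : WaveFun s) : conj (fockInner m Φ Ψ) = fockInner m Ψ Φ := by
  rw [fockInner_eq_tsum, fockInner_eq_tsum, Complex.conj_tsum]
  refine tsum_congr fun n => ?_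
  rw [← integral_conj]
  refine integral_congr_ae (Eventually.of_forall fun p => ?_)
  simp only [conj_pairDensity, map_mul, Complex.conj_conj, mul_comm]

theorem mul_pairDensity {n : ℕ} (a : ℂ) (c : (Fin n → Space) → (Fin n → Fin s → Fin 4) → ℂ)
    (p : Fin n → Space) : a * pairDensity m c p = pairDensity m (fun p μ => a * c p μ) p := by
  simp only [pairDensity, mul_left_comm _ a, Finset.mul_sum]

theorem integral_pairDensity {n : ℕ} {Z : Type*} [MeasureSpace Z]
    {c : Z → (Fin n → Space) → (Fin n → Fin s → Fin 4) → ℂ} (p : Fin n → Space)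
    (h : ∀ μ, Integrable fun z => c z p μ) :
    ∫ z, pairDensity m (c z) p = pairDensity m (fun p μ => ∫ z, c z p μ) p := by
  simp only [pairDensity]
  rw [integral_const_mul, integral_finsetSum _ fun μ _ => (h μ).const_mul _]
  simp only [integral_const_mul]

section PairDensity

variable {n : ℕ} {X : Type} [NormedAddCommGroup X] [NormedSpace ℝ X]

theorem contDiff_prod_shellDensity (hm : 0 < m) {P : X → Fin n → Space} (hP : ContDiff ℝ ∞ P) :
    ContDiff ℝ ∞ fun x => ((∏ i, shellDensity m (P x i) : ℝ) : ℂ) :=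
  contDiff_ofReal (contDiff_prod fun i _ => (contDiff_shellDensity hm).comp
    ((contDiff_apply ℝ Space i).comp hP))

theorem IsTestFun.pairDensity (hm : 0 < m) {P : X → Fin n → Space} (hP : ContDiff ℝ ∞ P)
    {c : X → (Fin n → Space) → (Fin n → Fin s → Fin 4) → ℂ}
    (hc : ∀ μ, IsTestFun fun x => c x (P x) μ) :
    IsTestFun fun x => Proca.pairDensity m (c x) (P x) :=
  IsTestFun.mul_left (contDiff_prod_shellDensity hm hP)
    (IsTestFun.sum _ fun μ _ => (hc μ).const_mul _)

end PairDensity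

/-- Pairs of Fock vectors with a finite number of particles and smooth, compactly supported
products. -/
structure IsPairing (Φ Ψ : WaveFun s) : Prop where
  finite : ∃ N, ∀ n, N ≤ n → ∀ p μ, conj (Φ n p μ) * Ψ n p μ = 0
  test : ∀ n μ, IsTestFun fun p : Fin n → Space => conj (Φ n p μ) * Ψ n p μ

theorem IsPairing.integrable (hm : 0 < m) {Φ Ψ : WaveFun s} (h : IsPairing Φ Ψ) (n : ℕ) :
    Integrable (pairDensity m (fun p μ => conj (Φ n p μ) * Ψ n p μ)) :=
  (IsTestFun.pairDensity (c := fun _ p μ => conj (Φ n p μ) * Ψ n p μ) hm contDiff_id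
    (h.test n)).integrable volume

theorem fockInner_add_right (hm : 0 < m) {Φ Ψ Ψ' : WaveFun s} (h : IsPairing Φ Ψ)
    (h' : IsPairing Φ Ψ') :
    fockInner m Φ (Ψ + Ψ') = fockInner m Φ Ψ + fockInner m Φ Ψ' := by
  obtain ⟨N, hN⟩ := h.finite
  obtain ⟨N', hN'⟩ := h'.finite
  rw [fockInner_eq_sum (N := max N N') fun n hn => hN n (le_trans (le_max_left _ _) hn),
    fockInner_eq_sum (N := max N N') fun n hn => hN' n (le_trans (le_max_right _ _) hn),
    fockInner_eq_sum (N := max N N'), ← Finset.sum_add_distrib]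
  · refine Finset.sum_congr rfl fun n _ => ?_
    rw [← integral_add (h.integrable hm n) (h'.integrable hm n)]
    refine integral_congr_ae (Eventually.of_forall fun p => ?_)
    simp only [pairDensity, Pi.add_apply, mul_add, Finset.sum_add_distrib]
  · intro n hn p μ
    rw [Pi.add_apply, Pi.add_apply, Pi.add_apply, mul_add,
      hN n (le_trans (le_max_left _ _) hn), hN' n (le_trans (le_max_right _ _) hn), add_zero]

theorem fockInner_smul_right (c : ℂ) (Φ Ψ : WaveFun s) :
    fockInner m Φ (c • Ψ) = c * fockInner m Φ Ψ := by
  rw [fockInner_eq_tsum, fockInner_eq_tsum, ← tsum_mul_left]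
  refine tsum_congr fun n => ?_
  rw [← integral_const_mul]
  refine integral_congr_ae (Eventually.of_forall fun p => ?_)
  simp only [pairDensity, Pi.smul_apply, smul_eq_mul, mul_left_comm _ c, ← Finset.mul_sum]

theorem fockInner_zero_right (Φ : WaveFun s) : fockInner m Φ 0 = 0 := by
  simpa using fockInner_smul_right (m := m) 0 Φ 0

theorem IsPairing.zero (Φ : WaveFun s) : IsPairing Φ 0 :=
  ⟨⟨0, fun n _ p μ => by simp⟩, fun n μ => by simpa using IsTestFun.zero⟩

theorem IsPairing.add {Φ Ψ Ψ' : WaveFun s} (h : IsPairing Φ Ψ) (h' : IsPairing Φ Ψ') :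
    IsPairing Φ (Ψ + Ψ') := by
  obtain ⟨N, hN⟩ := h.finite
  obtain ⟨N', hN'⟩ := h'.finite
  refine ⟨⟨max N N', fun n hn p μ => ?_⟩, fun n μ => ?_⟩
  · rw [Pi.add_apply, Pi.add_apply, Pi.add_apply, mul_add,
      hN n (le_trans (le_max_left _ _) hn), hN' n (le_trans (le_max_right _ _) hn), add_zero]
  · simpa [mul_add] using (h.test n μ).add (h'.test n μ)

theorem IsPairing.smul {Φ Ψ : WaveFun s} (h : IsPairing Φ Ψ) (c : ℂ) : IsPairing Φ (c • Ψ) := by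
  obtain ⟨N, hN⟩ := h.finite
  refine ⟨⟨N, fun n hn p μ => ?_⟩, fun n μ => ?_⟩
  · rw [Pi.smul_apply, Pi.smul_apply, Pi.smul_apply, smul_eq_mul, mul_left_comm, hN n hn, mul_zero]
  · simpa [mul_left_comm] using (h.test n μ).const_mul c

theorem IsPairing.sum {ι : Type*} (t : Finset ι) {Φ : WaveFun s} {Ψ : ι → WaveFun s}
    (h : ∀ i ∈ t, IsPairing Φ (Ψ i)) : IsPairing Φ (∑ i ∈ t, Ψ i) := by
  classical
  induction t using Finset.induction_on with
  | empty => exact IsPairing.zero Φ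
  | insert i t hi ih =>
    rw [Finset.sum_insert hi]
    exact (h i (by simp)).add (ih fun j hj => h j (by simp [hj]))

theorem fockInner_sum_right (hm : 0 < m) {ι : Type*} (t : Finset ι) {Φ : WaveFun s}
    {Ψ : ι → WaveFun s} (h : ∀ i ∈ t, IsPairing Φ (Ψ i)) :
    fockInner m Φ (∑ i ∈ t, Ψ i) = ∑ i ∈ t, fockInner m Φ (Ψ i) := by
  classical
  induction t using Finset.induction_on with
  | empty => simp [fockInner_zero_right]
  | insert i t hi ih =>
    rw [Finset.sum_insert hi, Finset.sum_insert hi,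
      fockInner_add_right hm (h i (by simp)) (IsPairing.sum t fun j hj => h j (by simp [hj])),
      ih fun j hj => h j (by simp [hj])]

/-! ### Families of Fock vectors depending on momenta -/

section Families

variable {Z : Type} [NormedAddCommGroup Z] [NormedSpace ℝ Z]

/-- Pairs of families of Fock vectors with smooth, compactly supported products. -/
structure IsTestPair (Θ₁ Θ₂ : Z → WaveFun s) : Prop where
  finite : ∃ N, ∀ n, N ≤ n → ∀ z p μ, conj (Θ₁ z n p μ) * Θ₂ z n p μ = 0
  test : ∀ n μ, IsTestFun fun y : Z × (Fin n → Space) => conj (Θ₁ y.1 n y.2 μ) * Θ₂ y.1 n y.2 μ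

namespace IsTestPair

variable {Θ₁ Θ₂ : Z → WaveFun s}

theorem isPairing (h : IsTestPair Θ₁ Θ₂) (z : Z) : IsPairing (Θ₁ z) (Θ₂ z) := by
  obtain ⟨N, hN⟩ := h.finite
  exact ⟨⟨N, fun n hn p μ => hN n hn z p μ⟩, fun n μ => (h.test n μ).of_prod_mk z⟩

theorem isTestFun_pairDensity (hm : 0 < m) (h : IsTestPair Θ₁ Θ₂) (n : ℕ) :
    IsTestFun fun y : Z × (Fin n → Space) =>
      pairDensity m (fun p μ => conj (Θ₁ y.1 n p μ) * Θ₂ y.1 n p μ) y.2 :=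
  IsTestFun.pairDensity (c := fun (y : Z × (Fin n → Space)) p μ =>
    conj (Θ₁ y.1 n p μ) * Θ₂ y.1 n p μ) hm contDiff_snd (h.test n)

theorem isTestFun (hm : 0 < m) (h : IsTestPair Θ₁ Θ₂) :
    IsTestFun fun z => fockInner m (Θ₁ z) (Θ₂ z) := by
  obtain ⟨N, hN⟩ := h.finite
  simp only [fun z => fockInner_eq_sum (m := m) (Φ := Θ₁ z) (Ψ := Θ₂ z) (N := N)
    fun n hn => hN n hn z]
  exact IsTestFun.sum _ fun n _ => (h.isTestFun_pairDensity hm n).integral_param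

/-- Fubini: smearing in the momentum of an annihilated particle commutes with the scalar product.
This turns matrix elements of fields into Fourier integrals of matrix elements of `ann`. -/
theorem integral_mul_fockInner (hm : 0 < m) (h : IsTestPair Θ₁ Θ₂) [MeasureSpace Z]
    [BorelSpace Z] [SecondCountableTopology Z] [SFinite (volume : Measure Z)]
    [IsFiniteMeasureOnCompacts (volume : Measure Z)] {c : Z → ℂ} (hc : Continuous c) :
    ∫ z, c z * fockInner m (Θ₁ z) (Θ₂ z) =
      ∑' n, ∫ p, pairDensity m (fun p μ => ∫ z, c z * (conj (Θ₁ z n p μ) * Θ₂ z n p μ)) p := by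
  obtain ⟨N, hN⟩ := h.finite
  simp only [fun z => fockInner_eq_sum (m := m) (Φ := Θ₁ z) (Ψ := Θ₂ z) (N := N)
    fun n hn => hN n hn z]
  rw [tsum_eq_sum (s := Finset.range N)]
  · simp only [Finset.mul_sum]
    rw [integral_finsetSum]
    · refine Finset.sum_congr rfl fun n _ => ?_
      have hint : Integrable (fun y : Z × (Fin n → Space) => c y.1 *
          pairDensity m (fun p μ => conj (Θ₁ y.1 n p μ) * Θ₂ y.1 n p μ) y.2)
          (volume.prod volume) :=
        ((hc.comp continuous_fst).mul (h.isTestFun_pairDensity hm n).continuous)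
          |>.integrable_of_hasCompactSupport (h.isTestFun_pairDensity hm n).compact.mul_left
      simp only [← integral_const_mul]
      rw [integral_integral_swap (f := fun z p => c z *
        pairDensity m (fun p μ => conj (Θ₁ z n p μ) * Θ₂ z n p μ) p) hint]
      refine integral_congr_ae (Eventually.of_forall fun p => ?_)
      simp only [mul_pairDensity]
      refine integral_pairDensity (c := fun z p μ => c z * (conj (Θ₁ z n p μ) * Θ₂ z n p μ))
        p fun μ => ?_
      have ht : IsTestFun fun z => conj (Θ₁ z n p μ) * Θ₂ z n p μ :=
        (h.test n μ).comp_of_leftInverse (g := fun z => (z, p)) (contDiff_id.prodMk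
          contDiff_const) continuous_fst fun _ => rfl
      exact (hc.mul ht.continuous).integrable_of_hasCompactSupport ht.compact.mul_left
    · intro n _
      have ht := (h.isTestFun_pairDensity hm n).integral_param (μ := (volume : Measure (Fin n → Space)))
      exact (hc.mul ht.continuous).integrable_of_hasCompactSupport ht.compact.mul_left
  · intro n hn
    have hn' : N ≤ n := by simpa using hn
    simp [pairDensity, hN n hn']

theorem fderiv_right {Φ : WaveFun s} (h : IsTestPair (fun _ => Φ) Θ₂)
    (hΘ : ∀ n μ, ContDiff ℝ ∞ fun y : Z × (Fin n → Space) => Θ₂ y.1 n y.2 μ) (v : Z) :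
    IsTestPair (fun _ => Φ) fun z n p μ => fderiv ℝ (fun z => Θ₂ z n p μ) z v := by
  -- As `Φ` is independent of `z`, the derivative of `Θ₂` times the conjugate of `Φ` is a partial
  -- derivative of the product, and only products are known to have compact support.
  have key : ∀ n z p μ, conj (Φ n p μ) * fderiv ℝ (fun z => Θ₂ z n p μ) z v =
      fderiv ℝ (fun y : Z × (Fin n → Space) => conj (Φ n y.2 μ) * Θ₂ y.1 n y.2 μ) (z, p) (v, 0) := by
    intro n z p μ
    have h1 : HasFDerivAt (fun y : Z × (Fin n → Space) => conj (Φ n y.2 μ) * Θ₂ y.1 n y.2 μ) _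
      (z, p) := ((h.test n μ).differentiable _).hasFDerivAt
    have h2 := (HasFDerivAt.comp (g := fun y : Z × (Fin n → Space) =>
      conj (Φ n y.2 μ) * Θ₂ y.1 n y.2 μ) (f := fun z => (z, p)) z h1
      (hasFDerivAt_prodMk_left z p)).fderiv
    have h3 : DifferentiableAt ℝ (fun z => Θ₂ z n p μ) z :=
      ((hΘ n μ).comp (contDiff_id.prodMk contDiff_const)).differentiable (by simp) z
    have h4 := congrArg (fun L => L v) h2
    simp only [Function.comp_def] at h4
    rw [fderiv_const_mul h3] at h4
    simpa using h4
  obtain ⟨N, hN⟩ := h.finite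
  refine ⟨⟨N, fun n hn z p μ => ?_⟩, fun n μ => ?_⟩
  · rw [key]
    simp [hN n hn]
  · simp only [key]
    exact (h.test n μ).fderiv_apply (v, 0)

theorem fderiv_fockInner (hm : 0 < m) {Φ : WaveFun s} (h : IsTestPair (fun _ => Φ) Θ₂)
    (hΘ : ∀ n μ, ContDiff ℝ ∞ fun y : Z × (Fin n → Space) => Θ₂ y.1 n y.2 μ) (z v : Z) :
    fderiv ℝ (fun z => fockInner m Φ (Θ₂ z)) z v =
      fockInner m Φ fun n p μ => fderiv ℝ (fun z => Θ₂ z n p μ) z v := by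
  obtain ⟨N, hN⟩ := h.finite
  obtain ⟨N', hN'⟩ := (h.fderiv_right hΘ v).finite
  simp only [fun z => fockInner_eq_sum (m := m) (Φ := Φ) (Ψ := Θ₂ z) (N := max N N')
    fun n hn => hN n (le_trans (le_max_left _ _) hn) z]
  rw [fockInner_eq_sum (N := max N N') fun n hn => hN' n (le_trans (le_max_right _ _) hn) z,
    fderiv_fun_sum fun n _ =>
      ((h.isTestFun_pairDensity hm n).integral_param (μ := volume)).differentiable z,
    _root_.sum_apply]
  refine Finset.sum_congr rfl fun n _ => ?_
  rw [fderiv_integral_param (h.isTestFun_pairDensity hm n)]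
  refine integral_congr_ae (Eventually.of_forall fun p => ?_)
  have h3 : ∀ μ, DifferentiableAt ℝ (fun z => Θ₂ z n p μ) z := fun μ =>
    ((hΘ n μ).comp (contDiff_id.prodMk contDiff_const)).differentiable (by simp) z
  simp only [pairDensity]
  rw [fderiv_const_mul (DifferentiableAt.fun_sum fun μ _ =>
      ((h3 μ).const_mul _).const_mul _), fderiv_fun_sum fun μ _ => ((h3 μ).const_mul _).const_mul _]
  simp only [_root_.smul_apply, _root_.sum_apply, smul_eq_mul]
  congr 1
  refine Finset.sum_congr rfl fun μ _ => ?_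
  rw [fderiv_const_mul ((h3 μ).const_mul _), fderiv_const_mul (h3 μ)]
  simp

end IsTestPair

end Families

/-! ### Splitting off one particle -/

theorem contDiff_vecCons {n : ℕ} {X : Type} [NormedAddCommGroup X] [NormedSpace ℝ X]
    {f : X → Space} {g : X → Fin n → Space} (hf : ContDiff ℝ ∞ f) (hg : ContDiff ℝ ∞ g) :
    ContDiff ℝ ∞ fun x => (Matrix.vecCons (f x) (g x) : Fin (n + 1) → Space) := by
  refine contDiff_pi.2 fun i => ?_
  cases i using Fin.cases with
  | zero => exact hf
  | succ i => exact (contDiff_apply ℝ Space i).comp hg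

theorem integral_vecCons {n : ℕ} (F : (Fin (n + 1) → Space) → ℂ) :
    ∫ p, F p = ∫ z : Space × (Fin n → Space), F (Matrix.vecCons z.1 z.2) := by
  have h := (volume_preserving_piFinSuccAbove (fun _ : Fin (n + 1) => Space) 0).symm
  rw [← h.integral_comp' F]
  refine integral_congr_ae (Eventually.of_forall fun z => ?_)
  exact congrArg F (Fin.insertNth_zero' z.1 z.2)

theorem sum_vecCons {n : ℕ} {A : Type*} [Fintype A] (F : (Fin (n + 1) → A) → ℂ) :
    ∑ μ, F μ = ∑ a, ∑ κ : Fin n → A, F (Matrix.vecCons a κ) := by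
  rw [← (Fin.consEquiv (fun _ : Fin (n + 1) => A)).sum_comp, Fintype.sum_prod_type]
  rfl

/-- The densities, the signs and the index sums all factor over the particles, so the first particle
can be split off. -/
theorem pairDensity_vecCons {n : ℕ}
    (c : (Fin (n + 1) → Space) → (Fin (n + 1) → Fin s → Fin 4) → ℂ) (q : Space)
    (p : Fin n → Space) :
    pairDensity m c (Matrix.vecCons q p) = (shellDensity m q : ℂ) * ∑ μ, (gram μ : ℂ) *
      pairDensity m (fun p κ => c (Matrix.vecCons q p) (Matrix.vecCons μ κ)) p := by
  simp only [pairDensity, sum_vecCons, Fin.prod_univ_succ, Matrix.cons_val_zero,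
    Matrix.cons_val_succ, Finset.mul_sum]
  refine Finset.sum_congr rfl fun μ _ => Finset.sum_congr rfl fun κ _ => ?_
  push_cast
  ring

/-- The annihilation operator `a_ν(q)`. -/
noncomputable def ann (ν : Fin s → Fin 4) (q : Space) (Ψ : WaveFun s) : WaveFun s :=
  fun n p κ => (Real.sqrt (n + 1) : ℂ) * Ψ (n + 1) (Matrix.vecCons q p) (Matrix.vecCons ν κ)

/-- Finite-particle vectors with smooth, compactly supported and symmetric wave functions. -/
structure IsTestVector (Ψ : WaveFun s) : Prop where
  finite : ∃ N, ∀ n, N ≤ n → Ψ n = 0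
  test : ∀ n μ, IsTestFun fun p => Ψ n p μ
  bose : ∀ n (e : Equiv.Perm (Fin n)) p μ, Ψ n (p ∘ e) (μ ∘ e) = Ψ n p μ

theorem IsFockVector.isTestVector {Ψ : WaveFun s} (h : IsFockVector m s Ψ) : IsTestVector Ψ := by
  obtain ⟨N, hN⟩ := h.finite
  exact ⟨⟨N + 1, fun n hn => hN n hn⟩, fun n μ => ⟨h.smooth n μ, h.compact n μ⟩, h.bose⟩

namespace IsTestVector

variable {Φ Ψ : WaveFun s}

theorem ann_finite (h : IsTestVector Ψ) : ∃ N, ∀ n, N ≤ n → ∀ ν q, ann ν q Ψ n = 0 := by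
  obtain ⟨N, hN⟩ := h.finite
  refine ⟨N, fun n hn ν q => ?_⟩
  funext p κ
  simp [ann, hN (n + 1) (by omega)]

theorem test_vecCons (h : IsTestVector Ψ) (n : ℕ) (μ : Fin (n + 1) → Fin s → Fin 4) :
    IsTestFun fun y : Space × (Fin n → Space) => Ψ (n + 1) (Matrix.vecCons y.1 y.2) μ :=
  (h.test (n + 1) μ).comp_of_leftInverse (contDiff_vecCons contDiff_fst contDiff_snd)
    (h := fun p => (p 0, fun i => p i.succ)) (by fun_prop) fun _ => rfl

theorem ann_test (h : IsTestVector Ψ) (n : ℕ) (ν : Fin s → Fin 4) (κ : Fin n → Fin s → Fin 4) :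
    IsTestFun fun y : Space × (Fin n → Space) => ann ν y.1 Ψ n y.2 κ :=
  (h.test_vecCons n _).const_mul _

theorem ann_ann_test (h : IsTestVector Ψ) (n : ℕ) (μ ν : Fin s → Fin 4)
    (κ : Fin n → Fin s → Fin 4) :
    IsTestFun fun y : (Space × Space) × (Fin n → Space) => ann μ y.1.1 (ann ν y.1.2 Ψ) n y.2 κ := by
  have h1 : IsTestFun fun y : (Space × Space) × (Fin n → Space) =>
      Ψ (n + 1 + 1) (Matrix.vecCons y.1.2 (Matrix.vecCons y.1.1 y.2))
        (Matrix.vecCons ν (Matrix.vecCons μ κ)) :=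
    (h.test (n + 1 + 1) _).comp_of_leftInverse
      (contDiff_vecCons (contDiff_snd.comp contDiff_fst)
        (contDiff_vecCons (contDiff_fst.comp contDiff_fst) contDiff_snd))
      (h := fun p => ((p 1, p 0), fun i => p i.succ.succ)) (by fun_prop) fun _ => rfl
  exact (h1.const_mul _).const_mul _

theorem ann_isTestVector (h : IsTestVector Ψ) (ν : Fin s → Fin 4) (q : Space) :
    IsTestVector (ann ν q Ψ) := by
  obtain ⟨N, hN⟩ := h.ann_finite
  refine ⟨⟨N, fun n hn => hN n hn ν q⟩, fun n κ => (h.ann_test n ν κ).of_prod_mk q,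
    fun n e p κ => ?_⟩
  -- The extension of `e` that fixes the annihilated particle.
  let e' : Equiv.Perm (Fin (n + 1)) := finSuccEquiv n |>.permCongr.symm (Equiv.optionCongr e)
  have h0 : e' 0 = 0 := by simp [e', Equiv.permCongr]
  have hs : ∀ i, e' i.succ = (e i).succ := fun i => by simp [e', Equiv.permCongr]
  have hv : ∀ {A : Type} (a : A) (f : Fin n → A),
      (Matrix.vecCons a (f ∘ e) : Fin (n + 1) → A) = Matrix.vecCons a f ∘ e' := by
    intro A a f
    funext i
    cases i using Fin.cases with
    | zero => simp [h0]
    | succ i => simp [hs]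
  simp only [ann]
  rw [hv, hv, h.bose]

/-- Bose symmetry under exchange of the first two particles. -/
theorem ann_comm (h : IsTestVector Ψ) (μ ν : Fin s → Fin 4) (q q' : Space) :
    ann μ q (ann ν q' Ψ) = ann ν q' (ann μ q Ψ) := by
  funext n p κ
  simp only [ann]
  congr 2
  have hv : ∀ {A : Type} (a b : A) (f : Fin n → A),
      (Matrix.vecCons a (Matrix.vecCons b f) : Fin (n + 2) → A) =
        Matrix.vecCons b (Matrix.vecCons a f) ∘ Equiv.swap 0 1 := by
    intro A a b f
    funext i
    cases i using Fin.cases with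
    | zero => simp
    | succ i =>
      cases i using Fin.cases with
      | zero => simp
      | succ i =>
        rw [Function.comp_apply, Equiv.swap_apply_of_ne_of_ne (Fin.succ_ne_zero _)]
        · simp
        · intro hi
          have := Fin.succ_inj.1 (hi.trans (Fin.succ_zero_eq_one).symm)
          exact Fin.succ_ne_zero _ this
  rw [hv q', hv ν, h.bose]

/-- The support in the label `q` is controlled by `Ψ` alone, hence smoothness of `Φ` is enough. -/
theorem pair_ann (hΦ : ∀ n μ, ContDiff ℝ ∞ fun p => Φ n p μ) (hΨ : IsTestVector Ψ)
    (ν : Fin s → Fin 4) : IsTestPair (fun _ : Space => Φ) fun q => ann ν q Ψ := by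
  obtain ⟨N, hN⟩ := hΨ.ann_finite
  refine ⟨⟨N, fun n hn z p μ => by simp [hN n hn]⟩, fun n μ => IsTestFun.mul_left ?_
    (hΨ.ann_test n ν μ)⟩
  exact Complex.conjCLE.contDiff.comp ((hΦ n μ).comp contDiff_snd)

theorem pair_ann_ann (hΦ : IsTestVector Φ) (hΨ : IsTestVector Ψ) (μ ν : Fin s → Fin 4) :
    IsTestPair (fun _ : Space × Space => Φ) fun z => ann μ z.1 (ann ν z.2 Ψ) := by
  obtain ⟨N, hN⟩ := hΦ.finite
  refine ⟨⟨N, fun n hn z p μ => by simp [hN n hn]⟩, fun n κ => IsTestFun.mul_left ?_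
    (hΨ.ann_ann_test n μ ν κ)⟩
  exact Complex.conjCLE.contDiff.comp ((hΦ.test n κ).smooth.comp contDiff_snd)

theorem ann_pair_ann (hΦ : IsTestVector Φ) (hΨ : IsTestVector Ψ) (μ ν : Fin s → Fin 4) :
    IsTestPair (fun z : Space × Space => ann μ z.1 Φ) fun z => ann ν z.2 Ψ := by
  obtain ⟨N, hN⟩ := hΦ.ann_finite
  refine ⟨⟨N, fun n hn z p μ => by simp [hN n hn]⟩, fun n κ => ?_⟩
  have h1 := hΦ.ann_test n μ κ
  have h2 := hΨ.ann_test n ν κ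
  refine ⟨?_, ?_⟩
  · exact (Complex.conjCLE.contDiff.comp (h1.smooth.comp
      ((contDiff_fst.comp contDiff_fst).prodMk contDiff_snd))).mul
      (h2.smooth.comp ((contDiff_snd.comp contDiff_fst).prodMk contDiff_snd))
  -- The first factor confines `q`, the second confines `q'`, and both share the remaining momenta.
  · refine HasCompactSupport.intro ((h1.compact.prod h2.compact).image
      (f := fun w => ((w.1.1, w.2.1), w.1.2)) (by fun_prop)) fun y hy => ?_
    by_contra hne
    have hne' := mul_ne_zero_iff.1 hne
    refine hy ⟨((y.1.1, y.2), (y.1.2, y.2)), ⟨?_, ?_⟩, rfl⟩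
    · exact subset_tsupport _ (by simpa using hne'.1)
    · exact subset_tsupport _ (by simpa using hne'.2)

end IsTestVector

/-! ### The second quantized generators -/

variable {m : ℝ} {s : ℕ}

/-- The generator of `t ↦ U(ta, exp(tA))` on one-particle wave functions. -/
noncomputable def oneGen (m : ℝ) (a : Spacetime) (A : Matrix (Fin 4) (Fin 4) ℝ)
    (ψ : Space → (Fin s → Fin 4) → ℂ) (q : Space) (ν : Fin s → Fin 4) : ℂ :=
  (mdot (onShell m q) a : ℂ) * ψ q ν + Complex.I * (fderiv ℝ (fun q' => ψ q' ν) q (velocity m A q) +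
    ∑ k, ∑ β, (A β (ν k) : ℂ) * ψ q (Function.update ν k β))

/-- The one-particle generator acting on the `i`-th particle. -/
noncomputable def slotGen (m : ℝ) (a : Spacetime) (A : Matrix (Fin 4) (Fin 4) ℝ) {n : ℕ}
    (i : Fin n) (ψ : (Fin n → Space) → (Fin n → Fin s → Fin 4) → ℂ) (p : Fin n → Space)
    (μ : Fin n → Fin s → Fin 4) : ℂ :=
  oneGen m a A (fun q ν => ψ (Function.update p i q) (Function.update μ i ν)) (p i) (μ i)

/-- The generator of `t ↦ U(ta, exp(tA))` on wave functions. -/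
noncomputable def gen (m : ℝ) (a : Spacetime) (A : Matrix (Fin 4) (Fin 4) ℝ) (Ψ : WaveFun s) :
    WaveFun s := fun n p μ => ∑ i, slotGen m a A i (Ψ n) p μ

variable {a : Spacetime} {A : Matrix (Fin 4) (Fin 4) ℝ}

/-- The derivative in the `i`-th momentum is expressed through the derivative in all momenta, which
shows that the result is smooth and linear in the wave function. -/
theorem slotGen_eq {n : ℕ} (i : Fin n) {ψ : (Fin n → Space) → (Fin n → Fin s → Fin 4) → ℂ}
    (p : Fin n → Space) (μ : Fin n → Fin s → Fin 4)
    (hψ : DifferentiableAt ℝ (fun p => ψ p μ) p) :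
    slotGen m a A i ψ p μ = (mdot (onShell m (p i)) a : ℂ) * ψ p μ +
      Complex.I * (fderiv ℝ (fun p => ψ p μ) p (Pi.single i (velocity m A (p i))) +
        ∑ k, ∑ β, (A β (μ i k) : ℂ) *
          ψ p (Function.update μ i (Function.update (μ i) k β))) := by
  have h : fderiv ℝ (fun q => ψ (Function.update p i q) μ) (p i) (velocity m A (p i)) =
      fderiv ℝ (fun p => ψ p μ) p (Pi.single i (velocity m A (p i))) := by
    have h1 : HasFDerivAt (fun p => ψ p μ) (fderiv ℝ (fun p => ψ p μ) p)
        (Function.update p i (p i)) := by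
      rw [Function.update_eq_self]; exact hψ.hasFDerivAt
    have h2 := (h1.comp (p i) (hasFDerivAt_update (𝕜 := ℝ) p (p i))).fderiv
    simp only [Function.comp_def] at h2
    rw [h2, ContinuousLinearMap.comp_apply]
    congr 1
    funext j
    by_cases hj : j = i
    · subst hj; simp
    · simp [hj]
  simp only [slotGen, oneGen, Function.update_eq_self]
  rw [h]

theorem slotGen_test (hm : 0 < m) {n : ℕ} (i : Fin n)
    {ψ : (Fin n → Space) → (Fin n → Fin s → Fin 4) → ℂ}
    (hψ : ∀ μ, IsTestFun fun p => ψ p μ) (μ : Fin n → Fin s → Fin 4) :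
    IsTestFun fun p => slotGen m a A i ψ p μ := by
  simp only [fun p => slotGen_eq (m := m) (a := a) (A := A) i p μ ((hψ μ).differentiable p)]
  have hp : ContDiff ℝ ∞ fun p : Fin n → Space => p i := contDiff_apply ℝ Space i
  have hv : ContDiff ℝ ∞ fun p : Fin n → Space =>
      (Pi.single i (velocity m A (p i)) : Fin n → Space) :=
    contDiff_pi.2 fun j => by
      by_cases hj : j = i
      · subst hj
        simpa [Function.comp_def] using (contDiff_velocity hm A).comp hp
      · simpa [hj] using contDiff_const
  refine (IsTestFun.mul_left (contDiff_ofReal ((contDiff_mdot_onShell hm a).comp hp)) (hψ μ)).add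
    ((IsTestFun.add ⟨?_, ?_⟩ (IsTestFun.sum _ fun k _ => IsTestFun.sum _ fun β _ =>
      (hψ _).const_mul _)).const_mul _)
  · exact ((hψ μ).smooth.fderiv_right (m := ∞) (by simp)).clm_apply hv
  · refine HasCompactSupport.intro (hψ μ).compact fun p hp => ?_
    rw [image_eq_zero_of_notMem_tsupport
      (f := fderiv ℝ fun p => ψ p μ) fun h => hp (tsupport_fderiv_subset ℝ h)]
    simp

theorem update_comp_perm {n : ℕ} {X : Type*} (e : Equiv.Perm (Fin n)) (p : Fin n → X) (i : Fin n)
    (x : X) : Function.update (p ∘ e) i x = Function.update p (e i) x ∘ e := by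
  rw [Function.update_comp_equiv, Equiv.symm_apply_apply]

theorem slotGen_comp_perm {n : ℕ} {ψ : (Fin n → Space) → (Fin n → Fin s → Fin 4) → ℂ}
    (hψ : ∀ (e : Equiv.Perm (Fin n)) p μ, ψ (p ∘ e) (μ ∘ e) = ψ p μ) (e : Equiv.Perm (Fin n))
    (i : Fin n) (p : Fin n → Space) (μ : Fin n → Fin s → Fin 4) :
    slotGen m a A i ψ (p ∘ e) (μ ∘ e) = slotGen m a A (e i) ψ p μ := by
  simp only [slotGen, update_comp_perm, hψ, Function.comp_apply]

theorem pairDensity_comp_perm {n : ℕ} (c : (Fin n → Space) → (Fin n → Fin s → Fin 4) → ℂ)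
    (e : Equiv.Perm (Fin n)) (p : Fin n → Space) :
    pairDensity m c (p ∘ e) = pairDensity m (fun p μ => c (p ∘ e) (μ ∘ e)) p := by
  simp only [pairDensity]
  congr 1
  · simp only [Function.comp_apply]
    rw [Equiv.prod_comp e fun i => shellDensity m (p i)]
  · rw [← (Equiv.arrowCongr e.symm (Equiv.refl (Fin s → Fin 4))).sum_comp]
    refine Finset.sum_congr rfl fun μ _ => ?_
    have h : (Equiv.arrowCongr e.symm (Equiv.refl (Fin s → Fin 4))) μ = μ ∘ e := rfl
    rw [h]
    simp only [Function.comp_apply]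
    rw [Equiv.prod_comp e fun i => gram (μ i)]

theorem integral_comp_perm {n : ℕ} (e : Equiv.Perm (Fin n)) (F : (Fin n → Space) → ℂ) :
    ∫ p, F (p ∘ e) = ∫ p, F p := by
  have h := volume_measurePreserving_piCongrLeft (fun _ : Fin n => Space) e.symm
  rw [← h.integral_comp' F]
  refine integral_congr_ae (Eventually.of_forall fun p => ?_)
  refine congrArg F (funext fun i => ?_)
  rw [MeasurableEquiv.coe_piCongrLeft, Equiv.piCongrLeft_apply]
  simp

/-- Every particle contributes the same as the first one: exchange the two particles and use Bose
symmetry of both wave functions. -/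
theorem integral_pairDensity_slotGen {n : ℕ}
    {φ ψ : (Fin (n + 1) → Space) → (Fin (n + 1) → Fin s → Fin 4) → ℂ}
    (hφ : ∀ (e : Equiv.Perm (Fin (n + 1))) p μ, φ (p ∘ e) (μ ∘ e) = φ p μ)
    (hψ : ∀ (e : Equiv.Perm (Fin (n + 1))) p μ, ψ (p ∘ e) (μ ∘ e) = ψ p μ) (i : Fin (n + 1)) :
    ∫ p, pairDensity m (fun p μ => conj (φ p μ) * slotGen m a A i ψ p μ) p =
      ∫ p, pairDensity m (fun p μ => conj (φ p μ) * slotGen m a A 0 ψ p μ) p := by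
  rw [← integral_comp_perm (Equiv.swap i 0)]
  simp only [pairDensity_comp_perm, hφ, slotGen_comp_perm hψ, Equiv.swap_apply_left]

theorem oneGen_const_mul (c : ℂ) (ψ : Space → (Fin s → Fin 4) → ℂ) (q : Space)
    (ν : Fin s → Fin 4) (hψ : DifferentiableAt ℝ (fun q => ψ q ν) q) :
    oneGen m a A (fun q ν => c * ψ q ν) q ν = c * oneGen m a A ψ q ν := by
  simp only [oneGen]
  rw [fderiv_const_mul hψ]
  simp only [_root_.smul_apply, smul_eq_mul, mul_left_comm _ c, ← Finset.mul_sum]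
  ring

namespace IsTestVector

variable {Φ Ψ : WaveFun s}

theorem slotGen_zero_vecCons (hΨ : IsTestVector Ψ) {n : ℕ} (q : Space) (p : Fin n → Space)
    (ν : Fin s → Fin 4) (κ : Fin n → Fin s → Fin 4) :
    (Real.sqrt (n + 1) : ℂ) *
        slotGen m a A 0 (Ψ (n + 1)) (Matrix.vecCons q p) (Matrix.vecCons ν κ) =
      oneGen m a A (fun q ν => ann ν q Ψ n p κ) q ν := by
  have hd : DifferentiableAt ℝ (fun q => Ψ (n + 1) (Matrix.vecCons q p) (Matrix.vecCons ν κ)) q :=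
    ((hΨ.test_vecCons n _).smooth.comp (contDiff_id.prodMk contDiff_const)).differentiable
      (by simp) q
  simp only [ann]
  rw [oneGen_const_mul (ψ := fun q ν => Ψ (n + 1) (Matrix.vecCons q p) (Matrix.vecCons ν κ))
    _ q ν hd]
  congr 1
  simp only [slotGen, Matrix.vecCons, Fin.update_cons_zero, Fin.cons_zero]

theorem slotGen_succ_vecCons {n : ℕ} (i : Fin n) (q : Space) (p : Fin n → Space)
    (ν : Fin s → Fin 4) (κ : Fin n → Fin s → Fin 4) :
    slotGen m a A i.succ (Ψ (n + 1)) (Matrix.vecCons q p) (Matrix.vecCons ν κ) =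
      slotGen m a A i (fun p κ => Ψ (n + 1) (Matrix.vecCons q p) (Matrix.vecCons ν κ)) p κ := by
  simp only [slotGen, Matrix.vecCons, ← Fin.cons_update, Fin.cons_succ]

/-- Commutator of the annihilation operators with the generators. -/
theorem ann_gen (hΨ : IsTestVector Ψ) (ν : Fin s → Fin 4) (q : Space) :
    ann ν q (gen m a A Ψ) = gen m a A (ann ν q Ψ) +
      fun n p κ => oneGen m a A (fun q ν => ann ν q Ψ n p κ) q ν := by
  funext n p κ
  rw [Pi.add_apply, Pi.add_apply, Pi.add_apply, ← hΨ.slotGen_zero_vecCons]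
  simp only [ann, gen, Fin.sum_univ_succ (n := n), mul_add]
  rw [add_comm]
  congr 1
  rw [Finset.mul_sum]
  refine Finset.sum_congr rfl fun i _ => ?_
  rw [slotGen_succ_vecCons]
  simp only [slotGen, ann]
  rw [oneGen_const_mul (ψ := fun q' ν' => Ψ (n + 1) (Matrix.vecCons q (Function.update p i q'))
    (Matrix.vecCons ν (Function.update κ i ν')))]
  have h1 := (hΨ.test_vecCons n (Matrix.vecCons ν (Function.update κ i (κ i)))).smooth.comp
    ((contDiff_const (c := q)).prodMk (contDiff_update ∞ p i))
  exact h1.differentiable (by simp) _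

theorem gen_test (hm : 0 < m) (hΨ : IsTestVector Ψ) (n : ℕ) (μ : Fin n → Fin s → Fin 4) :
    IsTestFun fun p => gen m a A Ψ n p μ :=
  IsTestFun.sum _ fun i _ => slotGen_test hm i (hΨ.test n) μ

theorem gen_isTestVector (hm : 0 < m) (hΨ : IsTestVector Ψ) : IsTestVector (gen m a A Ψ) := by
  obtain ⟨N, hN⟩ := hΨ.finite
  refine ⟨⟨N, fun n hn => ?_⟩, fun n μ => gen_test hm hΨ n μ, fun n e p μ => ?_⟩
  · funext p μ
    simp [gen, slotGen, oneGen, hN n hn]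
  · simp only [gen, slotGen_comp_perm (hΨ.bose n)]
    exact Equiv.sum_comp e fun i => slotGen m a A i (Ψ n) p μ

theorem isPairing (hΦ : IsTestVector Φ) (hΨ : IsTestVector Ψ) : IsPairing Φ Ψ := by
  obtain ⟨N, hN⟩ := hΦ.finite
  exact ⟨⟨N, fun n hn p μ => by simp [hN n hn]⟩, fun n μ =>
    IsTestFun.mul_left ((hΦ.test n μ).star).smooth (hΨ.test n μ)⟩

end IsTestVector

/-- Families of Fock vectors labelled by the wave function of one particle. -/
structure IsOneParticleFamily (X : WaveFun s) (Θ : (Fin s → Fin 4) → Space → WaveFun s) :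
    Prop where
  pair : ∀ ν, IsTestPair (fun _ => X) (Θ ν)
  smooth : ∀ ν n μ, ContDiff ℝ ∞ fun y : Space × (Fin n → Space) => Θ ν y.1 n y.2 μ

theorem IsTestVector.isOneParticleFamily {Φ Ψ : WaveFun s}
    (hΦ : ∀ n μ, ContDiff ℝ ∞ fun p => Φ n p μ) (hΨ : IsTestVector Ψ) :
    IsOneParticleFamily Φ fun ν q => ann ν q Ψ :=
  ⟨fun ν => IsTestVector.pair_ann hΦ hΨ ν, fun ν n μ => (hΨ.ann_test n ν μ).smooth⟩

namespace IsOneParticleFamily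

variable {X : WaveFun s} {Θ : (Fin s → Fin 4) → Space → WaveFun s}

/-- The one-particle generator in the label, as a linear combination of vectors; in this form the
additivity of the scalar product applies. -/
theorem oneGen_eq_add (q : Space) (ν : Fin s → Fin 4) :
    (fun n p κ => oneGen m a A (fun q ν => Θ ν q n p κ) q ν : WaveFun s) =
      (mdot (onShell m q) a : ℂ) • Θ ν q + Complex.I •
        ((fun n p κ => fderiv ℝ (fun q => Θ ν q n p κ) q (velocity m A q)) +
          ∑ k, ∑ β, (A β (ν k) : ℂ) • Θ (Function.update ν k β) q) := by
  funext n p κ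
  simp only [oneGen, Pi.add_apply, Pi.smul_apply, smul_eq_mul, Finset.sum_apply]

theorem isPairing_oneGen (h : IsOneParticleFamily X Θ) (q : Space) (ν : Fin s → Fin 4) :
    IsPairing X fun n p κ => oneGen m a A (fun q ν => Θ ν q n p κ) q ν := by
  rw [oneGen_eq_add]
  exact (((h.pair ν).isPairing q).smul _).add (((((h.pair ν).fderiv_right (h.smooth ν)
    (velocity m A q)).isPairing q).add (IsPairing.sum _ fun k _ => IsPairing.sum _ fun β _ =>
      ((h.pair _).isPairing q).smul _)).smul _)

/-- The generator acts on the label `(q, ν)` only and therefore passes through the scalar product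
over the remaining particles. -/
theorem oneGen_fockInner (hm : 0 < m) (h : IsOneParticleFamily X Θ) (q : Space)
    (ν : Fin s → Fin 4) :
    oneGen m a A (fun q ν => fockInner m X (Θ ν q)) q ν =
      fockInner m X fun n p κ => oneGen m a A (fun q ν => Θ ν q n p κ) q ν := by
  have h1 := ((h.pair ν).fderiv_right (h.smooth ν) (velocity m A q)).isPairing q
  have h2 : ∀ k β, IsPairing X ((A β (ν k) : ℂ) • Θ (Function.update ν k β) q) :=
    fun k β => ((h.pair _).isPairing q).smul _
  have h3 : ∀ k, IsPairing X (∑ β, (A β (ν k) : ℂ) • Θ (Function.update ν k β) q) :=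
    fun k => IsPairing.sum _ fun β _ => h2 k β
  have h4 := IsPairing.sum Finset.univ fun k _ => h3 k
  rw [oneGen_eq_add, fockInner_add_right hm (((h.pair ν).isPairing q).smul _)
    ((h1.add h4).smul _), fockInner_smul_right, fockInner_smul_right, fockInner_add_right hm h1 h4,
    fockInner_sum_right hm _ fun k _ => h3 k]
  simp only [fun k => fockInner_sum_right hm Finset.univ fun β _ => h2 k β, fockInner_smul_right]
  rw [oneGen, (h.pair ν).fderiv_fockInner hm (h.smooth ν)]

end IsOneParticleFamily

namespace IsTestVector

variable {Φ Ψ : WaveFun s}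

/-- Matrix elements of the generators in terms of the two-point function of the annihilation
operators. -/
theorem fockInner_gen (hm : 0 < m) (hΦ : IsTestVector Φ) (hΨ : IsTestVector Ψ) :
    fockInner m Φ (gen m a A Ψ) = ∫ q, (shellDensity m q : ℂ) * ∑ μ, (gram μ : ℂ) *
      oneGen m a A (fun q' ν => fockInner m (ann μ q Φ) (ann ν q' Ψ)) q μ := by
  obtain ⟨N, hN⟩ := hΦ.finite
  have hNann : ∀ n, N ≤ n → ∀ ν q, ann ν q Φ n = 0 := fun n hn ν q => by
    funext p κ; simp [ann, hN (n + 1) (by omega)]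
  -- Annihilation lowers the particle number by one: the `n`-particle term on the right matches the
  -- `(n+1)`-particle term on the left, and the vacuum term, an empty sum over particles, is zero.
  rw [fockInner_eq_sum (N := N + 1) fun n hn p μ => by simp [hN n (by omega)],
    Finset.sum_range_succ']
  have h0 : ∫ p, pairDensity m (fun p μ => conj (Φ 0 p μ) * gen m a A Ψ 0 p μ) p = 0 := by
    simp [pairDensity, gen]
  rw [h0, add_zero]
  have hfam : ∀ q μ, IsOneParticleFamily (ann μ q Φ) fun ν q => ann ν q Ψ := fun q μ =>
    IsTestVector.isOneParticleFamily
      (fun n κ => ((hΦ.ann_isTestVector μ q).test n κ).smooth) hΨ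
  have hR : ∀ q μ, oneGen m a A (fun q' ν => fockInner m (ann μ q Φ) (ann ν q' Ψ)) q μ =
      ∑ n ∈ Finset.range N, ∫ p, pairDensity m (fun p κ => conj (ann μ q Φ n p κ) *
        oneGen m a A (fun q ν => ann ν q Ψ n p κ) q μ) p := by
    intro q μ
    rw [(hfam q μ).oneGen_fockInner hm, fockInner_eq_sum (N := N) fun n hn p κ => by
      simp [hNann n hn]]
  have hslot : ∀ n (i : Fin (n + 1)) μ, IsTestFun fun p =>
      conj (Φ (n + 1) p μ) * slotGen m a A i (Ψ (n + 1)) p μ := fun n i μ =>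
    IsTestFun.mul_left ((hΦ.test _ μ).star).smooth (slotGen_test hm i (hΨ.test _) μ)
  have hslot' : ∀ n (i : Fin (n + 1)), IsTestFun (pairDensity m fun p μ =>
      conj (Φ (n + 1) p μ) * slotGen m a A i (Ψ (n + 1)) p μ) := fun n i =>
    IsTestFun.pairDensity (c := fun _ p μ =>
      conj (Φ (n + 1) p μ) * slotGen m a A i (Ψ (n + 1)) p μ) hm contDiff_id (hslot n i)
  have hcons : ∀ n, IsTestFun fun y : Space × (Fin n → Space) => ((n + 1 : ℝ) : ℂ) *
      pairDensity m (fun p μ => conj (Φ (n + 1) p μ) * slotGen m a A 0 (Ψ (n + 1)) p μ)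
        (Matrix.vecCons y.1 y.2) := fun n =>
    ((hslot' n 0).comp_of_leftInverse (contDiff_vecCons contDiff_fst contDiff_snd)
      (h := fun p => (p 0, fun i => p i.succ)) (by fun_prop) fun _ => rfl).const_mul _
  have hval : ∀ n q, ∫ p : Fin n → Space, ((n + 1 : ℝ) : ℂ) *
      pairDensity m (fun p μ => conj (Φ (n + 1) p μ) * slotGen m a A 0 (Ψ (n + 1)) p μ)
        (Matrix.vecCons q p) = (shellDensity m q : ℂ) * ∑ μ, (gram μ : ℂ) *
      ∫ p, pairDensity m (fun p κ => conj (ann μ q Φ n p κ) *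
        oneGen m a A (fun q ν => ann ν q Ψ n p κ) q μ) p := by
    intro n q
    have hint : ∀ μ, Integrable (pairDensity m (fun (p : Fin n → Space) κ =>
        conj (ann μ q Φ n p κ) * oneGen m a A (fun q ν => ann ν q Ψ n p κ) q μ)) := fun μ =>
      ((hfam q μ).isPairing_oneGen q μ).integrable hm n
    simp only [← integral_const_mul]
    rw [← integral_finsetSum _ fun μ _ => (hint μ).const_mul _, ← integral_const_mul]
    refine integral_congr_ae (Eventually.of_forall fun p => ?_)
    simp only [pairDensity_vecCons]
    rw [mul_left_comm, Finset.mul_sum]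
    congr 1
    refine Finset.sum_congr rfl fun μ _ => ?_
    rw [mul_left_comm, mul_pairDensity]
    congr 2
    funext p κ
    rw [← hΨ.slotGen_zero_vecCons, ann, map_mul, Complex.conj_ofReal]
    -- The two normalizations of `ann` multiply to `n + 1`, the number of equal contributions of the
    -- particles.
    have hs : (Real.sqrt (n + 1) : ℂ) * (Real.sqrt (n + 1) : ℂ) = ((n + 1 : ℝ) : ℂ) := by
      rw [← Complex.ofReal_mul, Real.mul_self_sqrt (by positivity)]
    rw [← hs]
    ring
  have hL : ∀ n, ∫ p, pairDensity m (fun p μ => conj (Φ (n + 1) p μ) *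
      gen m a A Ψ (n + 1) p μ) p = ∫ q, (shellDensity m q : ℂ) * ∑ μ, (gram μ : ℂ) *
      ∫ p, pairDensity m (fun p κ => conj (ann μ q Φ n p κ) *
        oneGen m a A (fun q ν => ann ν q Ψ n p κ) q μ) p := by
    intro n
    have h1 : ∫ p, pairDensity m (fun p μ => conj (Φ (n + 1) p μ) *
        gen m a A Ψ (n + 1) p μ) p = ∑ i, ∫ p, pairDensity m (fun p μ => conj (Φ (n + 1) p μ) *
          slotGen m a A i (Ψ (n + 1)) p μ) p := by
      rw [← integral_finsetSum _ fun i _ => (hslot' n i).integrable volume]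
      refine integral_congr_ae (Eventually.of_forall fun p => ?_)
      simp only [pairDensity, gen, Finset.mul_sum]
      rw [Finset.sum_comm]
    rw [h1]
    simp only [integral_pairDensity_slotGen (hΦ.bose (n + 1)) (hΨ.bose (n + 1))]
    rw [Finset.sum_const, Finset.card_univ, Fintype.card_fin, nsmul_eq_mul, ← integral_const_mul,
      integral_vecCons]
    simp only [← hval]
    rw [Measure.volume_eq_prod, integral_prod]
    · push_cast; rfl
    · have := (hcons n).integrable (volume.prod volume)
      push_cast at this ⊢
      exact this
  simp only [hL, hR]
  rw [← integral_finsetSum]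
  · refine integral_congr_ae (Eventually.of_forall fun q => ?_)
    simp only [Finset.mul_sum]
    rw [Finset.sum_comm]
  · intro n _
    simp only [← hval]
    exact (hcons n).integral_param.integrable volume

end IsTestVector

/-! ### Symmetry of the generators -/

variable {m : ℝ} {s : ℕ} {a : Spacetime} {A : Matrix (Fin 4) (Fin 4) ℝ} {Φ Ψ : WaveFun s}

/-- Exchanging the `i`-th entry of `μ` with `β` is an involution of the pairs `(μ, β)`. -/
theorem sum_update_swap {ι X M : Type*} [Fintype ι] [DecidableEq ι] [Fintype X]
    [AddCommMonoid M] (i : ι) (F : (ι → X) → X → M) :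
    ∑ μ, ∑ β, F μ β = ∑ μ, ∑ β, F (Function.update μ i β) (μ i) := by
  let e : (ι → X) × X ≃ (ι → X) × X :=
    { toFun := fun y => (Function.update y.1 i y.2, y.1 i)
      invFun := fun y => (Function.update y.1 i y.2, y.1 i)
      left_inv := fun y => by simp
      right_inv := fun y => by simp }
  rw [← Fintype.sum_prod_type', ← e.sum_comp, Fintype.sum_prod_type]
  rfl

theorem gram_update (hA : IsLorentzGen A) (μ : Fin s → Fin 4) (k : Fin s) (β : Fin 4) :
    gram (Function.update μ k β) * A (μ k) β = -(gram μ * A β (μ k)) := by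
  have h : ∀ ν : Fin s → Fin 4, gram ν =
      (-1) ^ s * (η (ν k) (ν k) * ∏ j ∈ Finset.univ.erase k, η (ν j) (ν j)) := fun ν => by
    rw [gram, Finset.mul_prod_erase _ (fun j => η (ν j) (ν j)) (Finset.mem_univ k)]
  have h' : ∏ j ∈ Finset.univ.erase k, η (Function.update μ k β j) (Function.update μ k β j) =
      ∏ j ∈ Finset.univ.erase k, η (μ j) (μ j) :=
    Finset.prod_congr rfl fun j hj => by rw [Function.update_of_ne (Finset.ne_of_mem_erase hj)]
  have h1 : η β β * A (μ k) β = -(η (μ k) (μ k) * A β (μ k)) := by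
    have h2 := hA (μ k) β
    have h3 := eta_mul_self β
    have h4 := eta_mul_self (μ k)
    linear_combination (η (μ k) (μ k) * η β β) * h2 - η β β * A (μ k) β * h4 -
      η (μ k) (μ k) * A β (μ k) * h3
  rw [h, h μ, h', Function.update_self]
  linear_combination ((-1) ^ s * ∏ j ∈ Finset.univ.erase k, η (μ j) (μ j)) * h1

/-- Exchanging the index `μ_k` with the summed index `β` moves the action of `A` from one argument
to the other. The sign is that of `A` with both indices at the same level. -/
theorem sum_gram_mul_antisymm (hA : IsLorentzGen A) (H : (Fin s → Fin 4) → (Fin s → Fin 4) → ℂ) :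
    ∑ μ, (gram μ : ℂ) * ∑ k, ∑ β, (A β (μ k) : ℂ) * H (Function.update μ k β) μ =
      -∑ μ, (gram μ : ℂ) * ∑ k, ∑ β, (A β (μ k) : ℂ) * H μ (Function.update μ k β) := by
  simp only [Finset.mul_sum]
  rw [Finset.sum_comm, Finset.sum_comm (s := (Finset.univ : Finset (Fin s → Fin 4))),
    ← Finset.sum_neg_distrib]
  refine Finset.sum_congr rfl fun k _ => ?_
  rw [sum_update_swap k, ← Finset.sum_neg_distrib]
  refine Finset.sum_congr rfl fun μ _ => ?_
  rw [← Finset.sum_neg_distrib]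
  refine Finset.sum_congr rfl fun β _ => ?_
  have h := congrArg (fun r : ℝ => (r : ℂ)) (gram_update hA μ k β)
  push_cast at h
  simp only [Function.update_self, Function.update_idem, Function.update_eq_self]
  linear_combination (H μ (Function.update μ k β)) * h

/-- The two-point function `⟨a_μ(q)Φ, a_ν(q')Ψ⟩` of the annihilation operators. -/
noncomputable def twoPoint (m : ℝ) (Φ Ψ : WaveFun s) (μ ν : Fin s → Fin 4) (z : Space × Space) :
    ℂ := fockInner m (ann μ z.1 Φ) (ann ν z.2 Ψ)

theorem conj_twoPoint (μ ν : Fin s → Fin 4) (q q' : Space) :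
    conj (twoPoint m Φ Ψ μ ν (q, q')) = twoPoint m Ψ Φ ν μ (q', q) := conj_fockInner _ _

theorem isTestFun_twoPoint (hm : 0 < m) (hΦ : IsTestVector Φ) (hΨ : IsTestVector Ψ)
    (μ ν : Fin s → Fin 4) : IsTestFun (twoPoint m Φ Ψ μ ν) :=
  (IsTestVector.ann_pair_ann hΦ hΨ μ ν).isTestFun hm

theorem isTestFun_twoPoint_diag (hm : 0 < m) (hΦ : IsTestVector Φ) (hΨ : IsTestVector Ψ)
    (μ ν : Fin s → Fin 4) : IsTestFun fun q => twoPoint m Φ Ψ μ ν (q, q) :=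
  (isTestFun_twoPoint hm hΦ hΨ μ ν).comp_of_leftInverse (contDiff_id.prodMk contDiff_id)
    continuous_fst fun _ => rfl

theorem fderiv_prod_right {f : Space × Space → ℂ} (hf : IsTestFun f) (q q' v : Space) :
    fderiv ℝ (fun q' => f (q, q')) q' v = fderiv ℝ f (q, q') (0, v) := by
  have h := (HasFDerivAt.comp (f := fun q' => (q, q')) q' (hf.differentiable (q, q')).hasFDerivAt
    (hasFDerivAt_prodMk_right q q')).fderiv
  simp only [Function.comp_def] at h
  rw [h]
  simp

theorem fderiv_prod_left {f : Space × Space → ℂ} (hf : IsTestFun f) (q q' v : Space) :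
    fderiv ℝ (fun q => f (q, q')) q v = fderiv ℝ f (q, q') (v, 0) := by
  have h := (HasFDerivAt.comp (f := fun q => (q, q')) q (hf.differentiable (q, q')).hasFDerivAt
    (hasFDerivAt_prodMk_left q q')).fderiv
  simp only [Function.comp_def] at h
  rw [h]
  simp

theorem fderiv_prod_diag {f : Space × Space → ℂ} (hf : IsTestFun f) (q v : Space) :
    fderiv ℝ (fun q => f (q, q)) q v = fderiv ℝ f (q, q) (v, 0) + fderiv ℝ f (q, q) (0, v) := by
  have h := (HasFDerivAt.comp (f := fun q : Space => (q, q)) q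
    (hf.differentiable (q, q)).hasFDerivAt
    ((hasFDerivAt_id (𝕜 := ℝ) q).prodMk (hasFDerivAt_id q))).fderiv
  simp only [Function.comp_def] at h
  rw [h, ← map_add]
  simp

theorem fderiv_conj {E : Type*} [NormedAddCommGroup E] [NormedSpace ℝ E] (f : E → ℂ) (x v : E) :
    fderiv ℝ (fun x => conj (f x)) x v = conj (fderiv ℝ f x v) := by
  have h := Complex.conjCLE.comp_fderiv (f := f) (x := x)
  rw [show (fun x => conj (f x)) = Complex.conjCLE ∘ f from rfl, h]
  rfl

theorem fockInner_gen_right (hm : 0 < m) (hΦ : IsTestVector Φ) (hΨ : IsTestVector Ψ) :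
    fockInner m Φ (gen m a A Ψ) = ∫ q, (shellDensity m q : ℂ) * ∑ μ, (gram μ : ℂ) *
      ((mdot (onShell m q) a : ℂ) * twoPoint m Φ Ψ μ μ (q, q) +
        Complex.I * (fderiv ℝ (twoPoint m Φ Ψ μ μ) (q, q) (0, velocity m A q) +
          ∑ k, ∑ β, (A β (μ k) : ℂ) * twoPoint m Φ Ψ μ (Function.update μ k β) (q, q))) := by
  rw [hΦ.fockInner_gen hm hΨ]
  refine integral_congr_ae (Eventually.of_forall fun q => ?_)
  simp only [oneGen]
  congr 1
  refine Finset.sum_congr rfl fun μ _ => ?_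
  rw [← fderiv_prod_right (isTestFun_twoPoint hm hΦ hΨ μ μ)]
  rfl

/-- The complex conjugate of `fockInner_gen_right` with the vectors exchanged: `A` now acts on the
first argument of the two-point function, and `i` changes sign. -/
theorem fockInner_gen_left (hm : 0 < m) (hΦ : IsTestVector Φ) (hΨ : IsTestVector Ψ) :
    fockInner m (gen m a A Φ) Ψ = ∫ q, (shellDensity m q : ℂ) * ∑ μ, (gram μ : ℂ) *
      ((mdot (onShell m q) a : ℂ) * twoPoint m Φ Ψ μ μ (q, q) -
        Complex.I * (fderiv ℝ (twoPoint m Φ Ψ μ μ) (q, q) (velocity m A q, 0) +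
          ∑ k, ∑ β, (A β (μ k) : ℂ) * twoPoint m Φ Ψ (Function.update μ k β) μ (q, q))) := by
  rw [← conj_fockInner, fockInner_gen_right hm hΨ hΦ, ← integral_conj]
  refine integral_congr_ae (Eventually.of_forall fun q => ?_)
  simp only [map_mul, map_sum, map_add, Complex.conj_ofReal, conj_twoPoint, Complex.conj_I]
  congr 1
  refine Finset.sum_congr rfl fun μ _ => ?_
  rw [← fderiv_prod_right (isTestFun_twoPoint hm hΨ hΦ μ μ), ← fderiv_conj,
    ← fderiv_prod_left (isTestFun_twoPoint hm hΦ hΨ μ μ)]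
  simp only [conj_twoPoint]
  ring

/-- The two partial derivatives add up to the derivative of the two-point function restricted to the
diagonal, which integrates to zero by invariance of the measure. -/
theorem integral_shellDensity_fderiv_twoPoint (hm : 0 < m) (hA : IsLorentzGen A)
    (hΦ : IsTestVector Φ) (hΨ : IsTestVector Ψ) :
    ∫ q, (shellDensity m q : ℂ) * ∑ μ, (gram μ : ℂ) *
      (fderiv ℝ (twoPoint m Φ Ψ μ μ) (q, q) (velocity m A q, 0) +
        fderiv ℝ (twoPoint m Φ Ψ μ μ) (q, q) (0, velocity m A q)) = 0 := by
  have hT : IsTestFun fun q => ∑ μ, (gram μ : ℂ) * twoPoint m Φ Ψ μ μ (q, q) :=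
    IsTestFun.sum _ fun μ _ => (isTestFun_twoPoint_diag hm hΦ hΨ μ μ).const_mul _
  rw [← integral_shellDensity_fderiv_velocity hm hA hT]
  refine integral_congr_ae (Eventually.of_forall fun q => ?_)
  have hd : ∀ μ, DifferentiableAt ℝ (fun q => twoPoint m Φ Ψ μ μ (q, q)) q := fun μ =>
    (isTestFun_twoPoint_diag hm hΦ hΨ μ μ).differentiable q
  simp only
  rw [fderiv_fun_sum fun μ _ => (hd μ).const_mul _, _root_.sum_apply]
  congr 1
  refine Finset.sum_congr rfl fun μ _ => ?_
  rw [fderiv_const_mul (hd μ), _root_.smul_apply,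
    fderiv_prod_diag (isTestFun_twoPoint hm hΦ hΨ μ μ), smul_eq_mul]

theorem isTestFun_fderiv_diag {f : Space × Space → ℂ} (hf : IsTestFun f)
    {v w : Space → Space} (hv : ContDiff ℝ ∞ v) (hw : ContDiff ℝ ∞ w) :
    IsTestFun fun q => fderiv ℝ f (q, q) (v q, w q) := by
  refine ⟨((hf.smooth.fderiv_right (m := ∞) (by simp)).comp
    (contDiff_id.prodMk contDiff_id)).clm_apply (hv.prodMk hw),
    HasCompactSupport.intro (hf.compact.image continuous_fst) fun q hq => ?_⟩
  rw [image_eq_zero_of_notMem_tsupport (f := fderiv ℝ f)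
    fun h => hq ⟨(q, q), tsupport_fderiv_subset ℝ h, rfl⟩]
  simp

/-- In the difference of both sides the terms with `p·a` cancel, the two momentum derivatives
combine into a total one, and the tensor parts cancel by antisymmetry of `A`. -/
theorem IsTestVector.fockInner_gen_symm (hm : 0 < m) (hA : IsLorentzGen A) (hΦ : IsTestVector Φ)
    (hΨ : IsTestVector Ψ) : fockInner m (gen m a A Φ) Ψ = fockInner m Φ (gen m a A Ψ) := by
  have hρ := contDiff_ofReal (contDiff_shellDensity hm)
  have hv := contDiff_velocity hm A
  have htp := isTestFun_twoPoint hm hΦ hΨ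
  have htd := isTestFun_twoPoint_diag hm hΦ hΨ
  have ha := contDiff_ofReal (contDiff_mdot_onShell hm a)
  rw [fockInner_gen_left hm hΦ hΨ, fockInner_gen_right hm hΦ hΨ, ← sub_eq_zero, ← integral_sub]
  · have h0 := congrArg (fun c => -Complex.I * c)
      (integral_shellDensity_fderiv_twoPoint hm hA hΦ hΨ)
    simp only [mul_zero] at h0
    rw [← integral_const_mul] at h0
    rw [← h0]
    refine integral_congr_ae (Eventually.of_forall fun q => ?_)
    have h1 := sum_gram_mul_antisymm hA fun μ ν => twoPoint m Φ Ψ μ ν (q, q)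
    simp only [mul_add, mul_sub, mul_left_comm _ Complex.I, Finset.sum_add_distrib,
      Finset.sum_sub_distrib, ← Finset.mul_sum] at h1 ⊢
    linear_combination (-Complex.I * (shellDensity m q : ℂ)) * h1
  · exact (IsTestFun.mul_left hρ (IsTestFun.sum _ fun μ _ => (((IsTestFun.mul_left ha
      (htd μ μ)).sub (((isTestFun_fderiv_diag (htp μ μ) hv contDiff_const).add
      (IsTestFun.sum _ fun k _ => IsTestFun.sum _ fun β _ =>
        (htd _ _).const_mul _)).const_mul _)).const_mul _))).integrable volume
  · exact (IsTestFun.mul_left hρ (IsTestFun.sum _ fun μ _ => (((IsTestFun.mul_left ha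
      (htd μ μ)).add (((isTestFun_fderiv_diag (htp μ μ) contDiff_const hv).add
      (IsTestFun.sum _ fun k _ => IsTestFun.sum _ fun β _ =>
        (htd _ _).const_mul _)).const_mul _)).const_mul _))).integrable volume

/-! ### The Wigner representation on the domain -/

variable {m : ℝ} {s : ℕ} {a : Spacetime} {A : Matrix (Fin 4) (Fin 4) ℝ} {Ψ : WaveFun s}

/-- With the inverse matrix written as `exp(-tA)`, the smooth dependence on `t` is visible. -/
theorem wignerU_exp_apply (t : ℝ) (n : ℕ) (p : Fin n → Space) (μ : Fin n → Fin s → Fin 4) :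
    wignerU m (t • a) (NormedSpace.exp (t • A)) Ψ n p μ =
      Complex.exp (Complex.I * (t * ∑ i, mdot (onShell m (p i)) a : ℝ)) *
        ∑ α : Fin n → Fin s → Fin 4,
          ((∏ i, ∏ j, NormedSpace.exp (-t • A) (α i j) (μ i j) : ℝ) : ℂ) *
            Ψ n (fun i => flow m A (-t) (p i)) α := by
  simp only [wignerU, ← Matrix.exp_neg, ← neg_smul, flow, ← Complex.exp_sum, mdot_smul_right]
  congr 2
  rw [← Finset.mul_sum]
  push_cast
  rw [← Finset.mul_sum]

/-- Replacement of the tensor index `j` of particle `i`. -/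
def updateIndex {n : ℕ} (μ : Fin n → Fin s → Fin 4) (i : Fin n) (j : Fin s) (β : Fin 4) :
    Fin n → Fin s → Fin 4 := Function.update μ i (Function.update (μ i) j β)

/-! ### Sums over all multi-indices, regrouped along one index -/

section UpdateIndex

variable {n : ℕ} (μ : Fin n → Fin s → Fin 4) (i : Fin n) (j : Fin s)

theorem updateIndex_self (β : Fin 4) : updateIndex μ i j β i j = β := by simp [updateIndex]

theorem updateIndex_of_ne (β : Fin 4) {x : Fin n × Fin s} (h : x ≠ (i, j)) :
    updateIndex μ i j β x.1 x.2 = μ x.1 x.2 := by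
  by_cases h1 : x.1 = i
  · have h2 : x.2 ≠ j := fun h2 => h (Prod.ext h1 h2)
    rw [updateIndex, h1, Function.update_self, Function.update_of_ne h2]
  · rw [updateIndex, Function.update_of_ne h1]

theorem sum_updateIndex (F : (Fin n → Fin s → Fin 4) → ℂ) :
    ∑ α, ∑ β, F (updateIndex α i j β) = 4 * ∑ α, F α := by
  let e : (Fin n → Fin s → Fin 4) × Fin 4 ≃ (Fin n → Fin s → Fin 4) × Fin 4 :=
    { toFun := fun y => (updateIndex y.1 i j y.2, y.1 i j)
      invFun := fun y => (updateIndex y.1 i j y.2, y.1 i j)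
      left_inv := fun y => by simp [updateIndex]
      right_inv := fun y => by simp [updateIndex] }
  have h : ∑ y : (Fin n → Fin s → Fin 4) × Fin 4, F y.1 = 4 * ∑ α, F α := by
    rw [Fintype.sum_prod_type, Finset.mul_sum]
    simp
  rw [← h, ← e.sum_comp, Fintype.sum_prod_type]
  rfl

/-- Summation over one index for fixed others meets every multi-index four times, so the full sum
vanishes as soon as all partial sums do. -/
theorem sum_eq_zero_of_updateIndex (F : (Fin n → Fin s → Fin 4) → ℂ)
    (h : ∀ α, ∑ β, F (updateIndex α i j β) = 0) : ∑ α, F α = 0 := by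
  have h1 := sum_updateIndex i j F
  simp only [h, Finset.sum_const_zero] at h1
  simpa using h1.symm

theorem sum_eq_zero_of_updateIndex₂ (k : Fin s) (F : (Fin n → Fin s → Fin 4) → ℂ)
    (h : ∀ α, ∑ β, ∑ γ, F (updateIndex (updateIndex α i j β) i k γ) = 0) : ∑ α, F α = 0 := by
  have h1 := sum_updateIndex i k F
  rw [sum_eq_zero_of_updateIndex i j (fun α => ∑ γ, F (updateIndex α i k γ)) h] at h1
  simpa using h1.symm

end UpdateIndex

theorem contDiff_exp_mul_sum (hm : 0 < m) (n : ℕ) :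
    ContDiff ℝ ∞ fun y : ℝ × (Fin n → Space) =>
      Complex.exp (Complex.I * (y.1 * ∑ i, mdot (onShell m (y.2 i)) a : ℝ)) :=
  (contDiff_const.mul (contDiff_ofReal (contDiff_fst.mul (ContDiff.sum fun i _ =>
    (contDiff_mdot_onShell hm a).comp ((contDiff_apply ℝ Space i).comp contDiff_snd))))).cexp

theorem contDiff_pi_flow (hm : 0 < m) (n : ℕ) :
    ContDiff ℝ ∞ fun y : ℝ × (Fin n → Space) => fun i => flow m A y.1 (y.2 i) :=
  contDiff_pi.2 fun i => (contDiff_flow hm A).comp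
    (contDiff_fst.prodMk ((contDiff_apply ℝ Space i).comp contDiff_snd))

theorem contDiff_wignerU (hm : 0 < m) (hΨ : ∀ n μ, ContDiff ℝ ∞ fun p => Ψ n p μ) (n : ℕ)
    (μ : Fin n → Fin s → Fin 4) : ContDiff ℝ ∞ fun y : ℝ × (Fin n → Space) =>
      wignerU m (y.1 • a) (NormedSpace.exp (y.1 • A)) Ψ n y.2 μ := by
  simp only [wignerU_exp_apply]
  refine (contDiff_exp_mul_sum hm n).mul (ContDiff.sum fun α _ => ContDiff.mul ?_ ?_)
  · exact contDiff_ofReal (contDiff_prod fun i _ => contDiff_prod fun j _ =>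
      (contDiff_exp_smul_apply A _ _).comp contDiff_fst.neg)
  · exact (hΨ n α).comp ((contDiff_pi_flow hm n).comp (contDiff_fst.neg.prodMk contDiff_snd))

theorem isTestFun_wignerU (hm : 0 < m) (hA : IsLorentzGen A)
    (hΨ : ∀ n μ, IsTestFun fun p => Ψ n p μ) (t : ℝ) (n : ℕ) (μ : Fin n → Fin s → Fin 4) :
    IsTestFun fun p => wignerU m (t • a) (NormedSpace.exp (t • A)) Ψ n p μ := by
  have h1 : ∀ α, IsTestFun fun p : Fin n → Space => Ψ n (fun i => flow m A (-t) (p i)) α := by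
    intro α
    refine (hΨ n α).comp_of_leftInverse
      (g := fun (p : Fin n → Space) i => flow m A (-t) (p i))
      ((contDiff_pi_flow hm n).comp (contDiff_const.prodMk contDiff_id))
      (h := fun (p : Fin n → Space) i => flow m A t (p i))
      ((contDiff_pi_flow hm n).continuous.comp (Continuous.prodMk_right t)) fun p => ?_
    funext i
    have := hA.flow_neg_flow hm (-t) (p i)
    rwa [neg_neg] at this
  have h2 : ContDiff ℝ ∞ fun p : Fin n → Space =>
      Complex.exp (Complex.I * (t * ∑ i, mdot (onShell m (p i)) a : ℝ)) :=
    (contDiff_exp_mul_sum hm n).comp (contDiff_const.prodMk contDiff_id)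
  simp only [wignerU_exp_apply]
  exact IsTestFun.mul_left h2 (IsTestFun.sum _ fun α _ => (h1 α).const_mul _)

/-- The product of all matrix elements except those of index `j` of particle `i`. -/
theorem prod_matrix_updateIndex {n : ℕ} (B : Matrix (Fin 4) (Fin 4) ℝ)
    (α μ : Fin n → Fin s → Fin 4) (i : Fin n) (j : Fin s) :
    ∏ i', ∏ j', B (α i' j') (μ i' j') = B (α i j) (μ i j) *
      ∏ x ∈ Finset.univ.erase (i, j), B (α x.1 x.2) (μ x.1 x.2) := by
  rw [← Fintype.prod_prod_type' (fun i' j' => B (α i' j') (μ i' j')),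
    Finset.mul_prod_erase _ (fun x : Fin n × Fin s => B (α x.1 x.2) (μ x.1 x.2))
      (Finset.mem_univ (i, j))]

/-- Invariance of the inverse metric. It follows from that of the metric because a left inverse of a
square matrix is a right inverse. -/
theorem IsLorentzGen.exp_eta_exp (hA : IsLorentzGen A) (t : ℝ) (γ δ : Fin 4) :
    ∑ α, ∑ β, η α β * (NormedSpace.exp (t • A) γ α * NormedSpace.exp (t • A) δ β) = η γ δ := by
  set B := NormedSpace.exp (t • A) with hB
  have h1 : (η * Bᵀ * η) * B = 1 := by
    have := hA.exp_isometry t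
    rw [mul_assoc, mul_assoc, ← mul_assoc Bᵀ, this, eta_mul_eta]
  have h2 : B * (η * Bᵀ * η) = 1 := mul_eq_one_comm.1 h1
  have h3 : B * η * Bᵀ = η := by
    calc B * η * Bᵀ = B * (η * Bᵀ * η) * η := by
          simp only [mul_assoc, eta_mul_eta, mul_one]
      _ = η := by rw [h2, one_mul]
  conv_rhs => rw [← h3]
  simp only [Matrix.mul_apply, Matrix.transpose_apply, Finset.sum_mul]
  rw [Finset.sum_comm]
  exact Finset.sum_congr rfl fun α _ => Finset.sum_congr rfl fun β _ => by ring

/-- Contracting the momentum with the matrix of index `j` yields the transported momentum, at which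
the wave function is evaluated. What remains is transversality of `Ψ` there. -/
theorem IsFockVector.wignerU_transversal (hm : 0 < m) (hA : IsLorentzGen A)
    (hΨ : IsFockVector m s Ψ) (t : ℝ) (n : ℕ) (p : Fin n → Space) (μ : Fin n → Fin s → Fin 4)
    (i : Fin n) (j : Fin s) :
    ∑ α, (onShell m (p i) α : ℂ) * wignerU m (t • a) (NormedSpace.exp (t • A)) Ψ n p
      (Function.update μ i (Function.update (μ i) j α)) = 0 := by
  simp only [wignerU_exp_apply, mul_left_comm _ (Complex.exp _), ← Finset.mul_sum]
  refine mul_eq_zero_of_right _ ?_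
  simp only [Finset.mul_sum]
  rw [Finset.sum_comm]
  set B := NormedSpace.exp (-t • A) with hB
  -- The product of the other matrix entries, which is unaffected by the index being contracted.
  let R : (Fin n → Fin s → Fin 4) → ℝ := fun α =>
    ∏ x ∈ Finset.univ.erase (i, j), B (α x.1 x.2) (μ x.1 x.2)
  have hR : ∀ α β, ∏ i', ∏ j', B (α i' j') (updateIndex μ i j β i' j') = B (α i j) β * R α := by
    intro α β
    rw [prod_matrix_updateIndex B α _ i j, updateIndex_self]
    congr 1
    exact Finset.prod_congr rfl fun x hx => by
      rw [updateIndex_of_ne _ _ _ _ (Finset.ne_of_mem_erase hx)]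
  have hR' : ∀ α β, R (updateIndex α i j β) = R α := fun α β =>
    Finset.prod_congr rfl fun x hx => by
      rw [updateIndex_of_ne _ _ _ _ (Finset.ne_of_mem_erase hx)]
  have h1 : ∀ α, ∑ β, (onShell m (p i) β : ℂ) *
      (((∏ i', ∏ j', B (α i' j') (updateIndex μ i j β i' j') : ℝ) : ℂ) *
        Ψ n (fun i => flow m A (-t) (p i)) α) =
      (R α : ℂ) * ((onShell m (flow m A (-t) (p i)) (α i j) : ℂ) *
        Ψ n (fun i => flow m A (-t) (p i)) α) := by
    intro α
    simp only [hR, hA.onShell_flow hm, Matrix.mulVec, dotProduct]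
    push_cast
    rw [Finset.sum_mul, Finset.mul_sum]
    exact Finset.sum_congr rfl fun β _ => by ring
  refine (Finset.sum_congr rfl fun α _ => h1 α).trans ?_
  refine sum_eq_zero_of_updateIndex i j _ fun α => ?_
  simp only [hR', updateIndex_self, ← Finset.mul_sum]
  exact mul_eq_zero_of_right _ (hΨ.transversal n (fun i => flow m A (-t) (p i)) α i j)

/-- The two matrices of the contracted indices carry the metric into itself, and tracelessness of
`Ψ` at the transported momenta applies. -/
theorem IsFockVector.wignerU_traceless (hA : IsLorentzGen A)
    (hΨ : IsFockVector m s Ψ) (t : ℝ) (n : ℕ) (p : Fin n → Space) (μ : Fin n → Fin s → Fin 4)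
    (i : Fin n) (j k : Fin s) (hjk : j ≠ k) :
    ∑ α, ∑ β, (η α β : ℂ) * wignerU m (t • a) (NormedSpace.exp (t • A)) Ψ n p
      (Function.update μ i (Function.update (Function.update (μ i) j α) k β)) = 0 := by
  simp only [wignerU_exp_apply, mul_left_comm _ (Complex.exp _), ← Finset.mul_sum]
  refine mul_eq_zero_of_right _ ?_
  set B := NormedSpace.exp (-t • A) with hB
  set κp : Fin n → Space := fun i => flow m A (-t) (p i)
  let R : (Fin n → Fin s → Fin 4) → ℝ := fun α =>
    ∏ x ∈ (Finset.univ.erase (i, k)).erase (i, j), B (α x.1 x.2) (μ x.1 x.2)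
  have hne : (i, j) ≠ (i, k) := fun h => hjk (Prod.ext_iff.1 h).2
  have hupd : ∀ (ν : Fin n → Fin s → Fin 4) β γ,
      Function.update ν i (Function.update (Function.update (ν i) j β) k γ) =
        updateIndex (updateIndex ν i j β) i k γ := fun ν β γ => by simp [updateIndex]
  have hupd' : ∀ (ν : Fin n → Fin s → Fin 4) β γ,
      updateIndex (updateIndex ν i j β) i k γ i j = β := fun ν β γ => by
    rw [updateIndex_of_ne (x := (i, j)) _ _ _ _ hne, updateIndex_self]
  have hout : ∀ (ν : Fin n → Fin s → Fin 4) β γ,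
      ∀ x ∈ (Finset.univ.erase (i, k)).erase (i, j),
      updateIndex (updateIndex ν i j β) i k γ x.1 x.2 = ν x.1 x.2 := fun ν β γ x hx => by
    rw [updateIndex_of_ne _ _ _ _ (Finset.ne_of_mem_erase (Finset.mem_of_mem_erase hx)),
      updateIndex_of_ne _ _ _ _ (Finset.ne_of_mem_erase hx)]
  have hR : ∀ α β γ, ∏ i', ∏ j', B (α i' j')
      (updateIndex (updateIndex μ i j β) i k γ i' j') = B (α i j) β * B (α i k) γ * R α := by
    intro α β γ
    rw [prod_matrix_updateIndex B α _ i k, updateIndex_self, ← Finset.mul_prod_erase _ _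
      (Finset.mem_erase.2 ⟨hne, Finset.mem_univ (i, j)⟩)]
    simp only [hupd']
    rw [← mul_assoc, mul_comm (B (α i k) γ)]
    congr 1
    exact Finset.prod_congr rfl fun x hx => by rw [hout _ _ _ x hx]
  have hR' : ∀ α β γ, R (updateIndex (updateIndex α i j β) i k γ) = R α := fun α β γ =>
    Finset.prod_congr rfl fun x hx => by rw [hout _ _ _ x hx]
  simp only [hupd, hR]
  have h1 : ∑ β, ∑ γ, (η β γ : ℂ) * ∑ α : Fin n → Fin s → Fin 4,
      ((B (α i j) β * B (α i k) γ * R α : ℝ) : ℂ) * Ψ n κp α =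
      ∑ α, (R α : ℂ) * ((η (α i j) (α i k) : ℂ) * Ψ n κp α) := by
    have h2 : ∀ α : Fin n → Fin s → Fin 4, (η (α i j) (α i k) : ℂ) =
        ∑ β, ∑ γ, (η β γ : ℂ) * ((B (α i j) β : ℂ) * (B (α i k) γ : ℂ)) := fun α => by
      rw [← hA.exp_eta_exp (-t) (α i j) (α i k)]
      push_cast
      rfl
    simp only [h2, Finset.sum_mul, Finset.mul_sum]
    rw [Finset.sum_comm' (t' := Finset.univ) (s' := fun _ => Finset.univ) (by simp)]
    conv_rhs => rw [Finset.sum_comm' (t' := Finset.univ) (s' := fun _ => Finset.univ) (by simp)]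
    conv_lhs => rw [Finset.sum_comm' (t' := Finset.univ) (s' := fun _ => Finset.univ) (by simp)]
    refine Finset.sum_congr rfl fun β _ => ?_
    rw [Finset.sum_comm]
    refine Finset.sum_congr rfl fun α _ => Finset.sum_congr rfl fun γ _ => ?_
    push_cast
    ring
  rw [h1]
  refine sum_eq_zero_of_updateIndex₂ i j k _ fun α => ?_
  simp only [hR', hupd', updateIndex_self]
  have h3 := hΨ.traceless n κp α i j k hjk
  simp only [hupd] at h3
  simp only [← Finset.mul_sum]
  exact mul_eq_zero_of_right _ h3

theorem IsFockVector.wignerU_exp (hm : 0 < m) (hA : IsLorentzGen A) (hΨ : IsFockVector m s Ψ)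
    (t : ℝ) : IsFockVector m s (wignerU m (t • a) (NormedSpace.exp (t • A)) Ψ) where
  finite := by
    obtain ⟨N, hN⟩ := hΨ.finite
    refine ⟨N, fun n hn => ?_⟩
    funext p μ
    simp [wignerU, hN n hn]
  smooth n μ := (isTestFun_wignerU hm hA hΨ.isTestVector.test t n μ).smooth
  compact n μ := (isTestFun_wignerU hm hA hΨ.isTestVector.test t n μ).compact
  bose n e p μ := by
    simp only [wignerU_exp_apply, Function.comp_apply]
    rw [Equiv.sum_comp e fun i => mdot (onShell m (p i)) a,
      ← (Equiv.arrowCongr e.symm (Equiv.refl (Fin s → Fin 4))).sum_comp]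
    congr 1
    refine Finset.sum_congr rfl fun α _ => ?_
    have h : (Equiv.arrowCongr e.symm (Equiv.refl (Fin s → Fin 4))) α = α ∘ e := rfl
    rw [h]
    simp only [Function.comp_apply]
    rw [Equiv.prod_comp e fun i => ∏ j, NormedSpace.exp (-t • A) (α i j) (μ i j)]
    congr 1
    exact hΨ.bose n e (fun i => flow m A (-t) (p i)) α
  symm n p μ i e := by
    simp only [wignerU_exp_apply]
    congr 1
    let E : Equiv.Perm (Fin n → Fin s → Fin 4) :=
      { toFun := fun α => Function.update α i (α i ∘ e)
        invFun := fun α => Function.update α i (α i ∘ e.symm)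
        left_inv := fun α => by simp [Function.comp_assoc]
        right_inv := fun α => by simp [Function.comp_assoc] }
    have hE : ∀ α, E α = Function.update α i (α i ∘ e) := fun α => rfl
    rw [← Equiv.sum_comp E]
    refine Finset.sum_congr rfl fun α _ => ?_
    rw [hE, hΨ.symm]
    congr 2
    refine Finset.prod_congr rfl fun i' _ => ?_
    by_cases h : i' = i
    · subst h
      simp only [Function.update_self, Function.comp_apply]
      exact Equiv.prod_comp e fun j => NormedSpace.exp (-t • A) (α i' j) (μ i' j)
    · simp only [Function.update_of_ne h]
  traceless n p μ i j k h := hΨ.wignerU_traceless hA t n p μ i j k h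
  transversal n p μ i j := hΨ.wignerU_transversal hm hA t n p μ i j

/-! ### Differentiation of the Wigner representation -/

/-- At `t = 0` all factors are entries of the identity. The product rule therefore gives a nonzero
term for the slot `x` only if `α` and `μ` agree in all other slots. -/
theorem hasDerivAt_prod_exp {n : ℕ} (α μ : Fin n → Fin s → Fin 4) :
    HasDerivAt (fun t : ℝ => ∏ i, ∏ j, NormedSpace.exp (-t • A) (α i j) (μ i j))
      (-∑ x : Fin n × Fin s, if ∀ y ≠ x, α y.1 y.2 = μ y.1 y.2 then
        A (α x.1 x.2) (μ x.1 x.2) else 0) 0 := by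
  have h1 : ∀ γ β, HasDerivAt (fun t : ℝ => NormedSpace.exp (-t • A) γ β) (-A γ β) 0 := by
    intro γ β
    have h2 : HasDerivAt (fun t : ℝ => NormedSpace.exp (t • A) γ β) (A γ β) (-(0 : ℝ)) := by
      rw [neg_zero]; exact hasDerivAt_exp_smul_apply A γ β
    have h3 := h2.comp (0 : ℝ) (hasDerivAt_neg (0 : ℝ))
    simpa [Function.comp_def] using h3
  have h4 := HasDerivAt.fun_finsetProd (u := (Finset.univ : Finset (Fin n × Fin s)))
    (f := fun x t => NormedSpace.exp (-t • A) (α x.1 x.2) (μ x.1 x.2))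
    (f' := fun x => -A (α x.1 x.2) (μ x.1 x.2)) (x := (0 : ℝ)) fun x _ => h1 _ _
  convert! h4 using 1
  · funext t
    exact (Fintype.prod_prod_type' fun i j => NormedSpace.exp (-t • A) (α i j) (μ i j)).symm
  · rw [← Finset.sum_neg_distrib]
    refine Finset.sum_congr rfl fun x _ => ?_
    simp only [neg_zero, zero_smul, NormedSpace.exp_zero, Matrix.one_apply, smul_eq_mul]
    split_ifs with h
    · rw [Finset.prod_eq_one fun y hy => if_pos (h y (Finset.ne_of_mem_erase hy)), one_mul]
    · push Not at h
      obtain ⟨y, hy, hne⟩ := h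
      rw [Finset.prod_eq_zero (Finset.mem_erase.2 ⟨hy, Finset.mem_univ y⟩) (if_neg hne)]
      simp

/-- The multi-indices that agree with `μ` away from the slot `x` are parametrized by their value
there. -/
theorem sum_ite_updateIndex {n : ℕ} (μ : Fin n → Fin s → Fin 4) (x : Fin n × Fin s)
    (F : (Fin n → Fin s → Fin 4) → ℂ) :
    ∑ α, ((if ∀ y ≠ x, α y.1 y.2 = μ y.1 y.2 then A (α x.1 x.2) (μ x.1 x.2) else 0 : ℝ) : ℂ) *
      F α = ∑ β, (A β (μ x.1 x.2) : ℂ) * F (updateIndex μ x.1 x.2 β) := by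
  symm
  refine Fintype.sum_of_injective (fun β => updateIndex μ x.1 x.2 β) (fun β γ h => ?_) _ _
    (fun α hα => ?_) fun β => ?_
  · have := congrFun (congrFun h x.1) x.2
    simpa [updateIndex_self] using this
  · rw [if_neg, Complex.ofReal_zero, zero_mul]
    intro h
    refine hα ⟨α x.1 x.2, ?_⟩
    funext i j
    by_cases hij : (i, j) = x
    · subst hij
      exact updateIndex_self _ _ _ _
    · exact (updateIndex_of_ne (x := (i, j)) _ _ _ _ hij).trans (h (i, j) hij).symm
  · rw [if_pos fun y hy => updateIndex_of_ne _ _ _ _ hy, updateIndex_self]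

/-- The three factors of the representation, namely the phase, the transported wave function and the
tensor matrices, differentiate to the three terms of `oneGen` for every particle. The last two
acquire a minus sign from the inverse transformation, which equals `i²`. -/
theorem hasDerivAt_wignerU (hΨ : IsTestVector Ψ) (n : ℕ) (p : Fin n → Space)
    (μ : Fin n → Fin s → Fin 4) :
    HasDerivAt (fun t : ℝ => wignerU m (t • a) (NormedSpace.exp (t • A)) Ψ n p μ)
      (Complex.I * gen m a A Ψ n p μ) 0 := by
  simp only [wignerU_exp_apply]
  have h1 : HasDerivAt (fun t : ℝ =>
      Complex.exp (Complex.I * (t * ∑ i, mdot (onShell m (p i)) a : ℝ)))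
      (Complex.I * (∑ i, mdot (onShell m (p i)) a : ℝ)) 0 := by
    have h := (((hasDerivAt_id (0 : ℝ)).mul_const (∑ i, mdot (onShell m (p i)) a)).ofReal_comp
      |>.const_mul Complex.I).cexp
    simpa using h
  have hflow : HasDerivAt (fun (t : ℝ) i => flow m A (-t) (p i))
      (-fun i => velocity m A (p i)) 0 := by
    refine hasDerivAt_pi.2 fun i => ?_
    have h2 : HasDerivAt (fun t : ℝ => flow m A t (p i)) (velocity m A (p i)) (-(0 : ℝ)) := by
      rw [neg_zero]; exact hasDerivAt_flow A (p i)
    simpa [Function.comp_def] using h2.scomp (0 : ℝ) (hasDerivAt_neg (0 : ℝ))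
  have hflow0 : (fun i => flow m A (-(0 : ℝ)) (p i)) = p := by
    funext i; rw [neg_zero, flow_zero]
  have h2 : ∀ α, HasDerivAt (fun t : ℝ => Ψ n (fun i => flow m A (-t) (p i)) α)
      (-∑ i, fderiv ℝ (fun p => Ψ n p α) p (Pi.single i (velocity m A (p i)))) 0 := by
    intro α
    have hd : HasFDerivAt (fun p => Ψ n p α) (fderiv ℝ (fun p => Ψ n p α) p)
        (fun i => flow m A (-(0 : ℝ)) (p i)) := by
      rw [hflow0]; exact ((hΨ.test n α).differentiable p).hasFDerivAt
    have h3 := hd.comp_hasDerivAt (0 : ℝ) hflow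
    have h4 : (fun i => velocity m A (p i)) =
        ∑ i, (Pi.single i (velocity m A (p i)) : Fin n → Space) := by
      rw [Finset.univ_sum_single]
    rw [map_neg, h4, map_sum] at h3
    exact h3
  have h3 := HasDerivAt.fun_sum (u := Finset.univ) fun (α : Fin n → Fin s → Fin 4) _ =>
    ((hasDerivAt_prod_exp (A := A) α μ).ofReal_comp).mul (h2 α)
  have h4 := h1.mul h3
  convert! h4 using 1
  have hδ : ∀ α : Fin n → Fin s → Fin 4,
      ((∏ i, ∏ j, NormedSpace.exp (-(0 : ℝ) • A) (α i j) (μ i j) : ℝ) : ℂ) =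
        if α = μ then 1 else 0 := by
    intro α
    simp only [neg_zero, zero_smul, NormedSpace.exp_zero, Matrix.one_apply]
    split_ifs with h
    · subst h; simp
    · obtain ⟨i, hi⟩ := Function.ne_iff.1 h
      obtain ⟨j, hj⟩ := Function.ne_iff.1 hi
      rw [Finset.prod_eq_zero (Finset.mem_univ i)
        (Finset.prod_eq_zero (Finset.mem_univ j) (if_neg hj)), Complex.ofReal_zero]
  have hsum : ∑ α : Fin n → Fin s → Fin 4, ((-∑ x : Fin n × Fin s,
      if ∀ y ≠ x, α y.1 y.2 = μ y.1 y.2 then A (α x.1 x.2) (μ x.1 x.2) else 0 : ℝ) : ℂ) *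
        Ψ n p α = -∑ i, ∑ k, ∑ β, (A β (μ i k) : ℂ) *
          Ψ n p (Function.update μ i (Function.update (μ i) k β)) := by
    simp only [Complex.ofReal_neg, Complex.ofReal_sum, neg_mul, Finset.sum_mul,
      Finset.sum_neg_distrib]
    rw [Finset.sum_comm]
    simp only [sum_ite_updateIndex]
    rw [Fintype.sum_prod_type]
    rfl
  simp only [Pi.mul_apply, hflow0, hδ, Finset.sum_add_distrib, hsum, ite_mul, one_mul, zero_mul,
    Finset.sum_ite_eq', Finset.mem_univ, if_true, Complex.ofReal_zero, mul_zero, Complex.exp_zero]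
  simp only [gen, fun i => slotGen_eq (m := m) (a := a) (A := A) i p μ
    ((hΨ.test n μ).differentiable p), Finset.sum_add_distrib, mul_add, ← Finset.mul_sum,
    ← Finset.sum_mul]
  push_cast
  linear_combination (∑ i, fderiv ℝ (fun p => Ψ n p μ) p (Pi.single i (velocity m A (p i))) +
    ∑ i, ∑ k, ∑ β, (A β (μ i k) : ℂ) *
      Ψ n p (Function.update μ i (Function.update (μ i) k β))) * Complex.I_mul_I

/-! ### The generators on the domain -/

theorem wignerU_exp_zero (n : ℕ) (p : Fin n → Space) (μ : Fin n → Fin s → Fin 4) :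
    wignerU m ((0 : ℝ) • a) (NormedSpace.exp ((0 : ℝ) • A)) Ψ n p μ = Ψ n p μ := by
  rw [wignerU_exp_apply]
  simp only [neg_zero, zero_smul, NormedSpace.exp_zero, flow_zero, zero_mul, Complex.ofReal_zero,
    mul_zero, Complex.exp_zero, one_mul]
  rw [Finset.sum_eq_single μ]
  · simp
  · intro α _ hα
    obtain ⟨i, hi⟩ := Function.ne_iff.1 hα
    obtain ⟨j, hj⟩ := Function.ne_iff.1 hi
    rw [Finset.prod_eq_zero (Finset.mem_univ i)
      (Finset.prod_eq_zero (Finset.mem_univ j) (by rw [Matrix.one_apply_ne hj])), Complex.ofReal_zero,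
      zero_mul]
  · simp

theorem tendsto_slope_wignerU (hΨ : IsTestVector Ψ) (n : ℕ) (p : Fin n → Space)
    (μ : Fin n → Fin s → Fin 4) :
    Tendsto (fun t : ℝ => (t : ℂ)⁻¹ * (wignerU m (t • a) (NormedSpace.exp (t • A)) Ψ n p μ -
      Ψ n p μ)) (𝓝[≠] 0) (𝓝 (Complex.I * gen m a A Ψ n p μ)) := by
  have h := (hasDerivAt_iff_tendsto_slope.1 (hasDerivAt_wignerU (m := m) (a := a) (A := A) hΨ n p μ))
  refine h.congr fun t => ?_
  have h0 := wignerU_exp_zero (m := m) (a := a) (A := A) (Ψ := Ψ) n p μ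
  rw [slope_def_module, sub_zero, h0, Complex.real_smul, Complex.ofReal_inv]

/-- Symmetry, transversality and tracelessness are linear conditions with `t`-independent
coefficients at each point. The difference quotients satisfy them, hence so does their pointwise
limit; smoothness and compact support are known directly from `IsTestVector.gen_isTestVector`. -/
theorem IsFockVector.gen (hm : 0 < m) (hA : IsLorentzGen A) (hΨ : IsFockVector m s Ψ) :
    IsFockVector m s (gen m a A Ψ) := by
  have hT := hΨ.isTestVector
  have hG : IsTestVector (Proca.gen m a A Ψ) := hT.gen_isTestVector hm
  let R : ℝ → WaveFun s := fun t =>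
    (t : ℂ)⁻¹ • (wignerU m (t • a) (NormedSpace.exp (t • A)) Ψ - Ψ)
  have hR : ∀ t, IsFockVector m s (R t) := fun t => (fockDomain m s).smul_mem _
    ((fockDomain m s).sub_mem (hΨ.wignerU_exp hm hA t) hΨ)
  have hlim : ∀ n p μ, Tendsto (fun t => -Complex.I * R t n p μ) (𝓝[≠] 0)
      (𝓝 (Proca.gen m a A Ψ n p μ)) := by
    intro n p μ
    have h := (tendsto_slope_wignerU (m := m) (a := a) (A := A) hT n p μ).const_mul (-Complex.I)
    rw [← mul_assoc, neg_mul, Complex.I_mul_I, neg_neg, one_mul] at h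
    exact h
  have hzero : ∀ {ι : Type} [Fintype ι] (c : ι → ℂ) n p (μ : ι → Fin n → Fin s → Fin 4),
      (∀ t, ∑ k, c k * R t n p (μ k) = 0) → ∑ k, c k * Proca.gen m a A Ψ n p (μ k) = 0 := by
    intro ι _ c n p μ h
    refine tendsto_nhds_unique (tendsto_finsetSum Finset.univ fun k _ =>
      (hlim n p (μ k)).const_mul (c k)) (tendsto_const_nhds.congr fun t => ?_)
    simp only [mul_left_comm (c _), ← Finset.mul_sum, h t, mul_zero]
  refine ⟨?_, fun n μ => (hG.test n μ).smooth, fun n μ => (hG.test n μ).compact, hG.bose,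
    fun n p μ i e => ?_, fun n p μ i j k hjk => ?_, fun n p μ i j => ?_⟩
  · obtain ⟨N, hN⟩ := hG.finite
    exact ⟨N, fun n hn => hN n hn.le⟩
  · refine tendsto_nhds_unique (hlim n p _) ((hlim n p μ).congr fun t => ?_)
    rw [(hR t).symm]
  · have h := hzero (ι := Fin 4 × Fin 4) (fun x => (η x.1 x.2 : ℂ)) n p (fun x =>
      Function.update μ i (Function.update (Function.update (μ i) j x.1) k x.2)) fun t => by
        rw [Fintype.sum_prod_type]; exact (hR t).traceless n p μ i j k hjk
    rwa [Fintype.sum_prod_type] at h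
  · exact hzero _ n p _ fun t => (hR t).transversal n p μ i j

/-- By the mean value inequality the difference quotients are bounded by the maximum of the time
derivative over the compact set `[-1, 1] × K`. -/
theorem exists_bound_slope {E : Type} [NormedAddCommGroup E] [NormedSpace ℝ E] {u : ℝ × E → ℂ}
    (hu : ContDiff ℝ ∞ u) {K : Set E} (hK : IsCompact K)
    (huK : ∀ t : ℝ, |t| ≤ 1 → ∀ p ∉ K, u (t, p) = 0) {u' : E → ℂ}
    (hu' : ∀ p, HasDerivAt (fun t => u (t, p)) (u' p) 0) :
    ∃ C, ∀ t : ℝ, |t| ≤ 1 → t ≠ 0 → ∀ p,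
      ‖(t : ℂ)⁻¹ * (u (t, p) - u (0, p)) - u' p‖ ≤ K.indicator (fun _ => C) p := by
  have hd : ∀ t p, HasDerivAt (fun t => u (t, p)) (fderiv ℝ u (t, p) (1, 0)) t := by
    intro t p
    have h := HasFDerivAt.comp_hasDerivAt (f := fun t : ℝ => (t, p)) t
      (hu.differentiable (by simp) (t, p)).hasFDerivAt
      ((hasDerivAt_id t).prodMk (hasDerivAt_const t p))
    exact h
  have hcont : Continuous fun y => ‖fderiv ℝ u y (1, 0)‖ :=
    ((hu.continuous_fderiv (by simp)).clm_apply continuous_const).norm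
  obtain ⟨C, hC⟩ := ((isCompact_Icc (a := (-1 : ℝ)) (b := 1)).prod hK).exists_bound_of_continuousOn
    hcont.continuousOn
  -- One `C` for the difference quotient, one for the derivative at `t = 0`.
  refine ⟨C + C, fun t ht ht0 p => ?_⟩
  have hu'eq : u' p = fderiv ℝ u (0, p) (1, 0) := (hu' p).unique (hd 0 p)
  by_cases hp : p ∈ K
  · rw [Set.indicator_of_mem hp]
    have hC' : ∀ t : ℝ, t ∈ Set.Icc (-1 : ℝ) 1 → ‖fderiv ℝ u (t, p) (1, 0)‖ ≤ C := fun t ht => by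
      simpa using hC (t, p) ⟨ht, hp⟩
    have h0 : (0 : ℝ) ∈ Set.Icc (-1 : ℝ) 1 := by constructor <;> norm_num
    have h1 := Convex.norm_image_sub_le_of_norm_hasDerivWithin_le
      (fun t _ => (hd t p).hasDerivWithinAt) hC' (convex_Icc (-1 : ℝ) 1) h0 (abs_le.1 ht)
    refine (norm_sub_le _ _).trans (add_le_add ?_ (hu'eq ▸ hC' 0 h0))
    rw [norm_mul, norm_inv, Complex.norm_real]
    rw [sub_zero] at h1
    rw [inv_mul_le_iff₀ (norm_pos_iff.2 ht0), mul_comm]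
    exact h1
  · have h0 : u' p = 0 := by
      refine (hu' p).unique ((hasDerivAt_const (0 : ℝ) (0 : ℂ)).congr_of_eventuallyEq ?_)
      filter_upwards [Metric.ball_mem_nhds (0 : ℝ) one_pos] with t ht
      exact huK t (by simpa using (mem_ball_zero_iff.1 ht).le) p hp
    rw [Set.indicator_of_notMem hp, huK t ht p hp, huK 0 (by simp) p hp, h0]
    simp

theorem exists_bound_slope_wignerU (hm : 0 < m) (hA : IsLorentzGen A) (hΨ : IsTestVector Ψ)
    (n : ℕ) (μ : Fin n → Fin s → Fin 4) :
    ∃ (K : Set (Fin n → Space)) (C : ℝ), IsCompact K ∧ ∀ t : ℝ, |t| ≤ 1 → t ≠ 0 → ∀ p,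
      ‖(t : ℂ)⁻¹ * (wignerU m (t • a) (NormedSpace.exp (t • A)) Ψ n p μ - Ψ n p μ) -
        Complex.I * Proca.gen m a A Ψ n p μ‖ ≤ K.indicator (fun _ => C) p := by
  -- The region swept out by the supports of all components under the flow for `|t| ≤ 1`.
  let K : Set (Fin n → Space) := ⋃ α : Fin n → Fin s → Fin 4,
    (fun y : ℝ × (Fin n → Space) => fun i => flow m A y.1 (y.2 i)) ''
      (Set.Icc (-1 : ℝ) 1 ×ˢ tsupport fun p => Ψ n p α)
  have hK : IsCompact K := isCompact_iUnion fun α =>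
    (isCompact_Icc.prod (hΨ.test n α).compact).image (contDiff_pi_flow hm n).continuous
  have h0 : ∀ p, wignerU m ((0 : ℝ) • a) (NormedSpace.exp ((0 : ℝ) • A)) Ψ n p μ = Ψ n p μ :=
    fun p => wignerU_exp_zero n p μ
  have huK : ∀ t : ℝ, |t| ≤ 1 → ∀ p ∉ K,
      wignerU m (t • a) (NormedSpace.exp (t • A)) Ψ n p μ = 0 := by
    intro t ht p hp
    rw [wignerU_exp_apply]
    refine mul_eq_zero_of_right _ (Finset.sum_eq_zero fun α _ => mul_eq_zero_of_right _ ?_)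
    refine image_eq_zero_of_notMem_tsupport (f := fun p => Ψ n p α) fun h => hp ?_
    refine Set.mem_iUnion.2 ⟨α, (t, fun i => flow m A (-t) (p i)), ⟨abs_le.1 ht, h⟩, ?_⟩
    funext i
    have := hA.flow_neg_flow hm (-t) (p i)
    rwa [neg_neg] at this
  obtain ⟨C, hC⟩ := exists_bound_slope (contDiff_wignerU (a := a) (A := A) hm
    (fun n μ => (hΨ.test n μ).smooth) n μ) hK huK
    (fun p => hasDerivAt_wignerU (m := m) (a := a) (A := A) hΨ n p μ)
  refine ⟨K, C, hK, fun t ht ht0 p => ?_⟩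
  have := hC t ht ht0 p
  rwa [h0] at this

/-- For each of the finitely many particle numbers the integrand tends to zero pointwise and is
dominated, for `|t| ≤ 1`, by a continuous function on a compact set. -/
theorem tendsto_fockInner_slope (hm : 0 < m) (hA : IsLorentzGen A) (hΨ : IsTestVector Ψ) :
    Tendsto (fun t : ℝ => fockInner m
        ((t : ℂ)⁻¹ • (wignerU m (t • a) (NormedSpace.exp (t • A)) Ψ - Ψ) -
          Complex.I • Proca.gen m a A Ψ)
        ((t : ℂ)⁻¹ • (wignerU m (t • a) (NormedSpace.exp (t • A)) Ψ - Ψ) -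
          Complex.I • Proca.gen m a A Ψ)) (𝓝[≠] 0) (𝓝 0) := by
  obtain ⟨N, hN⟩ := hΨ.finite
  obtain ⟨N', hN'⟩ := (hΨ.gen_isTestVector (a := a) (A := A) hm).finite
  set R : ℝ → WaveFun s := fun t =>
    (t : ℂ)⁻¹ • (wignerU m (t • a) (NormedSpace.exp (t • A)) Ψ - Ψ) -
      Complex.I • Proca.gen m a A Ψ with hR
  have hRa : ∀ t n p μ, R t n p μ = (t : ℂ)⁻¹ *
      (wignerU m (t • a) (NormedSpace.exp (t • A)) Ψ n p μ - Ψ n p μ) -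
        Complex.I * Proca.gen m a A Ψ n p μ := fun t n p μ => rfl
  have hR0 : ∀ t n, max N N' ≤ n → ∀ p μ, conj (R t n p μ) * R t n p μ = 0 := by
    intro t n hn p μ
    rw [hRa, hN n (le_trans (le_max_left _ _) hn), hN' n (le_trans (le_max_right _ _) hn)]
    simp [wignerU, hN n (le_trans (le_max_left _ _) hn)]
  change Tendsto (fun t => fockInner m (R t) (R t)) _ _
  simp only [fun t => fockInner_eq_sum (m := m) (Φ := R t) (Ψ := R t) (hR0 t)]
  rw [show (0 : ℂ) = ∑ n ∈ Finset.range (max N N'), ∫ p : Fin n → Space, (0 : ℂ) by simp]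
  refine tendsto_finsetSum _ fun n _ => ?_
  choose K C hK hC using exists_bound_slope_wignerU (a := a) hm hA hΨ n
  have hw : Continuous fun p : Fin n → Space => ‖((∏ i, shellDensity m (p i) : ℝ) : ℂ)‖ :=
    (contDiff_prod_shellDensity hm contDiff_id).continuous.norm
  refine tendsto_integral_filter_of_dominated_convergence (fun p => ∑ μ, (K μ).indicator
    (fun p => ‖((∏ i, shellDensity m (p i) : ℝ) : ℂ)‖ *
      (‖((∏ i, gram (μ i) : ℝ) : ℂ)‖ * (C μ * C μ))) p) ?_ ?_ ?_ ?_
  · refine Eventually.of_forall fun t => Continuous.aestronglyMeasurable ?_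
    have hc : ∀ μ, Continuous fun p => R t n p μ := fun μ => by
      simp only [hRa]
      exact (continuous_const.mul ((isTestFun_wignerU hm hA hΨ.test t n μ).continuous.sub
        (hΨ.test n μ).continuous)).sub (continuous_const.mul (hΨ.gen_test hm n μ).continuous)
    exact (contDiff_prod_shellDensity hm contDiff_id).continuous.mul
      (continuous_finsetSum _ fun μ _ => continuous_const.mul
        ((Complex.continuous_conj.comp (hc μ)).mul (hc μ)))
  · have hev : ∀ᶠ t : ℝ in 𝓝[≠] 0, |t| ≤ 1 ∧ t ≠ 0 := by
      refine Eventually.and ?_ self_mem_nhdsWithin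
      refine mem_nhdsWithin_of_mem_nhds ?_
      filter_upwards [Metric.ball_mem_nhds (0 : ℝ) one_pos] with t ht
      simpa using (mem_ball_zero_iff.1 ht).le
    filter_upwards [hev] with t ht
    refine Eventually.of_forall fun p => ?_
    rw [pairDensity, norm_mul]
    refine (mul_le_mul_of_nonneg_left (norm_sum_le _ _) (norm_nonneg _)).trans ?_
    rw [Finset.mul_sum]
    refine Finset.sum_le_sum fun μ _ => ?_
    have h := hC μ t ht.1 ht.2 p
    rw [← hRa] at h
    by_cases hp : p ∈ K μ
    · rw [Set.indicator_of_mem hp] at h ⊢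
      rw [norm_mul, norm_mul, RCLike.norm_conj]
      gcongr
      exact (norm_nonneg _).trans h
    · rw [Set.indicator_of_notMem hp] at h ⊢
      rw [norm_le_zero_iff.1 h]
      simp
  · refine integrable_finsetSum _ fun μ _ => ?_
    exact (integrable_indicator_iff (hK μ).isClosed.measurableSet).2
      ((hw.mul continuous_const).continuousOn.integrableOn_compact (hK μ))
  · refine Eventually.of_forall fun p => ?_
    have h1 : ∀ μ, Tendsto (fun t => R t n p μ) (𝓝[≠] 0) (𝓝 0) := by
      intro μ
      have h := (tendsto_slope_wignerU (m := m) (a := a) (A := A) hΨ n p μ).sub_const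
        (Complex.I * Proca.gen m a A Ψ n p μ)
      rwa [sub_self] at h
    have h2 := (tendsto_finsetSum Finset.univ fun (μ : Fin n → Fin s → Fin 4) _ =>
      ((((Complex.continuous_conj.tendsto 0).comp (h1 μ)).mul (h1 μ)).const_mul
        ((∏ i, gram (μ i) : ℝ) : ℂ))).const_mul ((∏ i, shellDensity m (p i) : ℝ) : ℂ)
    simp only [pairDensity]
    simpa using h2

/-! ### Oscillatory integrals -/

/-- The linear form `x ↦ v · x`. -/
noncomputable def mdotCLM (v : Spacetime) : Spacetime →L[ℝ] ℝ :=
  ∑ σ, lowerIndex v σ • ContinuousLinearMap.proj σ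

theorem mdotCLM_apply (v x : Spacetime) : mdotCLM v x = mdot v x := by
  simp [mdotCLM, mdot]

theorem continuous_mdotCLM : Continuous mdotCLM := by
  unfold mdotCLM
  simp only [lowerIndex_eq]
  fun_prop

theorem norm_exp_I_mul (r : ℝ) : ‖Complex.exp (Complex.I * r)‖ = 1 := by
  rw [mul_comm, Complex.norm_exp_ofReal_mul_I]

theorem hasFDerivAt_exp_mdot (v x : Spacetime) :
    HasFDerivAt (fun x => Complex.exp (Complex.I * mdot v x))
      ((Complex.exp (Complex.I * mdot v x) * Complex.I) • Complex.ofRealCLM.comp (mdotCLM v)) x := by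
  have h : HasFDerivAt (fun x => (mdot v x : ℂ)) (Complex.ofRealCLM.comp (mdotCLM v)) x := by
    have := (Complex.ofRealCLM.comp (mdotCLM v)).hasFDerivAt (x := x)
    rwa [show (⇑(Complex.ofRealCLM.comp (mdotCLM v))) = fun x => (mdot v x : ℂ) from
      funext fun x => congrArg Complex.ofReal (mdotCLM_apply v x)] at this
  have h2 := (h.const_mul Complex.I).cexp
  rwa [smul_smul] at h2

theorem continuous_mdot : Continuous fun y : Spacetime × Spacetime => mdot y.1 y.2 := by
  simp only [mdot_eq]
  fun_prop

theorem continuous_exp_mdot {X : Type*} [TopologicalSpace X] {φ : X → Spacetime} (hφ : Continuous φ) (x : Spacetime) :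
    Continuous fun ξ => Complex.exp (Complex.I * mdot (φ ξ) x) :=
  Complex.continuous_exp.comp (continuous_const.mul (Complex.continuous_ofReal.comp
    (continuous_mdot.comp (hφ.prodMk continuous_const))))

/-- The derivative of the integrand of an oscillatory integral. -/
noncomputable def oscDeriv {X : Type*} (φ : X → Spacetime) (f : X → ℂ) (x : Spacetime) (ξ : X) :
    Spacetime →L[ℝ] ℂ :=
  (f ξ * (Complex.exp (Complex.I * mdot (φ ξ) x) * Complex.I)) •
    Complex.ofRealCLM.comp (mdotCLM (φ ξ))

theorem continuous_oscDeriv {X : Type*} [TopologicalSpace X] {φ : X → Spacetime} {f : X → ℂ}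
    (hφ : Continuous φ) (hf : Continuous f) (x : Spacetime) : Continuous (oscDeriv φ f x) :=
  (hf.mul ((continuous_exp_mdot hφ x).mul continuous_const)).smul
    (continuous_const.clm_comp (continuous_mdotCLM.comp hφ))

section Osc

variable {X : Type} [NormedAddCommGroup X] [MeasureSpace X] [BorelSpace X]
  [IsFiniteMeasureOnCompacts (volume : Measure X)]

/-- The oscillatory integral `∫ f(ξ) e^{iφ(ξ)·x} dξ`. -/
noncomputable def osc (φ : X → Spacetime) (f : X → ℂ) (x : Spacetime) : ℂ :=
  ∫ ξ, f ξ * Complex.exp (Complex.I * mdot (φ ξ) x)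

variable {φ : X → Spacetime} {f : X → ℂ}

theorem hasFDerivAt_osc (hφ : Continuous φ) (hf : Continuous f) (hc : HasCompactSupport f)
    (x : Spacetime) : HasFDerivAt (osc φ f) (∫ ξ, oscDeriv φ f x ξ) x := by
  have hL : Continuous fun ξ => ‖Complex.ofRealCLM.comp (mdotCLM (φ ξ))‖ :=
    (continuous_const.clm_comp (continuous_mdotCLM.comp hφ)).norm
  have hb : Integrable fun ξ => ‖f ξ‖ * ‖Complex.ofRealCLM.comp (mdotCLM (φ ξ))‖ :=
    (hf.norm.mul hL).integrable_of_hasCompactSupport hc.norm.mul_right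
  have hi : ∀ x, Continuous fun ξ => f ξ * Complex.exp (Complex.I * mdot (φ ξ) x) := fun x =>
    hf.mul (continuous_exp_mdot hφ x)
  refine hasFDerivAt_integral_of_dominated_of_fderiv_le (F' := oscDeriv φ f) (s := Set.univ)
    Filter.univ_mem (Eventually.of_forall fun x => (hi x).aestronglyMeasurable)
    ((hi x).integrable_of_hasCompactSupport hc.mul_right)
    (continuous_oscDeriv hφ hf x).aestronglyMeasurable
    (Eventually.of_forall fun ξ x _ => ?_) hb (Eventually.of_forall fun ξ x _ => ?_)
  · rw [oscDeriv, norm_smul, norm_mul, norm_mul, norm_exp_I_mul, Complex.norm_I, one_mul, mul_one]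
  · have h := (hasFDerivAt_exp_mdot (φ ξ) x).const_mul (f ξ)
    rwa [smul_smul] at h

/-- Differentiation brings down the covariant component of the phase, so derivatives of fields
become operations on amplitudes. -/
theorem pd_osc (hφ : Continuous φ) (hf : Continuous f) (hc : HasCompactSupport f) (σ : Fin 4)
    (x : Spacetime) :
    pd σ (osc φ f) x = osc φ (fun ξ => Complex.I * lowerIndex (φ ξ) σ * f ξ) x := by
  have hcs : HasCompactSupport (oscDeriv φ f x) :=
    HasCompactSupport.intro hc fun ξ hξ => by
      ext v; simp [oscDeriv, image_eq_zero_of_notMem_tsupport hξ]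
  rw [pd, (hasFDerivAt_osc hφ hf hc x).fderiv, ContinuousLinearMap.integral_apply
    ((continuous_oscDeriv hφ hf x).integrable_of_hasCompactSupport hcs)]
  refine integral_congr_ae (Eventually.of_forall fun ξ => ?_)
  simp only [oscDeriv, _root_.smul_apply, ContinuousLinearMap.comp_apply, mdotCLM_apply,
    mdot_single, Complex.ofRealCLM_apply, smul_eq_mul]
  ring

end Osc

/-! ### Commutators with the field -/

variable {m : ℝ} {s : ℕ} {a : Spacetime} {A : Matrix (Fin 4) (Fin 4) ℝ} {Φ Ψ : WaveFun s}

theorem annihilate_apply (μ : Fin s → Fin 4) (x : Spacetime) (Ψ : WaveFun s) (n : ℕ)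
    (p : Fin n → Space) (κ : Fin n → Fin s → Fin 4) :
    annihilate m μ x Ψ n p κ = ∫ q, ((shellDensity m q : ℂ) *
      Complex.exp (-(Complex.I * mdot (onShell m q) x))) * ann μ q Ψ n p κ := by
  rw [annihilate, ← integral_const_mul]
  refine integral_congr_ae (Eventually.of_forall fun q => ?_)
  simp only [ann]
  ring

theorem continuous_wave (hm : 0 < m) (x : Spacetime) : Continuous fun q => (shellDensity m q : ℂ) *
    Complex.exp (-(Complex.I * mdot (onShell m q) x)) :=
  (contDiff_ofReal (contDiff_shellDensity hm)).continuous.mul (Complex.continuous_exp.comp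
    (continuous_const.mul (contDiff_ofReal (contDiff_mdot_onShell hm x)).continuous).neg)

theorem fockInner_annihilate (hm : 0 < m) (hΦ : ∀ n μ, ContDiff ℝ ∞ fun p => Φ n p μ)
    (hΨ : IsTestVector Ψ) (ν : Fin s → Fin 4) (y : Spacetime) :
    fockInner m Φ (annihilate m ν y Ψ) = ∫ q, ((shellDensity m q : ℂ) *
      Complex.exp (-(Complex.I * mdot (onShell m q) y))) * fockInner m Φ (ann ν q Ψ) := by
  rw [(IsTestVector.pair_ann hΦ hΨ ν).integral_mul_fockInner hm (continuous_wave hm y),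
    fockInner_eq_tsum]
  simp only [annihilate_apply, ← integral_const_mul, mul_left_comm]

theorem fockInner_annihilate_eq_osc (hm : 0 < m) (hΦ : IsTestVector Φ)
    (hΨ : IsTestVector Ψ) (ν : Fin s → Fin 4) :
    (fun y => fockInner m Φ (annihilate m ν y Ψ)) = osc (fun q => (-1 : ℝ) • onShell m q)
      fun q => (shellDensity m q : ℂ) * fockInner m Φ (ann ν q Ψ) := by
  funext y
  rw [fockInner_annihilate hm (fun n μ => (hΦ.test n μ).smooth) hΨ, osc]
  refine integral_congr_ae (Eventually.of_forall fun q => ?_)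
  simp only [mdot_smul_left]
  push_cast
  ring_nf

/-- Moving the generator across and using its commutator with `ann` leaves `-oneGen` acting on `⟨Φ,
a_ν(q)Ψ⟩`. Integration by parts moves the velocity derivative to `exp(-iq·y)`, where it produces
`q·(Ay)`. Together with `q·a` this is the contraction of `q` with `a + Ay`, that is, a derivative
with respect to `y`. -/
theorem fockInner_annihilate_gen (hm : 0 < m) (hA : IsLorentzGen A) (hΦ : IsTestVector Φ)
    (hΨ : IsTestVector Ψ) (ν : Fin s → Fin 4) (y : Spacetime) :
    fockInner m (gen m a A Φ) (annihilate m ν y Ψ) -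
        fockInner m Φ (annihilate m ν y (gen m a A Ψ)) =
      -Complex.I * ∑ σ, ((a + A *ᵥ y) σ : ℂ) *
          pd σ (fun y => fockInner m Φ (annihilate m ν y Ψ)) y -
        Complex.I * ∑ k, ∑ β, (A β (ν k) : ℂ) *
          fockInner m Φ (annihilate m (Function.update ν k β) y Ψ) := by
  have hs : ∀ {Φ : WaveFun s}, IsTestVector Φ → ∀ n μ, ContDiff ℝ ∞ fun p => Φ n p μ :=
    fun h n μ => (h.test n μ).smooth
  have hGΦ : IsTestVector (gen m a A Φ) := hΦ.gen_isTestVector hm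
  have hGΨ : IsTestVector (gen m a A Ψ) := hΨ.gen_isTestVector hm
  have hfam := IsTestVector.isOneParticleFamily (hs hΦ) hΨ
  set k : Space → (Fin s → Fin 4) → ℂ := fun q ν => fockInner m Φ (ann ν q Ψ) with hk
  have hkt : ∀ ν, IsTestFun fun q => k q ν := fun ν => (hfam.pair ν).isTestFun hm
  have h1 : ∀ q, fockInner m (gen m a A Φ) (ann ν q Ψ) - fockInner m Φ (ann ν q (gen m a A Ψ)) =
      -oneGen m a A k q ν := by
    intro q
    have hq := hΨ.ann_isTestVector ν q
    rw [hk, hfam.oneGen_fockInner hm, hΨ.ann_gen, fockInner_add_right hm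
      (hΦ.isPairing (hq.gen_isTestVector hm)) (hfam.isPairing_oneGen q ν),
      IsTestVector.fockInner_gen_symm hm hA hΦ hq]
    ring
  set w : Space → ℂ := fun q => (shellDensity m q : ℂ) *
    Complex.exp (-(Complex.I * mdot (onShell m q) y)) with hw
  have hwc : Continuous w := continuous_wave hm y
  have hint : ∀ {g : Space → ℂ}, IsTestFun g → Integrable fun q => w q * g q := fun {g} hg =>
    (hwc.mul hg.continuous).integrable_of_hasCompactSupport hg.compact.mul_left
  have hes : ContDiff ℝ ∞ fun q => Complex.exp (-(Complex.I * mdot (onShell m q) y)) :=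
    (contDiff_const.mul (contDiff_ofReal (contDiff_mdot_onShell hm y))).neg.cexp
  have hDk : IsTestFun fun q => fderiv ℝ (fun q => k q ν) q (velocity m A q) := by
    refine ⟨((hkt ν).smooth.fderiv_right (m := ∞) (by simp)).clm_apply (contDiff_velocity hm A),
      HasCompactSupport.intro (hkt ν).compact fun q hq => ?_⟩
    rw [image_eq_zero_of_notMem_tsupport (f := fderiv ℝ fun q => k q ν)
      fun h => hq (tsupport_fderiv_subset ℝ h)]
    rfl
  -- Invariance of the measure, applied to the product of plane wave and matrix element; the
  -- derivative of `q·y` along the velocity is `-q·(Ay)`.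
  have hparts : ∫ q, w q * fderiv ℝ (fun q => k q ν) q (velocity m A q) =
      -Complex.I * ∫ q, w q * ((mdot (onShell m q) (A *ᵥ y) : ℂ) * k q ν) := by
    have h := integral_shellDensity_fderiv_velocity hm hA (IsTestFun.mul_left hes (hkt ν))
    have hd : ∀ q, (shellDensity m q : ℂ) * fderiv ℝ (fun q =>
        Complex.exp (-(Complex.I * mdot (onShell m q) y)) * k q ν) q (velocity m A q) =
        w q * fderiv ℝ (fun q => k q ν) q (velocity m A q) +
          Complex.I * (w q * ((mdot (onShell m q) (A *ᵥ y) : ℂ) * k q ν)) := by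
      intro q
      have hmd : DifferentiableAt ℝ (fun q => mdot (onShell m q) y) q :=
        (contDiff_mdot_onShell hm y).differentiable (by simp) q
      have hmc : HasFDerivAt (fun q => (mdot (onShell m q) y : ℂ)) _ q :=
        Complex.ofRealCLM.hasFDerivAt.comp q hmd.hasFDerivAt
      have he : HasFDerivAt (fun q => Complex.exp (-(Complex.I * mdot (onShell m q) y))) _ q :=
        (hmc.const_mul Complex.I).fun_neg.cexp
      have hek : HasFDerivAt (fun q => Complex.exp (-(Complex.I * mdot (onShell m q) y)) * k q ν)
        _ q := he.mul ((hkt ν).differentiable q).hasFDerivAt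
      rw [hek.fderiv]
      simp only [_root_.add_apply, _root_.smul_apply, _root_.neg_apply,
        ContinuousLinearMap.comp_apply, fderiv_mdot_onShell_velocity hm hA,
        Complex.ofRealCLM_apply, smul_eq_mul, hw]
      push_cast
      ring
    simp only [hd] at h
    rw [integral_add (hint hDk) ((hint (IsTestFun.mul_left (contDiff_ofReal
      (contDiff_mdot_onShell hm _)) (hkt ν))).const_mul _), integral_const_mul] at h
    linear_combination h
  have hpd : ∀ σ, pd σ (fun y => fockInner m Φ (annihilate m ν y Ψ)) y =
      -Complex.I * ∫ q, w q * ((lowerIndex (onShell m q) σ : ℂ) * k q ν) := by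
    intro σ
    have hρk : IsTestFun fun q => (shellDensity m q : ℂ) * k q ν :=
      IsTestFun.mul_left (contDiff_ofReal (contDiff_shellDensity hm)) (hkt ν)
    have hφ : Continuous fun q => (-1 : ℝ) • onShell m q := (continuous_onShell hm).fun_const_smul _
    rw [fockInner_annihilate_eq_osc hm hΦ hΨ, pd_osc hφ
      hρk.continuous hρk.compact, osc, ← integral_const_mul]
    refine integral_congr_ae (Eventually.of_forall fun q => ?_)
    simp only [mdot_smul_left, lowerIndex_smul, hw]
    push_cast
    ring_nf
  have hmdot : ∀ b : Spacetime, ∫ q, w q * ((mdot (onShell m q) b : ℂ) * k q ν) =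
      ∑ σ, (b σ : ℂ) * ∫ q, w q * ((lowerIndex (onShell m q) σ : ℂ) * k q ν) := by
    intro b
    simp only [← integral_const_mul]
    rw [← integral_finsetSum _ fun σ _ => (hint (IsTestFun.mul_left (contDiff_ofReal
      (contDiff_lowerIndex_onShell hm σ)) (hkt ν))).const_mul _]
    refine integral_congr_ae (Eventually.of_forall fun q => ?_)
    simp only [mdot]
    push_cast
    simp only [Finset.mul_sum, Finset.sum_mul]
    exact Finset.sum_congr rfl fun σ _ => by ring
  have hk1 := (IsTestVector.pair_ann (hs hGΦ) hΨ ν).isTestFun hm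
  have hk2 := (IsTestVector.pair_ann (hs hΦ) hGΨ ν).isTestFun hm
  rw [fockInner_annihilate hm (hs hGΦ) hΨ, fockInner_annihilate hm (hs hΦ) hGΨ,
    ← integral_sub (hint hk1) (hint hk2)]
  simp only [← mul_sub, h1, fun ν => fockInner_annihilate hm (hs hΦ) hΨ ν y, hpd]
  have hsum : IsTestFun fun q => ∑ j, ∑ β, (A β (ν j) : ℂ) * k q (Function.update ν j β) :=
    IsTestFun.sum _ fun j _ => IsTestFun.sum _ fun β _ => (hkt _).const_mul _
  have hma : ∀ b, IsTestFun fun q => (mdot (onShell m q) b : ℂ) * k q ν := fun b =>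
    IsTestFun.mul_left (contDiff_ofReal (contDiff_mdot_onShell hm b)) (hkt ν)
  have hexpand : ∀ q, w q * -oneGen m a A k q ν =
      -(w q * ((mdot (onShell m q) a : ℂ) * k q ν)) -
        Complex.I * (w q * fderiv ℝ (fun q => k q ν) q (velocity m A q)) -
        Complex.I * (w q * ∑ j, ∑ β, (A β (ν j) : ℂ) * k q (Function.update ν j β)) := by
    intro q
    simp only [oneGen]
    ring
  have hsumint : ∫ q, w q * ∑ j, ∑ β, (A β (ν j) : ℂ) * k q (Function.update ν j β) =
      ∑ j, ∑ β, (A β (ν j) : ℂ) * ∫ q, w q * k q (Function.update ν j β) := by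
    simp only [Finset.mul_sum, mul_left_comm (w _), ← integral_const_mul]
    rw [integral_finsetSum _ fun j _ => integrable_finsetSum _ fun β _ =>
      (hint (hkt _)).const_mul _]
    exact Finset.sum_congr rfl fun j _ => integral_finsetSum _ fun β _ =>
      (hint (hkt _)).const_mul _
  change ∫ q, w q * -oneGen m a A k q ν = _
  simp only [hexpand]
  rw [integral_sub ((hint (hma a)).fun_neg.sub' ((hint hDk).const_mul _)) ((hint hsum).const_mul _),
    integral_sub (hint (hma a)).fun_neg ((hint hDk).const_mul _), integral_neg, integral_const_mul,
    integral_const_mul, hparts, hsumint, hmdot, hmdot]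
  simp only [Pi.add_apply, Complex.ofReal_add, add_mul, Finset.sum_add_distrib,
    mul_left_comm _ (-Complex.I), ← Finset.mul_sum]
  ring_nf
  simp only [Complex.I_sq]
  ring

theorem differentiableAt_fockInner_annihilate (hm : 0 < m) (hΦ : IsTestVector Φ)
    (hΨ : IsTestVector Ψ) (ν : Fin s → Fin 4) (y : Spacetime) :
    DifferentiableAt ℝ (fun y => fockInner m Φ (annihilate m ν y Ψ)) y := by
  have hρk := IsTestFun.mul_left (contDiff_ofReal (contDiff_shellDensity hm))
    ((IsTestVector.pair_ann (fun n μ => (hΦ.test n μ).smooth) hΨ ν).isTestFun hm)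
  rw [fockInner_annihilate_eq_osc hm hΦ hΨ]
  exact (hasFDerivAt_osc (φ := fun q => (-1 : ℝ) • onShell m q)
    ((continuous_onShell hm).fun_const_smul _) hρk.continuous
    hρk.compact y).differentiableAt

theorem pd_conj (σ : Fin 4) (f : Spacetime → ℂ) (y : Spacetime) :
    pd σ (fun y => conj (f y)) y = conj (pd σ f y) := fderiv_conj f y _

theorem fieldForm_eq (ν : Fin s → Fin 4) (y : Spacetime) :
    fieldForm m Φ Ψ ν y = fockInner m Φ (annihilate m ν y Ψ) +
      conj (fockInner m Ψ (annihilate m ν y Φ)) := by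
  rw [fieldForm, conj_fockInner]

/-- The commutators of the generators with the field. -/
theorem fieldForm_gen (hm : 0 < m) (hA : IsLorentzGen A) (hΦ : IsTestVector Φ)
    (hΨ : IsTestVector Ψ) (ν : Fin s → Fin 4) (y : Spacetime) :
    fieldForm m (gen m a A Φ) Ψ ν y - fieldForm m Φ (gen m a A Ψ) ν y =
      -Complex.I * ∑ σ, ((a + A *ᵥ y) σ : ℂ) * pd σ (fieldForm m Φ Ψ ν) y -
        Complex.I * ∑ k, ∑ β, (A β (ν k) : ℂ) * fieldForm m Φ Ψ (Function.update ν k β) y := by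
  have hpd : ∀ σ, pd σ (fieldForm m Φ Ψ ν) y =
      pd σ (fun y => fockInner m Φ (annihilate m ν y Ψ)) y +
        conj (pd σ (fun y => fockInner m Ψ (annihilate m ν y Φ)) y) := by
    intro σ
    rw [show fieldForm m Φ Ψ ν = _ from funext (fieldForm_eq ν), ← pd_conj]
    have h1 := differentiableAt_fockInner_annihilate hm hΦ hΨ ν y
    have h2 : DifferentiableAt ℝ (fun y => conj (fockInner m Ψ (annihilate m ν y Φ))) y :=
      Complex.conjCLE.differentiableAt.comp y (differentiableAt_fockInner_annihilate hm hΨ hΦ ν y)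
    rw [pd, fderiv_fun_add h1 h2]
    rfl
  have h1 := fockInner_annihilate_gen (a := a) hm hA hΦ hΨ ν y
  -- The creation part of the field is the complex conjugate of the annihilation part with `Φ` and
  -- `Ψ` exchanged.
  have h2 := congrArg conj (fockInner_annihilate_gen (a := a) hm hA hΨ hΦ ν y)
  simp only [map_sub, map_mul, map_neg, map_sum, Complex.conj_I, Complex.conj_ofReal] at h2
  simp only [hpd, fieldForm_eq, mul_add, Finset.sum_add_distrib]
  linear_combination h1 - h2

/-! ### Bilocal forms -/

variable {m : ℝ} {s : ℕ} {Φ Ψ : WaveFun s}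

/-- The sign of a frequency. -/
def sgn (b : Bool) : ℝ := if b then 1 else -1

theorem sgn_sq (b : Bool) : sgn b ^ 2 = 1 := by cases b <;> simp [sgn]

/-- The bilocal function with amplitude `f`, a sum over the signs of both frequencies. -/
noncomputable def bilocal (m : ℝ) (f : Bool × Bool → Space × Space → ℂ) (x y : Spacetime) : ℂ :=
  ∑ b, ∫ z : Space × Space, f b z *
    (Complex.exp (Complex.I * mdot (sgn b.1 • onShell m z.1) x) *
      Complex.exp (Complex.I * mdot (sgn b.2 • onShell m z.2) y))

/-- The total momentum of a pair of frequencies. -/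
noncomputable def pairSum (m : ℝ) (b : Bool × Bool) (z : Space × Space) : Spacetime :=
  sgn b.1 • onShell m z.1 + sgn b.2 • onShell m z.2

/-- The difference of the momenta of a pair of frequencies. -/
noncomputable def pairDiff (m : ℝ) (b : Bool × Bool) (z : Space × Space) : Spacetime :=
  sgn b.2 • onShell m z.2 - sgn b.1 • onShell m z.1

/-- The function with amplitude `f` on the diagonal. -/
noncomputable def diagonal (m : ℝ) (f : Bool × Bool → Space × Space → ℂ) (x : Spacetime) : ℂ :=
  ∑ b, osc (pairSum m b) (f b) x

theorem continuous_pairSum (hm : 0 < m) (b : Bool × Bool) : Continuous (pairSum m b) :=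
  (((continuous_onShell hm).comp continuous_fst).fun_const_smul _).add
    (((continuous_onShell hm).comp continuous_snd).fun_const_smul _)

theorem contDiff_lowerIndex_pairSum (hm : 0 < m) (b : Bool × Bool) (σ : Fin 4) :
    ContDiff ℝ ∞ fun z => lowerIndex (pairSum m b z) σ := by
  simp only [pairSum, lowerIndex_add, lowerIndex_smul]
  exact (contDiff_const.mul ((contDiff_lowerIndex_onShell hm σ).comp contDiff_fst)).add
    (contDiff_const.mul ((contDiff_lowerIndex_onShell hm σ).comp contDiff_snd))

theorem contDiff_lowerIndex_pairDiff (hm : 0 < m) (b : Bool × Bool) (σ : Fin 4) :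
    ContDiff ℝ ∞ fun z => lowerIndex (pairDiff m b z) σ := by
  simp only [pairDiff, lowerIndex_sub, lowerIndex_smul]
  exact (contDiff_const.mul ((contDiff_lowerIndex_onShell hm σ).comp contDiff_snd)).sub
    (contDiff_const.mul ((contDiff_lowerIndex_onShell hm σ).comp contDiff_fst))

theorem mdot_add_left (v w x : Spacetime) : mdot (v + w) x = mdot v x + mdot w x := by
  simp only [mdot, lowerIndex_add, add_mul, Finset.sum_add_distrib]

theorem bilocal_self (f : Bool × Bool → Space × Space → ℂ) (x : Spacetime) :
    bilocal m f x x = diagonal m f x := by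
  refine Finset.sum_congr rfl fun b _ => integral_congr_ae (Eventually.of_forall fun z => ?_)
  simp only [pairSum, mdot_add_left, Complex.ofReal_add, mul_add, Complex.exp_add]

/-- The amplitude of a bilocal function after application of the two-sided derivative. -/
noncomputable def arrowAmp (m : ℝ) (σ : Fin 4) (f : Bool × Bool → Space × Space → ℂ) (b : Bool × Bool)
    (z : Space × Space) : ℂ := Complex.I * lowerIndex (pairDiff m b z) σ * f b z

theorem isTestFun_arrowAmp (hm : 0 < m) (σ : Fin 4) {f : Bool × Bool → Space × Space → ℂ}
    (hf : ∀ b, IsTestFun (f b)) (b : Bool × Bool) : IsTestFun (arrowAmp m σ f b) :=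
  IsTestFun.mul_left (contDiff_const.mul (contDiff_ofReal (contDiff_lowerIndex_pairDiff hm b σ)))
    (hf b)

theorem pd_sum {ι : Type*} (t : Finset ι) {F : ι → Spacetime → ℂ} (σ : Fin 4) (x : Spacetime)
    (hF : ∀ i ∈ t, DifferentiableAt ℝ (F i) x) :
    pd σ (fun x => ∑ i ∈ t, F i x) x = ∑ i ∈ t, pd σ (F i) x := by
  simp only [pd]
  rw [fderiv_fun_sum hF, _root_.sum_apply]

/-- The derivatives with respect to `y` and `x` bring down `i` times the second and the first signed
momentum; their difference is the factor in `arrowAmp`. -/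
theorem arrow_bilocal (hm : 0 < m) {f : Bool × Bool → Space × Space → ℂ}
    (hf : ∀ b, IsTestFun (f b)) (σ : Fin 4) :
    arrow σ (bilocal m f) = bilocal m (arrowAmp m σ f) := by
  funext x y
  have hc1 : ∀ b : Bool, Continuous fun z : Space × Space => sgn b • onShell m z.1 := fun b =>
    ((continuous_onShell hm).comp continuous_fst).fun_const_smul _
  have hc2 : ∀ b : Bool, Continuous fun z : Space × Space => sgn b • onShell m z.2 := fun b =>
    ((continuous_onShell hm).comp continuous_snd).fun_const_smul _
  have h1 : (fun x' => bilocal m f x' y) = fun x' => ∑ b : Bool × Bool,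
      osc (fun z : Space × Space => sgn b.1 • onShell m z.1)
        (fun z => f b z * Complex.exp (Complex.I * mdot (sgn b.2 • onShell m z.2) y)) x' := by
    funext x'
    refine Finset.sum_congr rfl fun b _ => integral_congr_ae (Eventually.of_forall fun z => ?_)
    simp only []
    ring
  have h2 : (fun y' => bilocal m f x y') = fun y' => ∑ b : Bool × Bool,
      osc (fun z : Space × Space => sgn b.2 • onShell m z.2)
        (fun z => f b z * Complex.exp (Complex.I * mdot (sgn b.1 • onShell m z.1) x)) y' := by
    funext y'
    refine Finset.sum_congr rfl fun b _ => integral_congr_ae (Eventually.of_forall fun z => ?_)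
    simp only []
    ring
  have hf1 : ∀ b : Bool × Bool, Continuous fun z =>
      f b z * Complex.exp (Complex.I * mdot (sgn b.2 • onShell m z.2) y) := fun b =>
    (hf b).continuous.mul (continuous_exp_mdot (hc2 b.2) y)
  have hf2 : ∀ b : Bool × Bool, Continuous fun z =>
      f b z * Complex.exp (Complex.I * mdot (sgn b.1 • onShell m z.1) x) := fun b =>
    (hf b).continuous.mul (continuous_exp_mdot (hc1 b.1) x)
  have hs : ∀ (b : Bool × Bool) (g : Space × Space → ℂ), HasCompactSupport fun z => f b z * g z :=
    fun b g => (hf b).compact.mul_right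
  rw [arrow, h1, h2, pd_sum _ _ _ fun b _ =>
    (hasFDerivAt_osc (hc1 b.1) (hf1 b) (hs b _) x).differentiableAt, pd_sum _ _ _ fun b _ =>
    (hasFDerivAt_osc (hc2 b.2) (hf2 b) (hs b _) y).differentiableAt, ← Finset.sum_sub_distrib]
  refine Finset.sum_congr rfl fun b _ => ?_
  rw [pd_osc (hc1 b.1) (hf1 b) (hs b _), pd_osc (hc2 b.2) (hf2 b) (hs b _), osc, osc,
    ← integral_sub]
  · refine integral_congr_ae (Eventually.of_forall fun z => ?_)
    simp only [arrowAmp, pairDiff, lowerIndex_sub]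
    push_cast
    ring
  · refine Continuous.integrable_of_hasCompactSupport (Continuous.mul (Continuous.mul
      (continuous_const.mul (Complex.continuous_ofReal.comp ?_)) (hf2 b))
      (continuous_exp_mdot (hc2 b.2) y)) (hs b _).mul_left.mul_right
    simp only [lowerIndex_smul]
    exact continuous_const.mul ((contDiff_lowerIndex_onShell hm σ).continuous.comp continuous_snd)
  · refine Continuous.integrable_of_hasCompactSupport (Continuous.mul (Continuous.mul
      (continuous_const.mul (Complex.continuous_ofReal.comp ?_)) (hf1 b))
      (continuous_exp_mdot (hc1 b.1) x)) (hs b _).mul_left.mul_right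
    simp only [lowerIndex_smul]
    exact continuous_const.mul ((contDiff_lowerIndex_onShell hm σ).continuous.comp continuous_fst)

/-! ### Functions with an amplitude -/

theorem differentiable_diagonal (hm : 0 < m) {f : Bool × Bool → Space × Space → ℂ}
    (hf : ∀ b, IsTestFun (f b)) : Differentiable ℝ (diagonal m f) := fun x =>
  DifferentiableAt.fun_sum fun b _ => (hasFDerivAt_osc (continuous_pairSum hm b) (hf b).continuous
    (hf b).compact x).differentiableAt

theorem pd_diagonal (hm : 0 < m) {f : Bool × Bool → Space × Space → ℂ}
    (hf : ∀ b, IsTestFun (f b)) (σ : Fin 4) : pd σ (diagonal m f) =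
      diagonal m fun b z => Complex.I * lowerIndex (pairSum m b z) σ * f b z := by
  funext x
  unfold diagonal
  rw [pd_sum _ _ _ fun b _ => (hasFDerivAt_osc (continuous_pairSum hm b) (hf b).continuous
    (hf b).compact x).differentiableAt]
  exact Finset.sum_congr rfl fun b _ =>
    pd_osc (continuous_pairSum hm b) (hf b).continuous (hf b).compact σ x

theorem osc_integrable (hm : 0 < m) (b : Bool × Bool) {f : Space × Space → ℂ} (hf : IsTestFun f)
    (x : Spacetime) : Integrable fun z => f z * Complex.exp (Complex.I * mdot (pairSum m b z) x) :=
  (hf.continuous.mul (continuous_exp_mdot (continuous_pairSum hm b) x)).integrable_of_hasCompactSupport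
    hf.compact.mul_right

theorem osc_sum (hm : 0 < m) (b : Bool × Bool) {ι : Type*} (t : Finset ι)
    {f : ι → Space × Space → ℂ} (hf : ∀ i ∈ t, IsTestFun (f i)) (x : Spacetime) :
    osc (pairSum m b) (fun z => ∑ i ∈ t, f i z) x = ∑ i ∈ t, osc (pairSum m b) (f i) x := by
  simp only [osc, Finset.sum_mul]
  exact integral_finsetSum _ fun i hi => osc_integrable hm b (hf i hi) x

theorem osc_const_mul (b : Bool × Bool) (c : ℂ) (f : Space × Space → ℂ) (x : Spacetime) :
    osc (pairSum m b) (fun z => c * f z) x = c * osc (pairSum m b) f x := by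
  simp only [osc, mul_assoc, integral_const_mul]

theorem diagonal_sum (hm : 0 < m) {ι : Type*} (t : Finset ι)
    {f : ι → Bool × Bool → Space × Space → ℂ} (hf : ∀ i ∈ t, ∀ b, IsTestFun (f i b))
    (x : Spacetime) :
    diagonal m (fun b z => ∑ i ∈ t, f i b z) x = ∑ i ∈ t, diagonal m (f i) x := by
  simp only [diagonal, fun b => osc_sum hm b t (fun i hi => hf i hi b) x]
  exact Finset.sum_comm

theorem diagonal_const_mul (c : ℂ) (f : Bool × Bool → Space × Space → ℂ) (x : Spacetime) :
    diagonal m (fun b z => c * f b z) x = c * diagonal m f x := by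
  simp only [diagonal, osc_const_mul, Finset.mul_sum]

/-! ### Spatial integrals and moments -/

variable {m : ℝ} {s : ℕ} {Φ Ψ : WaveFun s}

theorem mdot_onShell_point (q : Space) (t : ℝ) (x : Space) :
    mdot (onShell m q) (point t x) = t * energy m q - inner ℝ q x := by
  rw [mdot_succ, onShell_zero, point_zero, PiLp.inner_apply]
  simp only [onShell_succ, point_succ, RCLike.inner_apply, conj_trivial]
  rw [mul_comm]
  congr 1
  exact Finset.sum_congr rfl fun _ _ => mul_comm _ _

/-- The spatial integral of an oscillatory integral. -/
noncomputable def slice (m : ℝ) (b : Bool × Bool) (t : ℝ) (f : Space × Space → ℂ) : ℂ :=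
  (2 * Real.pi) ^ 3 * ∫ q : Space, f (q, -(sgn b.1 * sgn b.2) • q) *
    Complex.exp (Complex.I * (t * ((sgn b.1 + sgn b.2) * energy m q) : ℝ))

theorem contDiff_energy_phase (hm : 0 < m) (b : Bool × Bool) (t : ℝ) :
    ContDiff ℝ ∞ fun z : Space × Space => Complex.exp (Complex.I *
      (t * (sgn b.1 * energy m z.1 + sgn b.2 * energy m z.2) : ℝ)) :=
  (contDiff_const.mul (contDiff_ofReal (contDiff_const.mul
    ((contDiff_const.mul ((contDiff_energy hm).comp contDiff_fst)).add
      (contDiff_const.mul ((contDiff_energy hm).comp contDiff_snd)))))).cexp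

/-- The time-dependent phase is absorbed into the amplitude before `integrable_bilocal_slice` is
applied. On the slice the two momenta differ at most by a sign, hence have the same energy. -/
theorem integrable_osc_slice (hm : 0 < m) (b : Bool × Bool) (t : ℝ) {f : Space × Space → ℂ}
    (hf : IsTestFun f) : Integrable (fun x : Space => osc (pairSum m b) f (point t x)) ∧
      ∫ x : Space, osc (pairSum m b) f (point t x) = slice m b t f := by
  have hF := IsTestFun.mul_left (contDiff_energy_phase hm b t) hf
  have h := integrable_bilocal_slice (ε₁ := sgn b.1) hF (sgn_sq b.2)
  have heq : ∀ x : Space, osc (pairSum m b) f (point t x) = ∫ z : Space × Space,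
      Complex.exp (Complex.I * (t * (sgn b.1 * energy m z.1 + sgn b.2 * energy m z.2) : ℝ)) * f z *
        Complex.exp (-(Complex.I * (inner ℝ (sgn b.1 • z.1 + sgn b.2 • z.2) x : ℝ))) := by
    intro x
    refine integral_congr_ae (Eventually.of_forall fun z => ?_)
    simp only [pairSum, mdot_add_left, mdot_smul_left, mdot_onShell_point, inner_add_left,
      inner_smul_left, conj_trivial]
    rw [mul_comm (Complex.exp _) (f z), mul_assoc, ← Complex.exp_add]
    congr 2
    push_cast
    ring
  simp only [heq]
  refine ⟨h.1, h.2.trans ?_⟩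
  rw [slice]
  congr 1
  refine integral_congr_ae (Eventually.of_forall fun q => ?_)
  simp only []
  rw [energy_smul _ (by rw [neg_sq, mul_pow, sgn_sq, sgn_sq, one_mul]), mul_comm, add_mul]

/-- The projection of the coordinate vectors to physical space. -/
noncomputable def spatialDir (σ : Fin 4) : Space :=
  Fin.cases 0 (fun j => EuclideanSpace.single j 1) σ

theorem spatialDir_zero : spatialDir 0 = 0 := rfl

theorem spatialDir_succ (j : Fin 3) : spatialDir j.succ = EuclideanSpace.single j 1 := rfl

theorem eta_zero_zero : η 0 0 = 1 := by simp [η]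

theorem eta_succ_succ (j : Fin 3) : η j.succ j.succ = -1 := by fin_cases j <;> simp [η]

/-- For `σ = 0` both sides vanish. With the convention `spatialDir 0 = 0`, the time and space
components can be treated by the same formulas. -/
theorem fderiv_energy_spatialDir (hm : 0 < m) (q : Space) (σ : Fin 4) :
    fderiv ℝ (energy m) q (spatialDir σ) = η σ 0 - lowerIndex (onShell m q) σ / energy m q := by
  have hE := (energy_pos hm q).ne'
  cases σ using Fin.cases with
  | zero => simp [spatialDir_zero, eta_zero_zero, lowerIndex_zero, onShell_zero, hE]
  | succ j =>
    rw [fderiv_energy hm, spatialDir_succ, eta_of_ne (Fin.succ_ne_zero j), lowerIndex_succ,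
      onShell_succ]
    simp [neg_div]

theorem fderiv_lowerIndex_onShell (hm : 0 < m) (q : Space) (σ τ : Fin 4) :
    fderiv ℝ (fun q => lowerIndex (onShell m q) τ) q (spatialDir σ) =
      η σ τ - η τ 0 * (lowerIndex (onShell m q) σ / energy m q) := by
  cases τ using Fin.cases with
  | zero =>
    have : (fun q => lowerIndex (onShell m q) 0) = energy m := by
      funext q; rw [lowerIndex_zero, onShell_zero]
    rw [this, fderiv_energy_spatialDir hm, eta_zero_zero, one_mul]
  | succ k =>
    have : (fun q => lowerIndex (onShell m q) k.succ) = fun q => -q k := by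
      funext q; rw [lowerIndex_succ, onShell_succ]
    rw [this, fderiv_fun_neg, _root_.neg_apply, fderiv_coord, eta_of_ne (Fin.succ_ne_zero k),
      zero_mul, sub_zero]
    cases σ using Fin.cases with
    | zero => simp [spatialDir_zero, eta_of_ne (Fin.succ_ne_zero k).symm]
    | succ j =>
      rw [spatialDir_succ, PiLp.single_apply]
      by_cases h : k = j
      · rw [h, eta_succ_succ]; simp
      · rw [eta_of_ne fun h' => h (Fin.succ_injective _ h').symm]; simp [h]

/-- The amplitude of an oscillatory integral multiplied by a coordinate at time `t`. -/
noncomputable def weight (m : ℝ) (b : Bool × Bool) (t : ℝ) (σ : Fin 4) (f : Space × Space → ℂ)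
    (z : Space × Space) : ℂ :=
  Complex.I * sgn b.2 * fderiv ℝ f z (0, spatialDir σ) +
    ((t * (lowerIndex (onShell m z.2) σ / energy m z.2) : ℝ) : ℂ) * f z

theorem isTestFun_weight (hm : 0 < m) (b : Bool × Bool) (t : ℝ) (σ : Fin 4)
    {f : Space × Space → ℂ} (hf : IsTestFun f) : IsTestFun (weight m b t σ f) :=
  ((hf.fderiv_apply _).const_mul _).add (IsTestFun.mul_left (contDiff_ofReal (contDiff_const.mul
    ((ContDiff.div (contDiff_lowerIndex_onShell hm σ) (contDiff_energy hm)
      fun q => (energy_pos hm q).ne').comp contDiff_snd))) hf)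

theorem fderiv_exp_pairSum (hm : 0 < m) (b : Bool × Bool) (t : ℝ) (x : Space) (σ : Fin 4)
    (z : Space × Space) :
    fderiv ℝ (fun z => Complex.exp (Complex.I * mdot (pairSum m b z) (point t x))) z
      (0, spatialDir σ) = Complex.I * sgn b.2 * ((t * (η σ 0 - lowerIndex (onShell m z.2) σ /
        energy m z.2) - inner ℝ (spatialDir σ) x : ℝ) : ℂ) *
      Complex.exp (Complex.I * mdot (pairSum m b z) (point t x)) := by
  have h0 : ∀ z, mdot (pairSum m b z) (point t x) = sgn b.1 * (t * energy m z.1 - inner ℝ z.1 x) +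
      sgn b.2 * (t * energy m z.2 - inner ℝ z.2 x) := fun z => by
    simp only [pairSum, mdot_add_left, mdot_smul_left, mdot_onShell_point]
  simp only [h0]
  obtain ⟨q, q'⟩ := z
  have hE : HasDerivAt (fun r : ℝ => energy m (q' + r • spatialDir σ))
      (η σ 0 - lowerIndex (onShell m q') σ / energy m q') 0 := by
    rw [← fderiv_energy_spatialDir hm]
    exact ((contDiff_energy hm).differentiable (by simp) q').hasFDerivAt.hasLineDerivAt _
  have hx : HasDerivAt (fun r : ℝ => inner ℝ (q' + r • spatialDir σ) x)
      (inner ℝ (spatialDir σ) x) 0 := by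
    simp only [inner_add_left, inner_smul_left, conj_trivial]
    simpa using ((hasDerivAt_id (0 : ℝ)).mul_const (inner ℝ (spatialDir σ) x)).const_add
      (inner ℝ q' x)
  have h1 := (((((hE.const_mul t).sub hx).const_mul (sgn b.2)).const_add
    (sgn b.1 * (t * energy m q - inner ℝ q x))).ofReal_comp.const_mul Complex.I).cexp
  have hdiff : DifferentiableAt ℝ (fun z : Space × Space => Complex.exp (Complex.I *
      ((sgn b.1 * (t * energy m z.1 - inner ℝ z.1 x) +
        sgn b.2 * (t * energy m z.2 - inner ℝ z.2 x) : ℝ) : ℂ))) (q, q') := by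
    refine ContDiff.differentiable (n := ∞) ((contDiff_const.mul (contDiff_ofReal ?_)).cexp)
      (by simp) _
    exact (contDiff_const.mul ((contDiff_const.mul ((contDiff_energy hm).comp contDiff_fst)).sub
      (contDiff_fst.inner ℝ contDiff_const))).add
      (contDiff_const.mul ((contDiff_const.mul ((contDiff_energy hm).comp contDiff_snd)).sub
      (contDiff_snd.inner ℝ contDiff_const)))
  have h2 := hdiff.hasFDerivAt.hasLineDerivAt (0, spatialDir σ)
  unfold HasLineDerivAt at h2
  simp only [Prod.smul_mk, Prod.mk_add_mk, smul_zero, add_zero] at h2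
  refine (h2.unique h1).trans ?_
  simp only [Pi.sub_apply, zero_smul, add_zero]
  push_cast
  ring

/-- A momentum derivative of the plane wave brings down the position, up to a group-velocity term
proportional to `t`; integration by parts in the second momentum moves it to the amplitude. For `σ =
0` only the factor `t` remains. -/
theorem lowerIndex_mul_osc (hm : 0 < m) (b : Bool × Bool) (t : ℝ) (σ : Fin 4)
    {f : Space × Space → ℂ} (hf : IsTestFun f) (x : Space) :
    (lowerIndex (point t x) σ : ℂ) * osc (pairSum m b) f (point t x) =
      osc (pairSum m b) (weight m b t σ f) (point t x) := by
  have hes : ContDiff ℝ ∞ fun z => Complex.exp (Complex.I * mdot (pairSum m b z) (point t x)) := by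
    simp only [pairSum, mdot_add_left, mdot_smul_left]
    exact (contDiff_const.mul (contDiff_ofReal
      ((contDiff_const.mul ((contDiff_mdot_onShell hm _).comp contDiff_fst)).add
      (contDiff_const.mul ((contDiff_mdot_onShell hm _).comp contDiff_snd))))).cexp
  have : (volume : Measure (Space × Space)).IsAddHaarMeasure := by
    rw [Measure.volume_eq_prod]; infer_instance
  have hp := IsTestFun.integral_mul_fderiv (μ := volume) hes hf (0, spatialDir σ)
  simp only [fderiv_exp_pairSum hm] at hp
  have hx : lowerIndex (point t x) σ = t * η σ 0 - inner ℝ (spatialDir σ) x := by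
    cases σ using Fin.cases with
    | zero => simp [lowerIndex_zero, point_zero, eta_zero_zero, spatialDir_zero]
    | succ j => simp [lowerIndex_succ, point_succ, eta_of_ne, spatialDir_succ,
        EuclideanSpace.inner_single_left]
  have hi := osc_integrable hm b (isTestFun_weight hm b t σ hf) (point t x)
  have hi1 := (osc_integrable hm b (hf.fderiv_apply (0, spatialDir σ)) (point t x)).const_mul
    (Complex.I * sgn b.2)
  have hs : Complex.I * (sgn b.2 : ℂ) * (Complex.I * sgn b.2) = -1 := by
    rw [mul_mul_mul_comm, Complex.I_mul_I, ← Complex.ofReal_mul, ← sq, sgn_sq, Complex.ofReal_one,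
      mul_one]
  have hsplit : ∀ z, weight m b t σ f z * Complex.exp (Complex.I * mdot (pairSum m b z) (point t x))
      = Complex.I * sgn b.2 * (fderiv ℝ f z (0, spatialDir σ) *
          Complex.exp (Complex.I * mdot (pairSum m b z) (point t x))) +
        (lowerIndex (point t x) σ * (f z * Complex.exp (Complex.I * mdot (pairSum m b z) (point t x)))
          + Complex.I * sgn b.2 * (Complex.I * sgn b.2 * ((t * (η σ 0 - lowerIndex (onShell m z.2) σ /
        energy m z.2) - inner ℝ (spatialDir σ) x : ℝ) : ℂ) *
      Complex.exp (Complex.I * mdot (pairSum m b z) (point t x)) * f z)) := by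
    intro z
    rw [weight, hx]
    push_cast
    linear_combination (-(((t * (η σ 0 - lowerIndex (onShell m z.2) σ / energy m z.2) -
      inner ℝ (spatialDir σ) x) : ℂ) *
        Complex.exp (Complex.I * mdot (pairSum m b z) (point t x)) * f z)) * hs
  have hi2 := (osc_integrable hm b hf (point t x)).const_mul (lowerIndex (point t x) σ : ℂ)
  have hi3 : Integrable fun z => Complex.I * sgn b.2 * (Complex.I * sgn b.2 *
      ((t * (η σ 0 - lowerIndex (onShell m z.2) σ /
        energy m z.2) - inner ℝ (spatialDir σ) x : ℝ) : ℂ) *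
      Complex.exp (Complex.I * mdot (pairSum m b z) (point t x)) * f z) := by
    have := (hi.sub' hi1).sub' hi2
    refine this.congr (Eventually.of_forall fun z => ?_)
    simp only [hsplit]
    ring
  unfold osc
  simp only [hsplit]
  rw [integral_add hi1 (hi2.fun_add hi3), integral_add hi2 hi3, integral_const_mul, integral_const_mul,
    integral_const_mul]
  simp only [mul_comm (fderiv ℝ f _ _) (Complex.exp _)]
  rw [hp]
  ring

/-! ### Charges -/

variable {m : ℝ} {s : ℕ} {Φ Ψ : WaveFun s}

theorem integrable_diagonal (hm : 0 < m) (t : ℝ) {f : Bool × Bool → Space × Space → ℂ}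
    (hf : ∀ b, IsTestFun (f b)) : Integrable (fun x : Space => diagonal m f (point t x)) ∧
      ∫ x : Space, diagonal m f (point t x) = ∑ b, slice m b t (f b) := by
  unfold diagonal
  refine ⟨integrable_finsetSum _ fun b _ => (integrable_osc_slice hm b t (hf b)).1, ?_⟩
  rw [integral_finsetSum _ fun b _ => (integrable_osc_slice hm b t (hf b)).1]
  exact Finset.sum_congr rfl fun b _ => (integrable_osc_slice hm b t (hf b)).2

theorem lowerIndex_mul_diagonal (hm : 0 < m) (t : ℝ) (σ : Fin 4)
    {f : Bool × Bool → Space × Space → ℂ} (hf : ∀ b, IsTestFun (f b)) (x : Space) :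
    (lowerIndex (point t x) σ : ℂ) * diagonal m f (point t x) =
      diagonal m (fun b => weight m b t σ (f b)) (point t x) := by
  simp only [diagonal, Finset.mul_sum, fun b => lowerIndex_mul_osc hm b t σ (hf b) x]

theorem integrable_moment (hm : 0 < m) (t : ℝ) (σ : Fin 4) {f : Bool × Bool → Space × Space → ℂ}
    (hf : ∀ b, IsTestFun (f b)) :
    Integrable (fun x : Space => (lowerIndex (point t x) σ : ℂ) * diagonal m f (point t x)) ∧
      ∫ x : Space, (lowerIndex (point t x) σ : ℂ) * diagonal m f (point t x) =
        ∑ b, slice m b t (weight m b t σ (f b)) := by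
  simp only [lowerIndex_mul_diagonal hm t σ hf]
  exact integrable_diagonal hm t fun b => isTestFun_weight hm b t σ (hf b)

theorem sgn_not (c : Bool) : sgn (!c) = -sgn c := by cases c <;> simp [sgn]

/-- Two creation or two annihilation operators: vanishing total momentum means `q' = -q`. -/
theorem slice_same {c : Bool} {t : ℝ} {f : Space × Space → ℂ} (h : ∀ q, f (q, -q) = 0) :
    slice m (c, c) t f = 0 := by
  simp [slice, ← sq, sgn_sq, h]

/-- One creation and one annihilation operator: `q' = q`, and the two energies cancel in the phase,
so the integral does not depend on `t`. -/
theorem slice_opposite {c : Bool} {t : ℝ} {f : Space × Space → ℂ} :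
    slice m (c, !c) t f = (2 * Real.pi) ^ 3 * ∫ q, f (q, q) := by
  simp [slice, ← sq, sgn_sq, sgn_not]

theorem sum_bool_prod (F : Bool × Bool → ℂ) (h : ∀ c, F (c, c) = 0) :
    ∑ b, F b = F (true, !true) + F (false, !false) := by
  simp [Fintype.sum_prod_type, h]

/-- Amplitude with the invariant measure split off. -/
noncomputable def shellAmp (m : ℝ) (g : Bool × Bool → Space × Space → ℂ) (b : Bool × Bool)
    (z : Space × Space) : ℂ := (shellDensity m z.1 : ℂ) * shellDensity m z.2 * g b z

theorem isTestFun_shellAmp (hm : 0 < m) {g : Bool × Bool → Space × Space → ℂ}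
    (hg : ∀ b, IsTestFun (g b)) (b : Bool × Bool) : IsTestFun (shellAmp m g b) := by
  have h := contDiff_ofReal (contDiff_shellDensity hm)
  exact IsTestFun.mul_left ((h.comp contDiff_fst).mul (h.comp contDiff_snd)) (hg b)

theorem energy_neg (q : Space) : energy m (-q) = energy m q := by
  simpa using energy_smul (m := m) (-1) (by norm_num) q

theorem lowerIndex_onShell_neg (q : Space) (τ : Fin 4) : lowerIndex (onShell m (-q)) τ =
    2 * η τ 0 * energy m q - lowerIndex (onShell m q) τ := by
  cases τ using Fin.cases with
  | zero => rw [lowerIndex_zero, lowerIndex_zero, onShell_zero, onShell_zero, energy_neg,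
      eta_zero_zero]; ring
  | succ k => rw [lowerIndex_succ, lowerIndex_succ, onShell_succ, onShell_succ,
      eta_of_ne (Fin.succ_ne_zero k)]; simp

theorem lowerIndex_pairDiff (b : Bool × Bool) (q q' : Space) (τ : Fin 4) :
    lowerIndex (pairDiff m b (q, q')) τ =
      sgn b.2 * lowerIndex (onShell m q') τ - sgn b.1 * lowerIndex (onShell m q) τ := by
  simp only [pairDiff, lowerIndex_sub, lowerIndex_smul]

theorem lowerIndex_onShell_zero (q : Space) : lowerIndex (onShell m q) 0 = energy m q := by
  rw [lowerIndex_zero, onShell_zero]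

theorem lowerIndex_pairDiff_zero (b : Bool × Bool) (q q' : Space) :
    lowerIndex (pairDiff m b (q, q')) 0 = sgn b.2 * energy m q' - sgn b.1 * energy m q := by
  simp only [lowerIndex_pairDiff, lowerIndex_onShell_zero]

theorem sgn_mul_self (c : Bool) : (sgn c : ℂ) * sgn c = 1 := by
  rw [← Complex.ofReal_mul, ← sq, sgn_sq, Complex.ofReal_one]

theorem shellDensity_mul_complex (hm : 0 < m) (q : Space) :
    (2 * Real.pi : ℂ) ^ 3 * (2 * energy m q) * shellDensity m q = 1 := by
  exact_mod_cast congrArg Complex.ofReal (shellDensity_mul hm q)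

/-- For equal signs the energy difference vanishes on the slice. For opposite signs it is `∓2E`,
which together with `(2π)³` cancels one of the two densities. -/
theorem integral_diagonal_arrow (hm : 0 < m) (t : ℝ) {g : Bool × Bool → Space × Space → ℂ}
    (hg : ∀ b, IsTestFun (g b)) :
    ∫ x : Space, diagonal m (arrowAmp m 0 (shellAmp m g)) (point t x) =
      -Complex.I * ((∫ q, (shellDensity m q : ℂ) * g (true, false) (q, q)) -
        ∫ q, (shellDensity m q : ℂ) * g (false, true) (q, q)) := by
  have h : ∀ c : Bool, slice m (c, !c) t (arrowAmp m 0 (shellAmp m g) (c, !c)) =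
      -Complex.I * sgn c * ∫ q, (shellDensity m q : ℂ) * g (c, !c) (q, q) := by
    intro c
    rw [slice_opposite, ← integral_const_mul, ← integral_const_mul]
    refine integral_congr_ae (Eventually.of_forall fun q => ?_)
    simp only [arrowAmp, shellAmp, lowerIndex_pairDiff_zero, sgn_not]
    push_cast
    linear_combination (-Complex.I * sgn c * shellDensity m q * g (c, !c) (q, q)) *
      shellDensity_mul_complex hm q
  rw [(integrable_diagonal hm t (isTestFun_arrowAmp hm 0 (isTestFun_shellAmp hm hg))).2,
    sum_bool_prod _ fun c => slice_same fun q => by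
      simp [arrowAmp, lowerIndex_pairDiff_zero, energy_neg], h, h]
  simp [sgn]
  ring

/-- As with one two-sided derivative, but the product of the two momentum differences is even in the
sign, so that the two mixed terms add up. -/
theorem integral_diagonal_arrow_arrow (hm : 0 < m) (t : ℝ) (σ : Fin 4)
    {g : Bool × Bool → Space × Space → ℂ} (hg : ∀ b, IsTestFun (g b)) :
    ∫ x : Space, diagonal m (arrowAmp m σ (arrowAmp m 0 (shellAmp m g))) (point t x) =
      -2 * ((∫ q, (shellDensity m q : ℂ) * (lowerIndex (onShell m q) σ * g (true, false) (q, q))) +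
        ∫ q, (shellDensity m q : ℂ) * (lowerIndex (onShell m q) σ * g (false, true) (q, q))) := by
  have h : ∀ c : Bool, slice m (c, !c) t (arrowAmp m σ (arrowAmp m 0 (shellAmp m g)) (c, !c)) =
      -2 * ∫ q, (shellDensity m q : ℂ) * (lowerIndex (onShell m q) σ * g (c, !c) (q, q)) := by
    intro c
    rw [slice_opposite, ← integral_const_mul, ← integral_const_mul]
    refine integral_congr_ae (Eventually.of_forall fun q => ?_)
    simp only [arrowAmp, shellAmp, lowerIndex_pairDiff, lowerIndex_onShell_zero, sgn_not]
    push_cast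
    have h1 := shellDensity_mul_complex hm q
    have h2 : Complex.I * (sgn c : ℂ) * (Complex.I * sgn c) = -1 := by
      rw [mul_mul_mul_comm, Complex.I_mul_I, sgn_mul_self, mul_one]
    linear_combination (-2 * lowerIndex (onShell m q) σ * shellDensity m q * g (c, !c) (q, q)) * h1
      + (2 * Real.pi : ℂ) ^ 3 * 4 * energy m q * lowerIndex (onShell m q) σ *
        (shellDensity m q * shellDensity m q) * g (c, !c) (q, q) * h2
  rw [(integrable_diagonal hm t (isTestFun_arrowAmp hm σ
      (isTestFun_arrowAmp hm 0 (isTestFun_shellAmp hm hg)))).2,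
    sum_bool_prod _ fun c => slice_same fun q => by
      simp [arrowAmp, lowerIndex_pairDiff_zero, energy_neg], h, h]
  simp
  ring

/-! ### The orbital part of the Lorentz charge -/

theorem lorentzGen_mulVec (σ τ : Fin 4) (v : Spacetime) (α : Fin 4) :
    (lorentzGen σ τ *ᵥ v) α =
      (if α = τ then lowerIndex v σ else 0) - (if α = σ then lowerIndex v τ else 0) := by
  simp only [Matrix.mulVec, dotProduct, lorentzGen, sub_mul, Finset.sum_sub_distrib, ite_mul,
    zero_mul]
  congr 1 <;> split_ifs <;> simp [lowerIndex]

theorem spatialDir_apply (τ : Fin 4) (k : Fin 3) :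
    spatialDir τ k = if k.succ = τ then 1 else 0 := by
  cases τ using Fin.cases with
  | zero => simp [spatialDir_zero]
  | succ j => simp [spatialDir_succ]

theorem velocity_lorentzGen (σ τ : Fin 4) (q : Space) : velocity m (lorentzGen σ τ) q =
    lowerIndex (onShell m q) σ • spatialDir τ - lowerIndex (onShell m q) τ • spatialDir σ := by
  ext k
  simp [velocity, lorentzGen_mulVec, spatialDir_apply]

theorem hasDerivAt_shellDensity (hm : 0 < m) (q : Space) (σ : Fin 4) :
    HasDerivAt (fun r : ℝ => shellDensity m (q + r • spatialDir σ))
      (-(shellDensity m q * ((η σ 0 - lowerIndex (onShell m q) σ / energy m q) / energy m q))) 0 := by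
  have hE : HasDerivAt (fun r : ℝ => energy m (q + r • spatialDir σ))
      (η σ 0 - lowerIndex (onShell m q) σ / energy m q) 0 := by
    rw [← fderiv_energy_spatialDir hm]
    exact ((contDiff_energy hm).differentiable (by simp) q).hasFDerivAt.hasLineDerivAt _
  have h := (hE.fun_inv (energy_pos hm _).ne').const_mul (2 * (2 * Real.pi) ^ 3)⁻¹
  simp only [← shellDensity_eq, zero_smul, add_zero] at h
  refine h.congr_deriv ?_
  rw [shellDensity_eq]
  have := (energy_pos hm q).ne'
  field_simp

/-- Derivative of the amplitude of the two-sided second derivatives. -/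
theorem fderiv_arrow_arrow (hm : 0 < m) (σ τ : Fin 4) {g : Bool × Bool → Space × Space → ℂ}
    (hg : ∀ b, IsTestFun (g b)) (b : Bool × Bool) (q q' : Space) :
    fderiv ℝ (arrowAmp m 0 (arrowAmp m τ (shellAmp m g)) b) (q, q') (0, spatialDir σ) =
      -(shellDensity m q * shellDensity m q' *
        ((sgn b.2 * (η σ 0 - lowerIndex (onShell m q') σ / energy m q') *
            lowerIndex (pairDiff m b (q, q')) τ +
          lowerIndex (pairDiff m b (q, q')) 0 *
            (sgn b.2 * (η σ τ - η τ 0 * (lowerIndex (onShell m q') σ / energy m q'))) -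
          lowerIndex (pairDiff m b (q, q')) 0 * lowerIndex (pairDiff m b (q, q')) τ *
            ((η σ 0 - lowerIndex (onShell m q') σ / energy m q') / energy m q')) * g b (q, q') +
          lowerIndex (pairDiff m b (q, q')) 0 * lowerIndex (pairDiff m b (q, q')) τ *
            fderiv ℝ (g b) (q, q') (0, spatialDir σ))) := by
  have hp : ∀ τ, HasDerivAt (fun r : ℝ =>
      lowerIndex (pairDiff m b (q, q' + r • spatialDir σ)) τ)
      (sgn b.2 * (η σ τ - η τ 0 * (lowerIndex (onShell m q') σ / energy m q'))) 0 := by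
    intro τ
    simp only [lowerIndex_pairDiff]
    rw [← fderiv_lowerIndex_onShell hm]
    exact ((((contDiff_lowerIndex_onShell hm τ).differentiable
      (by simp) q').hasFDerivAt.hasLineDerivAt _).const_mul (sgn b.2)).sub_const _
  have h0 := hp 0
  rw [eta_zero_zero, one_mul] at h0
  have hline : ∀ {f : Space × Space → ℂ}, IsTestFun f →
      HasDerivAt (fun r : ℝ => f (q, q' + r • spatialDir σ))
        (fderiv ℝ f (q, q') (0, spatialDir σ)) 0 := by
    intro f hf
    have h2 := (hf.differentiable (q, q')).hasFDerivAt.hasLineDerivAt (0, spatialDir σ)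
    unfold HasLineDerivAt at h2
    simpa only [Prod.smul_mk, Prod.mk_add_mk, smul_zero, add_zero] using h2
  have h1 := (h0.ofReal_comp.const_mul Complex.I).mul (((hp τ).ofReal_comp.const_mul Complex.I).mul
    (((hasDerivAt_shellDensity hm q' σ).ofReal_comp.const_mul (shellDensity m q : ℂ)).mul
      (hline (hg b))))
  have hf := isTestFun_arrowAmp hm 0 (isTestFun_arrowAmp hm τ (isTestFun_shellAmp hm hg)) b
  refine ((hline hf).unique h1).trans ?_
  simp only [Pi.mul_apply, zero_smul, add_zero]
  push_cast
  linear_combination (shellDensity m q * shellDensity m q' *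
        ((sgn b.2 * (η σ 0 - lowerIndex (onShell m q') σ / energy m q') *
            lowerIndex (pairDiff m b (q, q')) τ +
          lowerIndex (pairDiff m b (q, q')) 0 *
            (sgn b.2 * (η σ τ - η τ 0 * (lowerIndex (onShell m q') σ / energy m q'))) -
          lowerIndex (pairDiff m b (q, q')) 0 * lowerIndex (pairDiff m b (q, q')) τ *
            ((η σ 0 - lowerIndex (onShell m q') σ / energy m q') / energy m q')) * g b (q, q') +
          lowerIndex (pairDiff m b (q, q')) 0 * lowerIndex (pairDiff m b (q, q')) τ *
            fderiv ℝ (g b) (q, q') (0, spatialDir σ))) * Complex.I_mul_I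

/-- The amplitude of the orbital part of the Lorentz charge density. -/
noncomputable def orbitalAmp (m : ℝ) (t : ℝ) (σ τ : Fin 4) (g : Bool × Bool → Space × Space → ℂ)
    (b : Bool × Bool) (z : Space × Space) : ℂ :=
  weight m b t σ (arrowAmp m 0 (arrowAmp m τ (shellAmp m g)) b) z -
    weight m b t τ (arrowAmp m 0 (arrowAmp m σ (shellAmp m g)) b) z

theorem isTestFun_orbitalAmp (hm : 0 < m) (t : ℝ) (σ τ : Fin 4)
    {g : Bool × Bool → Space × Space → ℂ} (hg : ∀ b, IsTestFun (g b)) (b : Bool × Bool) :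
    IsTestFun (orbitalAmp m t σ τ g b) := by
  have h : ∀ τ b, IsTestFun (arrowAmp m 0 (arrowAmp m τ (shellAmp m g)) b) := fun τ =>
    isTestFun_arrowAmp hm 0 (isTestFun_arrowAmp hm τ (isTestFun_shellAmp hm hg))
  exact (isTestFun_weight hm b t σ (h τ b)).sub (isTestFun_weight hm b t τ (h σ b))

/-- The energy difference vanishes at `q' = -q`, so the derivative must act on this factor. The
outcome is proportional to `(p_σ/E - η_{σ0}) (p_τ/E - η_{τ0})`, symmetric in `σ` and `τ`, and
cancels in the difference. -/
theorem orbitalAmp_same (hm : 0 < m) (t : ℝ) (σ τ : Fin 4) {g : Bool × Bool → Space × Space → ℂ}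
    (hg : ∀ b, IsTestFun (g b)) (c : Bool) (q : Space) :
    orbitalAmp m t σ τ g (c, c) (q, -q) = 0 := by
  have hE : (energy m q : ℂ) ≠ 0 := Complex.ofReal_ne_zero.2 (energy_pos hm q).ne'
  simp only [orbitalAmp, weight, fderiv_arrow_arrow hm _ _ hg]
  simp only [arrowAmp, energy_neg, sub_self, lowerIndex_pairDiff, lowerIndex_onShell_neg,
    lowerIndex_onShell_zero, eta_comm τ σ]
  push_cast
  field_simp
  ring

/-- The terms in which the derivative acts on the kinematical factors, and those proportional to
`t`, are symmetric in `σ` and `τ` at `q' = q` and cancel. What survives is the derivative of `g`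
along `p_σ ∂_τ - p_τ ∂_σ`. -/
theorem orbitalAmp_opposite (hm : 0 < m) (t : ℝ) (σ τ : Fin 4)
    {g : Bool × Bool → Space × Space → ℂ} (hg : ∀ b, IsTestFun (g b)) (c : Bool) (q : Space) :
    (2 * Real.pi) ^ 3 * orbitalAmp m t σ τ g (c, !c) (q, q) =
      -2 * Complex.I * sgn c * ((shellDensity m q : ℂ) *
        fderiv ℝ (g (c, !c)) (q, q) (0, velocity m (lorentzGen σ τ) q)) := by
  have hE : (energy m q : ℂ) ≠ 0 := Complex.ofReal_ne_zero.2 (energy_pos hm q).ne'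
  have hv : fderiv ℝ (g (c, !c)) (q, q) (0, velocity m (lorentzGen σ τ) q) =
      lowerIndex (onShell m q) σ * fderiv ℝ (g (c, !c)) (q, q) (0, spatialDir τ) -
        lowerIndex (onShell m q) τ * fderiv ℝ (g (c, !c)) (q, q) (0, spatialDir σ) := by
    rw [velocity_lorentzGen, show ((0 : Space), lowerIndex (onShell m q) σ • spatialDir τ -
      lowerIndex (onShell m q) τ • spatialDir σ) = lowerIndex (onShell m q) σ • (0, spatialDir τ) -
      lowerIndex (onShell m q) τ • (0, spatialDir σ) by simp, map_sub, map_smul, map_smul,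
      Complex.real_smul, Complex.real_smul]
  rw [hv, orbitalAmp, weight, weight, fderiv_arrow_arrow hm _ _ hg, fderiv_arrow_arrow hm _ _ hg]
  simp only [arrowAmp, shellAmp, lowerIndex_pairDiff, lowerIndex_onShell_zero, sgn_not]
  rw [eta_comm τ σ]
  push_cast
  have h1 := shellDensity_mul_complex hm q
  set D₁ := fderiv ℝ (g (c, !c)) (q, q) (0, spatialDir τ)
  set D₂ := fderiv ℝ (g (c, !c)) (q, q) (0, spatialDir σ)
  set G := g (c, !c) (q, q)
  have hρ : (shellDensity m q : ℂ) = ((2 * Real.pi : ℂ) ^ 3 * (2 * energy m q))⁻¹ :=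
    eq_inv_of_mul_eq_one_right h1
  have hpi : (Real.pi : ℂ) ≠ 0 := Complex.ofReal_ne_zero.2 Real.pi_ne_zero
  rw [hρ]
  rcases c with _ | _ <;> simp only [sgn] <;> push_cast <;> field_simp <;> ring

theorem integral_orbital (hm : 0 < m) (t : ℝ) (σ τ : Fin 4) {g : Bool × Bool → Space × Space → ℂ}
    (hg : ∀ b, IsTestFun (g b)) :
    Integrable (fun x : Space =>
      lowerIndex (point t x) σ * diagonal m (arrowAmp m 0 (arrowAmp m τ (shellAmp m g))) (point t x) -
      lowerIndex (point t x) τ *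
        diagonal m (arrowAmp m 0 (arrowAmp m σ (shellAmp m g))) (point t x)) ∧
    ∫ x : Space, (lowerIndex (point t x) σ *
        diagonal m (arrowAmp m 0 (arrowAmp m τ (shellAmp m g))) (point t x) -
      lowerIndex (point t x) τ *
        diagonal m (arrowAmp m 0 (arrowAmp m σ (shellAmp m g))) (point t x)) =
      -2 * Complex.I * ((∫ q, (shellDensity m q : ℂ) *
        fderiv ℝ (g (true, false)) (q, q) (0, velocity m (lorentzGen σ τ) q)) -
      ∫ q, (shellDensity m q : ℂ) *
        fderiv ℝ (g (false, true)) (q, q) (0, velocity m (lorentzGen σ τ) q)) := by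
  have hf : ∀ τ b, IsTestFun (arrowAmp m 0 (arrowAmp m τ (shellAmp m g)) b) := fun τ =>
    isTestFun_arrowAmp hm 0 (isTestFun_arrowAmp hm τ (isTestFun_shellAmp hm hg))
  have h1 : ∀ x : Space, lowerIndex (point t x) σ *
        diagonal m (arrowAmp m 0 (arrowAmp m τ (shellAmp m g))) (point t x) -
      lowerIndex (point t x) τ *
        diagonal m (arrowAmp m 0 (arrowAmp m σ (shellAmp m g))) (point t x) =
      diagonal m (orbitalAmp m t σ τ g) (point t x) := by
    intro x
    rw [lowerIndex_mul_diagonal hm t σ (hf τ), lowerIndex_mul_diagonal hm t τ (hf σ)]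
    simp only [diagonal, ← Finset.sum_sub_distrib]
    refine Finset.sum_congr rfl fun b _ => ?_
    simp only [osc]
    rw [← integral_sub (osc_integrable hm b (isTestFun_weight hm b t σ (hf τ b)) _)
      (osc_integrable hm b (isTestFun_weight hm b t τ (hf σ b)) _)]
    simp only [orbitalAmp, sub_mul]
  have h2 := integrable_diagonal hm t (isTestFun_orbitalAmp hm t σ τ hg)
  have h : ∀ c : Bool, slice m (c, !c) t (orbitalAmp m t σ τ g (c, !c)) =
      -2 * Complex.I * sgn c * ∫ q, (shellDensity m q : ℂ) *
        fderiv ℝ (g (c, !c)) (q, q) (0, velocity m (lorentzGen σ τ) q) := by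
    intro c
    rw [slice_opposite, ← integral_const_mul, ← integral_const_mul]
    simp only [orbitalAmp_opposite hm t σ τ hg]
  simp only [h1]
  refine ⟨h2.1, h2.2.trans ?_⟩
  rw [sum_bool_prod _ fun c => slice_same (orbitalAmp_same hm t σ τ hg c), h, h]
  simp [sgn]
  ring

/-! ### Normal ordered products -/

variable {m : ℝ} {s : ℕ} {Φ Ψ : WaveFun s}

theorem integral_swap (F : Space × Space → ℂ) : ∫ z : Space × Space, F (z.2, z.1) = ∫ z, F z :=
  integral_prod_swap (μ := (volume : Measure Space)) (ν := (volume : Measure Space)) F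

/-- The positive frequency wave with the density of the invariant measure. -/
noncomputable def wave (m : ℝ) (x : Spacetime) (q : Space) : ℂ :=
  (shellDensity m q : ℂ) * Complex.exp (-(Complex.I * mdot (onShell m q) x))

theorem continuous_wave_prod (hm : 0 < m) (x y : Spacetime) :
    Continuous fun z : Space × Space => wave m x z.1 * wave m y z.2 :=
  ((continuous_wave hm x).comp continuous_fst).mul ((continuous_wave hm y).comp continuous_snd)

theorem annihilate_annihilate (hm : 0 < m) (hΨ : IsTestVector Ψ) (μ ν : Fin s → Fin 4)
    (x y : Spacetime) (n : ℕ) (p : Fin n → Space) (κ : Fin n → Fin s → Fin 4) :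
    annihilate m μ x (annihilate m ν y Ψ) n p κ =
      ∫ z : Space × Space, wave m x z.1 * wave m y z.2 * ann μ z.1 (ann ν z.2 Ψ) n p κ := by
  have h1 : ∀ q, ann μ q (annihilate m ν y Ψ) n p κ =
      ∫ q', wave m y q' * ann μ q (ann ν q' Ψ) n p κ := by
    intro q
    rw [ann, annihilate_apply, ← integral_const_mul]
    simp only [ann, wave, mul_left_comm]
  have hi : Integrable fun z : Space × Space =>
      wave m x z.1 * wave m y z.2 * ann μ z.1 (ann ν z.2 Ψ) n p κ := by
    have ht : IsTestFun fun z : Space × Space => ann μ z.1 (ann ν z.2 Ψ) n p κ :=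
      (hΨ.ann_ann_test n μ ν κ).comp_of_leftInverse (contDiff_id.prodMk contDiff_const)
        continuous_fst fun _ => rfl
    exact ((continuous_wave_prod hm x y).mul ht.continuous).integrable_of_hasCompactSupport
      ht.compact.mul_left
  rw [annihilate_apply]
  rw [Measure.volume_eq_prod] at hi ⊢
  rw [integral_prod _ hi]
  simp only [h1, ← integral_const_mul, wave, mul_assoc]

theorem annihilate_comm (hm : 0 < m) (hΨ : IsTestVector Ψ) (μ ν : Fin s → Fin 4)
    (x y : Spacetime) :
    annihilate m μ x (annihilate m ν y Ψ) = annihilate m ν y (annihilate m μ x Ψ) := by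
  funext n p κ
  rw [annihilate_annihilate hm hΨ, annihilate_annihilate hm hΨ, ← integral_swap]
  refine integral_congr_ae (Eventually.of_forall fun z => ?_)
  simp only []
  rw [hΨ.ann_comm, mul_comm (wave m x _)]

theorem fockInner_annihilate_annihilate (hm : 0 < m) (hΦ : IsTestVector Φ) (hΨ : IsTestVector Ψ)
    (μ ν : Fin s → Fin 4) (x y : Spacetime) :
    fockInner m Φ (annihilate m μ x (annihilate m ν y Ψ)) = ∫ z : Space × Space,
      wave m x z.1 * wave m y z.2 * fockInner m Φ (ann μ z.1 (ann ν z.2 Ψ)) := by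
  rw [(IsTestVector.pair_ann_ann hΦ hΨ μ ν).integral_mul_fockInner hm
    (continuous_wave_prod hm x y), fockInner_eq_tsum]
  simp only [annihilate_annihilate hm hΨ, ← integral_const_mul, mul_left_comm (conj _)]

theorem fockInner_annihilate_both (hm : 0 < m) (hΦ : IsTestVector Φ) (hΨ : IsTestVector Ψ)
    (μ ν : Fin s → Fin 4) (x y : Spacetime) :
    fockInner m (annihilate m μ x Φ) (annihilate m ν y Ψ) = ∫ z : Space × Space,
      conj (wave m x z.1) * wave m y z.2 * twoPoint m Φ Ψ μ ν z := by
  have hc : Continuous fun z : Space × Space => conj (wave m x z.1) * wave m y z.2 :=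
    (Complex.continuous_conj.comp ((continuous_wave hm x).comp continuous_fst)).mul
      ((continuous_wave hm y).comp continuous_snd)
  simp only [twoPoint]
  rw [(IsTestVector.ann_pair_ann hΦ hΨ μ ν).integral_mul_fockInner hm hc, fockInner_eq_tsum]
  refine tsum_congr fun n => integral_congr_ae (Eventually.of_forall fun p => ?_)
  refine congrArg (fun c => pairDensity m c p) ?_
  funext p κ
  rw [annihilate_apply, annihilate_apply, ← integral_conj, ← integral_prod_mul]
  refine integral_congr_ae (Eventually.of_forall fun z => ?_)
  simp only [wave, map_mul]
  ring

/-- Matrix elements of pairs of annihilation and creation operators; the Booleans tell which of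
the two are creation operators. -/
noncomputable def corr (m : ℝ) (Φ Ψ : WaveFun s) (μ ν : Fin s → Fin 4) :
    Bool × Bool → Space × Space → ℂ
  | (false, false), z => fockInner m Φ (ann μ z.1 (ann ν z.2 Ψ))
  | (true, false), z => twoPoint m Φ Ψ μ ν z
  | (false, true), z => twoPoint m Φ Ψ ν μ (z.2, z.1)
  | (true, true), z => conj (fockInner m Ψ (ann ν z.2 (ann μ z.1 Φ)))

theorem IsTestFun.comp_swap {f : Space × Space → ℂ} (hf : IsTestFun f) :
    IsTestFun fun z : Space × Space => f (z.2, z.1) :=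
  hf.comp_of_leftInverse (contDiff_snd.prodMk contDiff_fst) (h := Prod.swap) continuous_swap
    fun _ => rfl

theorem isTestFun_corr (hm : 0 < m) (hΦ : IsTestVector Φ) (hΨ : IsTestVector Ψ)
    (μ ν : Fin s → Fin 4) : ∀ b, IsTestFun (corr m Φ Ψ μ ν b)
  | (false, false) => (IsTestVector.pair_ann_ann hΦ hΨ μ ν).isTestFun hm
  | (true, false) => isTestFun_twoPoint hm hΦ hΨ μ ν
  | (false, true) => (isTestFun_twoPoint hm hΦ hΨ ν μ).comp_swap
  | (true, true) => ((IsTestVector.pair_ann_ann hΨ hΦ ν μ).isTestFun hm).comp_swap.star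

theorem conj_wave (x : Spacetime) (q : Space) : conj (wave m x q) =
    (shellDensity m q : ℂ) * Complex.exp (Complex.I * mdot (sgn true • onShell m q) x) := by
  rw [wave, map_mul, Complex.conj_ofReal, ← Complex.exp_conj]
  simp [sgn]

theorem wave_eq (x : Spacetime) (q : Space) : wave m x q =
    (shellDensity m q : ℂ) * Complex.exp (Complex.I * mdot (sgn false • onShell m q) x) := by
  rw [wave, mdot_smul_left]
  simp [sgn]

/-- Each of the four normal ordered terms carries one choice of frequency signs; the term with two
creation operators is obtained by complex conjugation from the one with two annihilation operators.
-/
theorem wickForm_eq_bilocal (hm : 0 < m) (hΦ : IsTestVector Φ) (hΨ : IsTestVector Ψ)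
    (μ ν : Fin s → Fin 4) :
    wickForm m Φ Ψ μ ν = bilocal m (shellAmp m (corr m Φ Ψ μ ν)) := by
  funext x y
  rw [wickForm, fockInner_annihilate_annihilate hm hΦ hΨ, fockInner_annihilate_both hm hΦ hΨ,
    fockInner_annihilate_both hm hΦ hΨ, ← conj_fockInner, fockInner_annihilate_annihilate hm hΨ hΦ,
    ← integral_conj]
  have h1 : ∀ F : Bool × Bool → ℂ, F (false, false) + F (true, false) + F (false, true) +
      F (true, true) = ∑ b, F b := fun F => by simp [Fintype.sum_prod_type]; ring
  rw [bilocal, ← h1]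
  refine congrArg₂ _ (congrArg₂ _ (congrArg₂ _ ?_ ?_) ?_) ?_
  -- In the last two terms the first integration variable belongs to `y`; the variables are
  -- exchanged there.
  rotate_left 2
  iterate 2 rw [← integral_swap]; rotate_left
  all_goals
    refine integral_congr_ae (Eventually.of_forall fun z => ?_)
    simp only [map_mul, conj_wave, shellAmp, corr]
    try simp only [wave_eq]
    ring

theorem wickForm_comm (hm : 0 < m) (hΦ : IsTestVector Φ) (hΨ : IsTestVector Ψ)
    (μ ν : Fin s → Fin 4) (x y : Spacetime) :
    wickForm m Φ Ψ μ ν x y = wickForm m Φ Ψ ν μ y x := by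
  rw [wickForm, wickForm, annihilate_comm hm hΨ μ ν, annihilate_comm hm hΦ ν μ]
  ring

/-- Normally ordered fields commute, and the two-sided derivative changes sign under exchange of its
factors. -/
theorem quad₁_antisymm (hm : 0 < m) (hΦ : IsTestVector Φ) (hΨ : IsTestVector Ψ)
    (α σ β : Fin 4) (x : Spacetime) : quad₁ m Φ Ψ α σ β x = -quad₁ m Φ Ψ β σ α x := by
  simp only [quad₁, arrow, ← Finset.sum_neg_distrib]
  refine Finset.sum_congr rfl fun κ _ => ?_
  simp only [wickForm_comm hm hΦ hΨ (headIndex α κ) (headIndex β κ)]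
  ring

/-- The contraction of the matrix elements over all indices. -/
noncomputable def fullCorr (m : ℝ) (Φ Ψ : WaveFun s) (b : Bool × Bool) (z : Space × Space) : ℂ :=
  ∑ μ : Fin s → Fin 4, ((∏ j, η (μ j) (μ j) : ℝ) : ℂ) * corr m Φ Ψ μ μ b z

/-- The contraction of the matrix elements over all indices but the first. -/
noncomputable def headCorr (m : ℝ) (Φ Ψ : WaveFun s) (α β : Fin 4) (b : Bool × Bool)
    (z : Space × Space) : ℂ :=
  ∑ κ : Fin (s - 1) → Fin 4, ((∏ j, η (κ j) (κ j) : ℝ) : ℂ) *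
    corr m Φ Ψ (headIndex α κ) (headIndex β κ) b z

theorem isTestFun_fullCorr (hm : 0 < m) (hΦ : IsTestVector Φ) (hΨ : IsTestVector Ψ)
    (b : Bool × Bool) : IsTestFun (fullCorr m Φ Ψ b) :=
  IsTestFun.sum _ fun μ _ => (isTestFun_corr hm hΦ hΨ μ μ b).const_mul _

theorem isTestFun_headCorr (hm : 0 < m) (hΦ : IsTestVector Φ) (hΨ : IsTestVector Ψ)
    (α β : Fin 4) (b : Bool × Bool) : IsTestFun (headCorr m Φ Ψ α β b) :=
  IsTestFun.sum _ fun _ _ => (isTestFun_corr hm hΦ hΨ _ _ b).const_mul _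

theorem quad₂_eq_diagonal (hm : 0 < m) (hΦ : IsTestVector Φ) (hΨ : IsTestVector Ψ) (ρ σ : Fin 4) :
    quad₂ m Φ Ψ ρ σ = diagonal m (arrowAmp m ρ (arrowAmp m σ (shellAmp m (fullCorr m Φ Ψ)))) := by
  funext x
  have h : ∀ μ : Fin s → Fin 4, ∀ b, IsTestFun (shellAmp m (corr m Φ Ψ μ μ) b) := fun μ =>
    isTestFun_shellAmp hm (isTestFun_corr hm hΦ hΨ μ μ)
  have h' : ∀ μ : Fin s → Fin 4, ∀ b,
      IsTestFun (arrowAmp m ρ (arrowAmp m σ (shellAmp m (corr m Φ Ψ μ μ))) b) := fun μ =>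
    isTestFun_arrowAmp hm ρ (isTestFun_arrowAmp hm σ (h μ))
  simp only [quad₂, fun μ => wickForm_eq_bilocal hm hΦ hΨ μ μ, fun μ => arrow_bilocal hm (h μ) σ,
    fun μ => arrow_bilocal hm (isTestFun_arrowAmp hm σ (h μ)) ρ, bilocal_self,
    ← diagonal_const_mul]
  rw [← diagonal_sum hm _ fun μ _ b => (h' μ b).const_mul _]
  congr 1
  funext b z
  simp only [arrowAmp, shellAmp, fullCorr, Finset.mul_sum]
  exact Finset.sum_congr rfl fun μ _ => by ring

theorem quad₁_eq_diagonal (hm : 0 < m) (hΦ : IsTestVector Φ) (hΨ : IsTestVector Ψ)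
    (α σ β : Fin 4) :
    quad₁ m Φ Ψ α σ β = diagonal m (arrowAmp m σ (shellAmp m (headCorr m Φ Ψ α β))) := by
  funext x
  have h : ∀ κ : Fin (s - 1) → Fin 4, ∀ b, IsTestFun (shellAmp m
      (corr m Φ Ψ (headIndex α κ) (headIndex β κ)) b) := fun κ =>
    isTestFun_shellAmp hm (isTestFun_corr hm hΦ hΨ _ _)
  simp only [quad₁, fun μ ν => wickForm_eq_bilocal hm hΦ hΨ μ ν, fun κ => arrow_bilocal hm (h κ) σ,
    bilocal_self, ← diagonal_const_mul]
  rw [← diagonal_sum hm _ fun κ _ b => (isTestFun_arrowAmp hm σ (h κ) b).const_mul _]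
  congr 1
  funext b z
  simp only [arrowAmp, shellAmp, headCorr, Finset.mul_sum]
  exact Finset.sum_congr rfl fun κ _ => by ring

theorem isTestFun_quad₁Amp (hm : 0 < m) (hΦ : IsTestVector Φ) (hΨ : IsTestVector Ψ)
    (α σ β : Fin 4) (b : Bool × Bool) :
    IsTestFun (arrowAmp m σ (shellAmp m (headCorr m Φ Ψ α β)) b) :=
  isTestFun_arrowAmp hm σ (isTestFun_shellAmp hm (isTestFun_headCorr hm hΦ hΨ α β)) b

theorem quad₂_comm (hm : 0 < m) (hΦ : IsTestVector Φ) (hΨ : IsTestVector Ψ) (ρ σ : Fin 4) :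
    quad₂ m Φ Ψ ρ σ = quad₂ m Φ Ψ σ ρ := by
  rw [quad₂_eq_diagonal hm hΦ hΨ, quad₂_eq_diagonal hm hΦ hΨ]
  congr 1
  funext b z
  simp only [arrowAmp]
  ring

/-- The product of sum and difference is the difference of the squares, and both signed momenta have
the square `m²`. This is the Klein-Gordon equation of the field. -/
theorem sum_eta_pairSum_mul_pairDiff (b : Bool × Bool) (z : Space × Space) :
    ∑ μ, η μ μ * (lowerIndex (pairSum m b z) μ * lowerIndex (pairDiff m b z) μ) = 0 := by
  have h : ∀ v w : Spacetime, mdot v w = ∑ μ, η μ μ * (lowerIndex v μ * lowerIndex w μ) := by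
    intro v w
    rw [mdot]
    refine Finset.sum_congr rfl fun μ _ => ?_
    rw [lowerIndex_eq w]
    linear_combination (-(lowerIndex v μ * w μ)) * eta_mul_self μ
  have h1 := mdot_onShell_self (m := m) z.1
  have h2 := mdot_onShell_self (m := m) z.2
  simp only [h] at h1 h2
  simp only [pairSum, pairDiff, lowerIndex_add, lowerIndex_sub, lowerIndex_smul]
  calc _ = sgn b.2 ^ 2 * ∑ μ, η μ μ * (lowerIndex (onShell m z.2) μ * lowerIndex (onShell m z.2) μ) -
        sgn b.1 ^ 2 * ∑ μ, η μ μ * (lowerIndex (onShell m z.1) μ * lowerIndex (onShell m z.1) μ) := by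
        rw [Finset.mul_sum, Finset.mul_sum, ← Finset.sum_sub_distrib]
        exact Finset.sum_congr rfl fun μ _ => by ring
    _ = 0 := by rw [h1, h2, sgn_sq, sgn_sq]; ring

/-- The current `A_α ↔∂_μ A_β` is conserved. -/
theorem sum_pd_quad₁ (hm : 0 < m) (hΦ : IsTestVector Φ) (hΨ : IsTestVector Ψ) (α β : Fin 4)
    (x : Spacetime) : ∑ μ, (η μ μ : ℂ) * pd μ (quad₁ m Φ Ψ α μ β) x = 0 := by
  have ht := fun μ => isTestFun_quad₁Amp hm hΦ hΨ α μ β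
  simp only [quad₁_eq_diagonal hm hΦ hΨ, fun μ => pd_diagonal hm (ht μ) μ, ← diagonal_const_mul]
  rw [← diagonal_sum hm]
  · rw [show (fun b z => ∑ μ, (η μ μ : ℂ) * (Complex.I * lowerIndex (pairSum m b z) μ *
      arrowAmp m μ (shellAmp m (headCorr m Φ Ψ α β)) b z)) = fun _ _ => 0 from ?_]
    · simp [diagonal, osc]
    · funext b z
      have h := congrArg Complex.ofReal (sum_eta_pairSum_mul_pairDiff (m := m) b z)
      push_cast at h
      rw [show (∑ μ, (η μ μ : ℂ) * (Complex.I * lowerIndex (pairSum m b z) μ *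
        arrowAmp m μ (shellAmp m (headCorr m Φ Ψ α β)) b z)) =
        (∑ μ, (η μ μ : ℂ) * (lowerIndex (pairSum m b z) μ * lowerIndex (pairDiff m b z) μ)) *
          (Complex.I * Complex.I * shellAmp m (headCorr m Φ Ψ α β) b z) from ?_, h, zero_mul]
      rw [Finset.sum_mul]
      exact Finset.sum_congr rfl fun μ _ => by simp only [arrowAmp]; ring
  · exact fun μ _ b => (IsTestFun.mul_left (contDiff_const.mul (contDiff_ofReal
      (contDiff_lowerIndex_pairSum hm b μ))) (ht μ b)).const_mul _

/-! ### The generators as integrals of densities -/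

variable {m : ℝ} {s : ℕ} {Φ Ψ : WaveFun s}

theorem gram_eq (μ : Fin s → Fin 4) :
    (gram μ : ℂ) = (-1) ^ s * ((∏ j, η (μ j) (μ j) : ℝ) : ℂ) := by
  rw [gram]; push_cast; rfl

theorem fullCorr_true_false (q : Space) : (-1) ^ s * fullCorr m Φ Ψ (true, false) (q, q) =
    ∑ μ, (gram μ : ℂ) * twoPoint m Φ Ψ μ μ (q, q) := by
  simp only [fullCorr, corr, gram_eq, Finset.mul_sum, mul_assoc]

theorem fullCorr_false_true (q : Space) : (-1) ^ s * fullCorr m Φ Ψ (false, true) (q, q) =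
    ∑ μ, (gram μ : ℂ) * twoPoint m Φ Ψ μ μ (q, q) := by
  simp only [fullCorr, corr, gram_eq, Finset.mul_sum, mul_assoc]

theorem fderiv_fullCorr_true_false (hm : 0 < m) (hΦ : IsTestVector Φ) (hΨ : IsTestVector Ψ)
    (q v : Space) : (-1) ^ s * fderiv ℝ (fullCorr m Φ Ψ (true, false)) (q, q) (0, v) =
      ∑ μ, (gram μ : ℂ) * fderiv ℝ (twoPoint m Φ Ψ μ μ) (q, q) (0, v) := by
  have h : fullCorr m Φ Ψ (true, false) = fun z => ∑ μ : Fin s → Fin 4,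
      ((∏ j, η (μ j) (μ j) : ℝ) : ℂ) * twoPoint m Φ Ψ μ μ z := rfl
  have hd := fun μ => (isTestFun_twoPoint hm hΦ hΨ μ μ).differentiable (q, q)
  rw [h, fderiv_fun_sum fun μ _ => (hd μ).const_mul _, _root_.sum_apply, Finset.mul_sum]
  refine Finset.sum_congr rfl fun μ _ => ?_
  rw [fderiv_const_mul (hd μ), _root_.smul_apply, smul_eq_mul, gram_eq, mul_assoc]

/-- With the operators in this order the second momentum belongs to `Φ`, so the derivative falls on
the first argument of the two-point function. -/
theorem fderiv_fullCorr_false_true (hm : 0 < m) (hΦ : IsTestVector Φ) (hΨ : IsTestVector Ψ)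
    (q v : Space) : (-1) ^ s * fderiv ℝ (fullCorr m Φ Ψ (false, true)) (q, q) (0, v) =
      ∑ μ, (gram μ : ℂ) * fderiv ℝ (twoPoint m Φ Ψ μ μ) (q, q) (v, 0) := by
  rw [← fderiv_prod_right (isTestFun_fullCorr hm hΦ hΨ _)]
  have h : (fun q' => fullCorr m Φ Ψ (false, true) (q, q')) = fun q' => ∑ μ : Fin s → Fin 4,
      ((∏ j, η (μ j) (μ j) : ℝ) : ℂ) * twoPoint m Φ Ψ μ μ (q', q) := rfl
  have hd : ∀ μ, DifferentiableAt ℝ (fun q' => twoPoint m Φ Ψ μ μ (q', q)) q := fun μ =>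
    (isTestFun_twoPoint hm hΦ hΨ μ μ).differentiable.comp
      (differentiable_id.prodMk (differentiable_const _)) q
  rw [h, fderiv_fun_sum fun μ _ => (hd μ).const_mul _, _root_.sum_apply, Finset.mul_sum]
  refine Finset.sum_congr rfl fun μ _ => ?_
  rw [fderiv_const_mul (hd μ), _root_.smul_apply, smul_eq_mul, gram_eq, mul_assoc,
    fderiv_prod_left (isTestFun_twoPoint hm hΦ hΨ μ μ)]

theorem velocity_zero (q : Space) : velocity m 0 q = 0 := by
  ext k; simp [velocity]

/-- Both mixed frequency terms give `p_σ` times the contracted two-point function on the diagonal;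
the factor `-2` for each and the coefficient `-1/4` combine to `1`. -/
theorem integral_momentumDensity (hm : 0 < m) (hΦ : IsTestVector Φ) (hΨ : IsTestVector Ψ)
    (σ : Fin 4) (t : ℝ) :
    Integrable (fun x : Space => momentumDensity m Φ Ψ σ (point t x)) ∧
      fockInner m Φ (gen m (Pi.single σ 1) 0 Ψ) =
        ∫ x : Space, momentumDensity m Φ Ψ σ (point t x) := by
  have hg := isTestFun_fullCorr (m := m) hm hΦ hΨ
  have hi := (integrable_diagonal hm t (isTestFun_arrowAmp hm σ
    (isTestFun_arrowAmp hm 0 (isTestFun_shellAmp hm hg)))).1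
  simp only [momentumDensity, quad₂_eq_diagonal hm hΦ hΨ]
  refine ⟨(hi.const_mul _).const_mul _, ?_⟩
  rw [integral_const_mul, integral_const_mul, integral_diagonal_arrow_arrow hm t σ hg,
    fockInner_gen_right hm hΦ hΨ]
  have h1 : ∀ b, (-1) ^ s * ∫ q, (shellDensity m q : ℂ) *
      (lowerIndex (onShell m q) σ * fullCorr m Φ Ψ b (q, q)) =
      ∫ q, (shellDensity m q : ℂ) * (lowerIndex (onShell m q) σ *
        ((-1) ^ s * fullCorr m Φ Ψ b (q, q))) := by
    intro b
    rw [← integral_const_mul]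
    exact integral_congr_ae (Eventually.of_forall fun q => by simp only []; ring)
  have h2 := h1 (true, false)
  have h3 := h1 (false, true)
  simp only [fullCorr_true_false, fullCorr_false_true] at h2 h3
  have h4 : ∀ q, (shellDensity m q : ℂ) * ∑ μ : Fin s → Fin 4, (gram μ : ℂ) *
      ((mdot (onShell m q) (Pi.single σ 1) : ℂ) * twoPoint m Φ Ψ μ μ (q, q) +
        Complex.I * (fderiv ℝ (twoPoint m Φ Ψ μ μ) (q, q) (0, velocity m 0 q) +
          ∑ k, ∑ β, (((0 : Matrix (Fin 4) (Fin 4) ℝ) β (μ k) : ℝ) : ℂ) *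
            twoPoint m Φ Ψ μ (Function.update μ k β) (q, q))) =
      (shellDensity m q : ℂ) * (lowerIndex (onShell m q) σ *
        ∑ μ, (gram μ : ℂ) * twoPoint m Φ Ψ μ μ (q, q)) := by
    intro q
    rw [velocity_zero, Prod.mk_zero_zero]
    simp only [mdot_single, map_zero, Matrix.zero_apply, Complex.ofReal_zero, zero_mul,
      Finset.sum_const_zero, add_zero, mul_zero, Finset.mul_sum, mul_left_comm]
  simp only [h4]
  linear_combination (-1 / 2 : ℂ) * (h2 + h3)

/-! ### The spin part of the Lorentz charge -/

theorem update_vecCons_zero {X : Type*} {n : ℕ} (a b : X) (f : Fin n → X) :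
    Function.update (Matrix.vecCons a f) 0 b = Matrix.vecCons b f := by
  funext i
  cases i using Fin.cases with
  | zero => simp
  | succ i => simp

theorem lorentzGen_apply (σ τ α β : Fin 4) : lorentzGen σ τ α β =
    (if α = τ then η σ β else 0) - (if α = σ then η τ β else 0) := rfl

/-- Symmetry of the tensor indices of the annihilated particle; it makes the slots of the spin term
interchangeable. -/
theorem ann_comp_perm (hΨ : IsFockVector m s Ψ) (μ : Fin s → Fin 4) (e : Equiv.Perm (Fin s))
    (q : Space) : ann (μ ∘ e) q Ψ = ann μ q Ψ := by
  funext n p κ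
  have h := hΨ.symm (n + 1) (Matrix.vecCons q p) (Matrix.vecCons μ κ) 0 e
  rw [Matrix.cons_val_zero, update_vecCons_zero] at h
  simp only [ann, h]

theorem headIndex_eq_vecCons {r : ℕ} (α : Fin 4) (κ : Fin r → Fin 4) :
    (headIndex α κ : Fin (r + 1) → Fin 4) = Matrix.vecCons α κ := by
  funext i
  cases i using Fin.cases with
  | zero => simp [headIndex]
  | succ i => simp [headIndex]

/-- A permutation moves the slot `k` to the front. There the metric forces `μ_0 = σ`, and its entry
cancels against the sign of that slot in `gram` since `η_{σσ}² = 1`. -/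
theorem sum_gram_eta (H : (Fin s → Fin 4) → (Fin s → Fin 4) → ℂ)
    (hH : ∀ (e : Equiv.Perm (Fin s)) μ ν, H (μ ∘ e) (ν ∘ e) = H μ ν) (σ τ : Fin 4) (k : Fin s) :
    ∑ μ, (gram μ : ℂ) * ((η σ (μ k) : ℂ) * H μ (Function.update μ k τ)) =
      (-1) ^ s * ∑ κ : Fin (s - 1) → Fin 4, ((∏ j, η (κ j) (κ j) : ℝ) : ℂ) *
        H (headIndex σ κ) (headIndex τ κ) := by
  cases s with
  | zero => exact k.elim0
  | succ r =>
    have hk : ∑ μ : Fin (r + 1) → Fin 4,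
        (gram μ : ℂ) * ((η σ (μ k) : ℂ) * H μ (Function.update μ k τ)) =
        ∑ μ, (gram μ : ℂ) * ((η σ (μ 0) : ℂ) * H μ (Function.update μ 0 τ)) := by
      let e : Equiv.Perm (Fin (r + 1)) := Equiv.swap 0 k
      rw [← (Equiv.arrowCongr e (Equiv.refl (Fin 4))).sum_comp]
      refine Finset.sum_congr rfl fun μ _ => ?_
      have h1 : Equiv.arrowCongr e (Equiv.refl (Fin 4)) μ = μ ∘ e := rfl
      have h2 : Function.update (μ ∘ e) k τ = Function.update μ 0 τ ∘ e := by
        funext i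
        by_cases hi : i = k
        · simp [hi, e]
        · have : e i ≠ 0 := fun h => hi (by simpa [e] using congrArg e h)
          simp [hi, this]
      have h3 : gram (μ ∘ e) = gram μ := by
        rw [gram, gram]
        exact congrArg _ (Equiv.prod_comp e fun j => η (μ j) (μ j))
      rw [h1, h2, hH, h3]
      simp [e]
    rw [hk, sum_vecCons, Finset.sum_eq_single σ]
    · rw [Finset.mul_sum]
      refine Finset.sum_congr rfl fun κ _ => ?_
      change _ = (-1) ^ (r + 1) * (((∏ j : Fin r, η (κ j) (κ j) : ℝ) : ℂ) *
        H (headIndex σ κ) (headIndex τ κ))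
      rw [update_vecCons_zero, gram_eq, headIndex_eq_vecCons, headIndex_eq_vecCons, Fin.prod_univ_succ]
      simp only [Matrix.cons_val_zero, Matrix.cons_val_succ]
      have h2 := congrArg Complex.ofReal (eta_mul_self σ)
      push_cast at h2 ⊢
      linear_combination ((-1) ^ (r + 1) * (∏ j, (η (κ j) (κ j) : ℂ)) *
        H (Matrix.vecCons σ κ) (Matrix.vecCons τ κ)) * h2
    · intro a _ ha
      refine Finset.sum_eq_zero fun κ _ => ?_
      rw [Matrix.cons_val_zero, eta_of_ne ha.symm]
      simp
    · simp

/-- All `s` slots contribute the same, which explains the coefficient `s` of the spin density. -/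
theorem sum_gram_lorentzGen (H : (Fin s → Fin 4) → (Fin s → Fin 4) → ℂ)
    (hH : ∀ (e : Equiv.Perm (Fin s)) μ ν, H (μ ∘ e) (ν ∘ e) = H μ ν) (σ τ : Fin 4) :
    ∑ μ, (gram μ : ℂ) * ∑ k, ∑ β, (lorentzGen σ τ β (μ k) : ℂ) * H μ (Function.update μ k β) =
      s * (-1) ^ s * ((∑ κ : Fin (s - 1) → Fin 4, ((∏ j, η (κ j) (κ j) : ℝ) : ℂ) *
        H (headIndex σ κ) (headIndex τ κ)) -
      ∑ κ : Fin (s - 1) → Fin 4, ((∏ j, η (κ j) (κ j) : ℝ) : ℂ) *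
        H (headIndex τ κ) (headIndex σ κ)) := by
  have h1 : ∀ (μ : Fin s → Fin 4) k, ∑ β, (lorentzGen σ τ β (μ k) : ℂ) *
      H μ (Function.update μ k β) = η σ (μ k) * H μ (Function.update μ k τ) -
        η τ (μ k) * H μ (Function.update μ k σ) := by
    intro μ k
    have h : ∀ β, (lorentzGen σ τ β (μ k) : ℂ) =
        (if β = τ then (η σ (μ k) : ℂ) else 0) - (if β = σ then (η τ (μ k) : ℂ) else 0) := by
      intro β
      rw [lorentzGen_apply]
      split_ifs <;> simp
    simp only [h, sub_mul, Finset.sum_sub_distrib, ite_mul, zero_mul, Finset.sum_ite_eq',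
      Finset.mem_univ, if_true]
  simp only [h1, Finset.mul_sum, mul_sub, Finset.sum_sub_distrib]
  rw [Finset.sum_comm, Finset.sum_comm (s := (Finset.univ : Finset (Fin s → Fin 4)))]
  simp only [sum_gram_eta H hH, Finset.sum_const, Finset.card_univ, Fintype.card_fin, nsmul_eq_mul,
    ← Finset.mul_sum]
  ring

theorem integral_quad₁ (hm : 0 < m) (hΦ : IsTestVector Φ) (hΨ : IsTestVector Ψ) (σ τ : Fin 4)
    (t : ℝ) : Integrable (fun x : Space => quad₁ m Φ Ψ σ 0 τ (point t x)) ∧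
      ∫ x : Space, quad₁ m Φ Ψ σ 0 τ (point t x) =
        -Complex.I * ((∫ q, (shellDensity m q : ℂ) * headCorr m Φ Ψ σ τ (true, false) (q, q)) -
          ∫ q, (shellDensity m q : ℂ) * headCorr m Φ Ψ σ τ (false, true) (q, q)) := by
  simp only [quad₁_eq_diagonal hm hΦ hΨ]
  exact ⟨(integrable_diagonal hm t (isTestFun_quad₁Amp hm hΦ hΨ σ 0 τ)).1,
    integral_diagonal_arrow hm t (isTestFun_headCorr hm hΦ hΨ σ τ)⟩

theorem IsTestFun.diag {f : Space × Space → ℂ} (hf : IsTestFun f) :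
    IsTestFun fun q => f (q, q) :=
  hf.comp_of_leftInverse (contDiff_id.prodMk contDiff_id) continuous_fst fun _ => rfl

theorem IsTestFun.integrable_shell (hm : 0 < m) {f : Space → ℂ} (hf : IsTestFun f) :
    Integrable fun q => (shellDensity m q : ℂ) * f q :=
  (IsTestFun.mul_left (contDiff_ofReal (contDiff_shellDensity hm)) hf).integrable volume

/-- The orbital part gives half the difference of the derivatives along the velocity in the two
arguments of the two-point function. Their sum integrates to zero, so this equals the derivative in
the second argument, as in `gen`. The spin part gives the tensor term. -/
theorem integral_lorentzDensity (hm : 0 < m) (hΦ : IsFockVector m s Φ) (hΨ : IsFockVector m s Ψ)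
    (σ τ : Fin 4) (t : ℝ) :
    Integrable (fun x : Space => lorentzDensity m Φ Ψ σ τ (point t x)) ∧
      fockInner m Φ (gen m 0 (lorentzGen σ τ) Ψ) =
        ∫ x : Space, lorentzDensity m Φ Ψ σ τ (point t x) := by
  have hΦt := hΦ.isTestVector
  have hΨt := hΨ.isTestVector
  have hg := isTestFun_fullCorr (m := m) hm hΦt hΨt
  have ho := integral_orbital hm t σ τ hg
  have hq := integral_quad₁ hm hΦt hΨt σ τ t
  simp only [lorentzDensity, quad₂_eq_diagonal hm hΦt hΨt]
  refine ⟨((ho.1.const_mul _).sub' (hq.1.const_mul _)).const_mul _, ?_⟩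
  rw [integral_const_mul, integral_sub (ho.1.const_mul _) (hq.1.const_mul _), integral_const_mul,
    integral_const_mul, ho.2, hq.2, fockInner_gen_right hm hΦt hΨt]
  have hv := contDiff_velocity hm (lorentzGen σ τ)
  have htp := isTestFun_twoPoint hm hΦt hΨt
  set v := velocity m (lorentzGen σ τ) with hvdef
  have hD2 : IsTestFun fun q => ∑ μ, (gram μ : ℂ) *
      fderiv ℝ (twoPoint m Φ Ψ μ μ) (q, q) (0, v q) :=
    IsTestFun.sum _ fun μ _ => (isTestFun_fderiv_diag (htp μ μ) contDiff_const hv).const_mul _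
  have hD1 : IsTestFun fun q => ∑ μ, (gram μ : ℂ) *
      fderiv ℝ (twoPoint m Φ Ψ μ μ) (q, q) (v q, 0) :=
    IsTestFun.sum _ fun μ _ => (isTestFun_fderiv_diag (htp μ μ) hv contDiff_const).const_mul _
  have hsum := integral_shellDensity_fderiv_twoPoint hm (isLorentzGen_lorentzGen σ τ) hΦt hΨt
  simp only [mul_add, Finset.sum_add_distrib] at hsum
  rw [integral_add (hD1.integrable_shell hm) (hD2.integrable_shell hm)] at hsum
  have h2 : (-1) ^ s * ∫ q, (shellDensity m q : ℂ) *
      fderiv ℝ (fullCorr m Φ Ψ (true, false)) (q, q) (0, v q) =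
      ∫ q, (shellDensity m q : ℂ) * ∑ μ, (gram μ : ℂ) *
        fderiv ℝ (twoPoint m Φ Ψ μ μ) (q, q) (0, v q) := by
    rw [← integral_const_mul]
    refine integral_congr_ae (Eventually.of_forall fun q => ?_)
    simp only []
    rw [mul_left_comm, fderiv_fullCorr_true_false hm hΦt hΨt]
  have h3 : (-1) ^ s * ∫ q, (shellDensity m q : ℂ) *
      fderiv ℝ (fullCorr m Φ Ψ (false, true)) (q, q) (0, v q) =
      ∫ q, (shellDensity m q : ℂ) * ∑ μ, (gram μ : ℂ) *
        fderiv ℝ (twoPoint m Φ Ψ μ μ) (q, q) (v q, 0) := by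
    rw [← integral_const_mul]
    refine integral_congr_ae (Eventually.of_forall fun q => ?_)
    simp only []
    rw [mul_left_comm, fderiv_fullCorr_false_true hm hΦt hΨt]
  have hpt : ∀ q, (shellDensity m q : ℂ) * ∑ μ : Fin s → Fin 4, (gram μ : ℂ) *
      ((mdot (onShell m q) 0 : ℂ) * twoPoint m Φ Ψ μ μ (q, q) +
        Complex.I * (fderiv ℝ (twoPoint m Φ Ψ μ μ) (q, q) (0, v q) +
          ∑ k, ∑ β, (lorentzGen σ τ β (μ k) : ℂ) *
            twoPoint m Φ Ψ μ (Function.update μ k β) (q, q))) =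
      Complex.I * ((shellDensity m q : ℂ) * ∑ μ, (gram μ : ℂ) *
        fderiv ℝ (twoPoint m Φ Ψ μ μ) (q, q) (0, v q)) +
      Complex.I * (s * (-1) ^ s) *
        ((shellDensity m q : ℂ) * headCorr m Φ Ψ σ τ (true, false) (q, q) -
          (shellDensity m q : ℂ) * headCorr m Φ Ψ σ τ (false, true) (q, q)) := by
    intro q
    have h := sum_gram_lorentzGen (fun μ ν => twoPoint m Φ Ψ μ ν (q, q)) (fun e μ ν => by
      simp only [twoPoint, ann_comp_perm hΦ, ann_comp_perm hΨ]) σ τ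
    have h0 : mdot (onShell m q) 0 = 0 := by simp [mdot]
    simp only [h0, Complex.ofReal_zero, zero_mul, zero_add, mul_add, Finset.sum_add_distrib,
      mul_left_comm _ Complex.I, ← Finset.mul_sum]
    rw [h]
    simp only [headCorr, corr]
    ring
  have hh := fun b => (isTestFun_headCorr hm hΦt hΨt σ τ b).diag.integrable_shell hm
  simp only [hpt]
  rw [integral_add ((hD2.integrable_shell hm).const_mul _)
    (((hh _).sub' (hh _)).const_mul _), integral_const_mul, integral_const_mul,
    integral_sub (hh _) (hh _)]
  linear_combination (-Complex.I / 2) * (h2 - h3) + (Complex.I / 2) * hsum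

/-! ### The reduced stress-energy tensor -/

variable {m : ℝ} {s : ℕ} {Φ Ψ : WaveFun s}

/-- The amplitude of a partial derivative on the diagonal. -/
noncomputable def pdAmp (m : ℝ) (σ : Fin 4) (f : Bool × Bool → Space × Space → ℂ) (b : Bool × Bool)
    (z : Space × Space) : ℂ := Complex.I * lowerIndex (pairSum m b z) σ * f b z

theorem isTestFun_pdAmp (hm : 0 < m) (σ : Fin 4) {f : Bool × Bool → Space × Space → ℂ}
    (hf : ∀ b, IsTestFun (f b)) (b : Bool × Bool) : IsTestFun (pdAmp m σ f b) :=
  IsTestFun.mul_left (contDiff_const.mul (contDiff_ofReal (contDiff_lowerIndex_pairSum hm b σ)))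
    (hf b)

/-- The slice is defined by vanishing total spatial momentum; hence spatial divergences integrate to
zero without any discussion of boundary terms. -/
theorem lowerIndex_pairSum_slice (b : Bool × Bool) (j : Fin 3) (q : Space) :
    lowerIndex (pairSum m b (q, -(sgn b.1 * sgn b.2) • q)) j.succ = 0 := by
  simp only [pairSum, lowerIndex_add, lowerIndex_smul]
  simp only [lowerIndex_succ, onShell_succ, PiLp.smul_apply, smul_eq_mul]
  linear_combination (sgn b.1 * q j) * sgn_sq b.2

theorem integral_pd_diagonal (hm : 0 < m) (t : ℝ) (j : Fin 3)
    {f : Bool × Bool → Space × Space → ℂ} (hf : ∀ b, IsTestFun (f b)) :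
    Integrable (fun x : Space => pd j.succ (diagonal m f) (point t x)) ∧
      ∫ x : Space, pd j.succ (diagonal m f) (point t x) = 0 := by
  have h := integrable_diagonal hm t (isTestFun_pdAmp hm j.succ hf)
  rw [pd_diagonal hm hf]
  refine ⟨h.1, h.2.trans (Finset.sum_eq_zero fun b _ => ?_)⟩
  simp only [slice, pdAmp, lowerIndex_pairSum_slice]
  simp

/-- Since the total momentum vanishes on the slice, the momentum derivative in `weight` contributes
only when it acts on that factor. This is integration by parts of `x_σ ∂_j` in Fourier space. -/
theorem weight_pdAmp (hm : 0 < m) (b : Bool × Bool) (t : ℝ) (σ : Fin 4) (j : Fin 3)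
    {f : Bool × Bool → Space × Space → ℂ} (hf : ∀ b, IsTestFun (f b)) (q : Space) :
    weight m b t σ (pdAmp m j.succ f b) (q, -(sgn b.1 * sgn b.2) • q) =
      -(η σ j.succ : ℂ) * f b (q, -(sgn b.1 * sgn b.2) • q) := by
  have h0 := lowerIndex_pairSum_slice (m := m) b j q
  set q' := -(sgn b.1 * sgn b.2) • q with hq'
  have hline : ∀ {f : Space × Space → ℂ}, IsTestFun f →
      HasDerivAt (fun r : ℝ => f (q, q' + r • spatialDir σ))
        (fderiv ℝ f (q, q') (0, spatialDir σ)) 0 := by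
    intro f hf
    have h2 := (hf.differentiable (q, q')).hasFDerivAt.hasLineDerivAt (0, spatialDir σ)
    unfold HasLineDerivAt at h2
    simpa only [Prod.smul_mk, Prod.mk_add_mk, smul_zero, add_zero] using h2
  have hp : HasDerivAt (fun r : ℝ =>
      lowerIndex (pairSum m b (q, q' + r • spatialDir σ)) j.succ) (sgn b.2 * η σ j.succ) 0 := by
    simp only [pairSum, lowerIndex_add, lowerIndex_smul]
    have h := fderiv_lowerIndex_onShell hm q' σ j.succ
    rw [eta_of_ne (Fin.succ_ne_zero j), zero_mul, sub_zero] at h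
    rw [← h]
    exact ((((contDiff_lowerIndex_onShell hm j.succ).differentiable
      (by simp) q').hasFDerivAt.hasLineDerivAt _).const_mul (sgn b.2)).const_add _
  have h1 := (hp.ofReal_comp.const_mul Complex.I).mul (hline (hf b))
  have h2 := (hline (isTestFun_pdAmp hm j.succ hf b)).unique h1
  rw [weight, h2]
  simp only [pdAmp, zero_smul, add_zero, h0]
  push_cast
  have h3 : Complex.I * (sgn b.2 : ℂ) * (Complex.I * sgn b.2) = -1 := by
    rw [mul_mul_mul_comm, Complex.I_mul_I, sgn_mul_self, mul_one]
  linear_combination (η σ j.succ * f b (q, q')) * h3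

theorem integral_moment_pd_diagonal (hm : 0 < m) (t : ℝ) (σ : Fin 4) (j : Fin 3)
    {f : Bool × Bool → Space × Space → ℂ} (hf : ∀ b, IsTestFun (f b)) :
    Integrable (fun x : Space =>
      (lowerIndex (point t x) σ : ℂ) * pd j.succ (diagonal m f) (point t x)) ∧
    ∫ x : Space, (lowerIndex (point t x) σ : ℂ) * pd j.succ (diagonal m f) (point t x) =
      -(η σ j.succ : ℂ) * ∫ x : Space, diagonal m f (point t x) := by
  have h := integrable_moment hm t σ (isTestFun_pdAmp hm j.succ hf)
  rw [pd_diagonal hm hf]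
  refine ⟨h.1, h.2.trans ?_⟩
  rw [(integrable_diagonal hm t hf).2, Finset.mul_sum]
  refine Finset.sum_congr rfl fun b _ => ?_
  rw [slice, slice]
  simp only [weight_pdAmp hm b t σ j hf, mul_assoc, integral_const_mul]
  ring

/-- The amplitude of `A_0 ↔∂_ρ A_σ + A_0 ↔∂_σ A_ρ + A_σ ↔∂_0 A_ρ`, contracted in the other indices. -/
noncomputable def spinAmp (m : ℝ) (Φ Ψ : WaveFun s) (ρ σ : Fin 4) (b : Bool × Bool)
    (z : Space × Space) : ℂ :=
  arrowAmp m ρ (shellAmp m (headCorr m Φ Ψ 0 σ)) b z +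
    arrowAmp m σ (shellAmp m (headCorr m Φ Ψ 0 ρ)) b z +
    arrowAmp m 0 (shellAmp m (headCorr m Φ Ψ σ ρ)) b z

theorem isTestFun_spinAmp (hm : 0 < m) (hΦ : IsTestVector Φ) (hΨ : IsTestVector Ψ)
    (ρ σ : Fin 4) (b : Bool × Bool) : IsTestFun (spinAmp m Φ Ψ ρ σ b) :=
  ((isTestFun_quad₁Amp hm hΦ hΨ 0 ρ σ b).add (isTestFun_quad₁Amp hm hΦ hΨ 0 σ ρ b)).add
    (isTestFun_quad₁Amp hm hΦ hΨ σ 0 ρ b)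

theorem diagonal_add (hm : 0 < m) {f g : Bool × Bool → Space × Space → ℂ}
    (hf : ∀ b, IsTestFun (f b)) (hg : ∀ b, IsTestFun (g b)) :
    diagonal m (fun b z => f b z + g b z) = fun x => diagonal m f x + diagonal m g x := by
  funext x
  simp only [diagonal, ← Finset.sum_add_distrib]
  refine Finset.sum_congr rfl fun b _ => ?_
  simp only [osc, add_mul]
  exact integral_add (osc_integrable hm b (hf b) x) (osc_integrable hm b (hg b) x)

theorem diagonal_spinAmp (hm : 0 < m) (hΦ : IsTestVector Φ) (hΨ : IsTestVector Ψ) (ρ σ : Fin 4) :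
    diagonal m (spinAmp m Φ Ψ ρ σ) = fun x =>
      quad₁ m Φ Ψ 0 ρ σ x + quad₁ m Φ Ψ 0 σ ρ x + quad₁ m Φ Ψ σ 0 ρ x := by
  have h := isTestFun_quad₁Amp (m := m) hm hΦ hΨ
  unfold spinAmp
  rw [diagonal_add hm (fun b => (h 0 ρ σ b).add (h 0 σ ρ b)) (h σ 0 ρ),
    diagonal_add hm (h 0 ρ σ) (h 0 σ ρ)]
  simp only [quad₁_eq_diagonal hm hΦ hΨ]

theorem quad₁_same (hm : 0 < m) (hΦ : IsTestVector Φ) (hΨ : IsTestVector Ψ) (α σ : Fin 4) :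
    quad₁ m Φ Ψ α σ α = fun _ => 0 := by
  funext x
  have h := quad₁_antisymm hm hΦ hΨ α σ α x
  linear_combination (1 / 2 : ℂ) * h

theorem differentiable_quad₁ (hm : 0 < m) (hΦ : IsTestVector Φ) (hΨ : IsTestVector Ψ)
    (α σ β : Fin 4) : Differentiable ℝ (quad₁ m Φ Ψ α σ β) := by
  rw [quad₁_eq_diagonal hm hΦ hΨ]
  exact differentiable_diagonal hm (isTestFun_quad₁Amp hm hΦ hΨ α σ β)

theorem pd_add {f g : Spacetime → ℂ} (hf : Differentiable ℝ f) (hg : Differentiable ℝ g)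
    (σ : Fin 4) (x : Spacetime) : pd σ (fun x => f x + g x) x = pd σ f x + pd σ g x := by
  rw [pd, fderiv_fun_add (hf x) (hg x)]
  rfl

theorem pd_neg (f : Spacetime → ℂ) (σ : Fin 4) (x : Spacetime) :
    pd σ (fun x => -f x) x = -pd σ f x := by
  rw [pd, fderiv_fun_neg]
  rfl

/-- The time derivative in the divergence term acts on `A_σ ↔∂_0 A_0` only, as `A_0 ↔∂_σ A_0`
vanishes. Antisymmetry and conservation of the current `A_0 ↔∂_μ A_σ` replace it by spatial
derivatives. -/
theorem Tred_eq (hm : 0 < m) (hΦ : IsTestVector Φ) (hΨ : IsTestVector Ψ) (σ : Fin 4)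
    (x : Spacetime) : Tred m Φ Ψ 0 σ x = (-1) ^ s * (-(1 / 4) * quad₂ m Φ Ψ 0 σ x +
      (s / 2) * ∑ j : Fin 3, pd j.succ (diagonal m (spinAmp m Φ Ψ j.succ σ)) x) := by
  have hd := differentiable_quad₁ (m := m) hm hΦ hΨ
  have h0 : pd 0 (quad₁ m Φ Ψ 0 0 σ) x = ∑ j : Fin 3, pd j.succ (quad₁ m Φ Ψ 0 j.succ σ) x := by
    have h := sum_pd_quad₁ hm hΦ hΨ 0 σ x
    rw [Fin.sum_univ_succ] at h
    simp only [eta_zero_zero, eta_succ_succ, Complex.ofReal_one, one_mul, Complex.ofReal_neg,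
      neg_mul, Finset.sum_neg_distrib] at h
    linear_combination h
  have h1 : pd 0 (quad₁ m Φ Ψ σ 0 0) x = -pd 0 (quad₁ m Φ Ψ 0 0 σ) x := by
    rw [← pd_neg]
    exact congrArg (fun f => pd 0 f x) (funext fun y => quad₁_antisymm hm hΦ hΨ σ 0 0 y)
  have h2 : pd 0 (quad₁ m Φ Ψ 0 σ 0) x = 0 := by
    rw [quad₁_same hm hΦ hΨ]
    simp [pd]
  have h3 : ∀ ρ, pd ρ (fun x => quad₁ m Φ Ψ 0 ρ σ x + quad₁ m Φ Ψ 0 σ ρ x + quad₁ m Φ Ψ σ 0 ρ x) x =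
      pd ρ (quad₁ m Φ Ψ 0 ρ σ) x + pd ρ (quad₁ m Φ Ψ 0 σ ρ) x + pd ρ (quad₁ m Φ Ψ σ 0 ρ) x :=
    fun ρ => by
      rw [pd_add ((hd 0 ρ σ).fun_add (hd 0 σ ρ)) (hd σ 0 ρ), pd_add (hd 0 ρ σ) (hd 0 σ ρ)]
  rw [Tred]
  simp only [fun ρ => diagonal_spinAmp hm hΦ hΨ ρ σ, fun μ => pd_add (hd 0 σ μ) (hd σ 0 μ) μ x, h3]
  rw [Fin.sum_univ_succ]
  simp only [eta_zero_zero, eta_succ_succ, Complex.ofReal_one, one_mul, Complex.ofReal_neg,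
    neg_mul, Finset.sum_neg_distrib, h1, h2, h0, Finset.sum_add_distrib]
  ring

theorem integral_Tred (hm : 0 < m) (hΦ : IsTestVector Φ) (hΨ : IsTestVector Ψ) (σ : Fin 4)
    (t : ℝ) : Integrable (fun x : Space => Tred m Φ Ψ 0 σ (point t x)) ∧
      ∫ x : Space, Tred m Φ Ψ 0 σ (point t x) =
        ∫ x : Space, momentumDensity m Φ Ψ σ (point t x) := by
  have h := fun j : Fin 3 => integral_pd_diagonal hm t j (isTestFun_spinAmp hm hΦ hΨ j.succ σ)
  have hi : Integrable fun x : Space => ∑ j : Fin 3,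
      pd j.succ (diagonal m (spinAmp m Φ Ψ j.succ σ)) (point t x) :=
    integrable_finsetSum _ fun j _ => (h j).1
  have hq : Integrable fun x : Space => quad₂ m Φ Ψ 0 σ (point t x) := by
    simp only [quad₂_eq_diagonal hm hΦ hΨ]
    exact (integrable_diagonal hm t (isTestFun_arrowAmp hm 0 (isTestFun_arrowAmp hm σ
      (isTestFun_shellAmp hm (isTestFun_fullCorr hm hΦ hΨ))))).1
  simp only [Tred_eq hm hΦ hΨ, momentumDensity, quad₂_comm hm hΦ hΨ σ 0]
  refine ⟨((hq.const_mul _).fun_add (hi.const_mul _)).const_mul _, ?_⟩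
  rw [integral_const_mul, integral_const_mul, integral_add (hq.const_mul _) (hi.const_mul _),
    integral_const_mul, integral_const_mul, integral_finsetSum _ fun j _ => (h j).1]
  simp [h]

/-- Only spatial indices are summed; the hypothesis `Y 0 = 0` is what makes the formula hold for `σ
= 0` as well. -/
theorem sum_eta_succ (σ : Fin 4) (Y : Fin 4 → ℂ) (h : Y 0 = 0) :
    ∑ j : Fin 3, -(η σ j.succ : ℂ) * Y j.succ = Y σ := by
  cases σ using Fin.cases with
  | zero => simp [eta_of_ne (Fin.succ_ne_zero _).symm, h]
  | succ k =>
    rw [Finset.sum_eq_single k]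
    · rw [eta_succ_succ]; simp
    · intro j _ hj
      rw [eta_of_ne fun h' => hj (Fin.succ_injective _ h').symm]
      simp
    · simp

/-- The first moments of the divergence are integrals of the potential `spinAmp`, which vanishes
when its first index is `0`. The terms with `A_0` are symmetric in the two indices; the
antisymmetric part of the remaining one is the spin density. -/
theorem integral_moment_Tred (hm : 0 < m) (hΦ : IsTestVector Φ) (hΨ : IsTestVector Ψ)
    (σ τ : Fin 4) (t : ℝ) :
    Integrable (fun x : Space => lowerIndex (point t x) σ * Tred m Φ Ψ 0 τ (point t x) -
      lowerIndex (point t x) τ * Tred m Φ Ψ 0 σ (point t x)) ∧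
    ∫ x : Space, (lowerIndex (point t x) σ * Tred m Φ Ψ 0 τ (point t x) -
      lowerIndex (point t x) τ * Tred m Φ Ψ 0 σ (point t x)) =
        ∫ x : Space, lorentzDensity m Φ Ψ σ τ (point t x) := by
  have ht := isTestFun_spinAmp (m := m) hm hΦ hΨ
  have hd := fun σ τ (j : Fin 3) => integral_moment_pd_diagonal hm t σ j (ht j.succ τ)
  let Z : Fin 4 → Fin 4 → Space → ℂ := fun σ τ x => ∑ j : Fin 3, (lowerIndex (point t x) σ : ℂ) *
    pd j.succ (diagonal m (spinAmp m Φ Ψ j.succ τ)) (point t x)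
  have hZi : ∀ σ τ, Integrable (Z σ τ) := fun σ τ => integrable_finsetSum _ fun j _ => (hd σ τ j).1
  have hZ : ∀ σ τ, ∫ x, Z σ τ x = ∫ x : Space, diagonal m (spinAmp m Φ Ψ σ τ) (point t x) := by
    intro σ τ
    rw [integral_finsetSum _ fun j _ => (hd σ τ j).1]
    simp only [hd]
    refine sum_eta_succ σ (fun ρ => ∫ x : Space, diagonal m (spinAmp m Φ Ψ ρ τ) (point t x)) ?_
    have h0 : diagonal m (spinAmp m Φ Ψ 0 τ) = fun _ => 0 := by
      rw [diagonal_spinAmp hm hΦ hΨ, quad₁_same hm hΦ hΨ 0 τ]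
      funext x
      rw [quad₁_antisymm hm hΦ hΨ τ 0 0]
      ring
    simp [h0]
  have hB := fun α σ β => (integrable_diagonal hm t (isTestFun_quad₁Amp hm hΦ hΨ α σ β)).1
  simp only [← quad₁_eq_diagonal hm hΦ hΨ] at hB
  -- Only `A_τ ↔∂_0 A_σ - A_σ ↔∂_0 A_τ` survives, so the coefficient `s/2` of the divergence becomes
  -- the coefficient `-s` of the spin term.
  have hdiff : (∫ x, Z σ τ x) - ∫ x, Z τ σ x =
      -2 * ∫ x : Space, quad₁ m Φ Ψ σ 0 τ (point t x) := by
    rw [hZ, hZ, ← integral_sub (integrable_diagonal hm t (ht σ τ)).1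
      (integrable_diagonal hm t (ht τ σ)).1, ← integral_const_mul]
    refine integral_congr_ae (Eventually.of_forall fun x => ?_)
    simp only [diagonal_spinAmp hm hΦ hΨ]
    linear_combination quad₁_antisymm hm hΦ hΨ τ 0 σ (point t x)
  have ho := (integral_orbital hm t σ τ (isTestFun_fullCorr (m := m) hm hΦ hΨ)).1
  simp only [← quad₂_eq_diagonal hm hΦ hΨ] at ho
  have hpt : ∀ x : Space, lowerIndex (point t x) σ * Tred m Φ Ψ 0 τ (point t x) -
      lowerIndex (point t x) τ * Tred m Φ Ψ 0 σ (point t x) =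
      (-1) ^ s * (-(1 / 4) * (lowerIndex (point t x) σ * quad₂ m Φ Ψ 0 τ (point t x) -
        lowerIndex (point t x) τ * quad₂ m Φ Ψ 0 σ (point t x)) +
        (s / 2) * (Z σ τ x - Z τ σ x)) := by
    intro x
    simp only [Tred_eq hm hΦ hΨ, Z, ← Finset.mul_sum]
    ring
  simp only [hpt, lorentzDensity]
  have hZZ := (hZi σ τ).sub' (hZi τ σ)
  refine ⟨((ho.const_mul _).fun_add (hZZ.const_mul _)).const_mul _, ?_⟩
  rw [integral_const_mul, integral_const_mul, integral_add (ho.const_mul _) (hZZ.const_mul _),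
    integral_sub (ho.const_mul _) ((hB σ 0 τ).const_mul _), integral_const_mul (s / 2 : ℂ),
    integral_const_mul (s : ℂ), integral_sub (hZi σ τ) (hZi τ σ), hdiff]
  ring

/-! ### The generators as operators -/

theorem gen_add {a : Spacetime} {A : Matrix (Fin 4) (Fin 4) ℝ} (hΦ : IsTestVector Φ)
    (hΨ : IsTestVector Ψ) : gen m a A (Φ + Ψ) = gen m a A Φ + gen m a A Ψ := by
  funext n p μ
  simp only [gen, Pi.add_apply, ← Finset.sum_add_distrib]
  refine Finset.sum_congr rfl fun i _ => ?_
  have h1 := (hΦ.test n μ).differentiable p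
  have h2 := (hΨ.test n μ).differentiable p
  rw [slotGen_eq i p μ h1, slotGen_eq i p μ h2, slotGen_eq i p μ (h1.fun_add h2)]
  simp only [Pi.add_apply]
  rw [fderiv_fun_add h1 h2]
  simp only [_root_.add_apply, mul_add, Finset.sum_add_distrib]
  ring

theorem gen_smul {a : Spacetime} {A : Matrix (Fin 4) (Fin 4) ℝ} (hΨ : IsTestVector Ψ) (c : ℂ) :
    gen m a A (c • Ψ) = c • gen m a A Ψ := by
  funext n p μ
  simp only [gen, Pi.smul_apply, smul_eq_mul, Finset.mul_sum]
  refine Finset.sum_congr rfl fun i _ => ?_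
  have h1 := (hΨ.test n μ).differentiable p
  rw [slotGen_eq i p μ h1, slotGen_eq i p μ (h1.const_smul c)]
  simp only [Pi.smul_apply, smul_eq_mul]
  rw [fderiv_const_mul h1]
  simp only [_root_.smul_apply, smul_eq_mul, mul_left_comm _ c, ← Finset.mul_sum]
  ring

/-- The generators of the Poincaré group as operators on the domain. -/
noncomputable def generator (hm : 0 < m) (s : ℕ) (a : Spacetime) {A : Matrix (Fin 4) (Fin 4) ℝ}
    (hA : IsLorentzGen A) : fockDomain m s →ₗ[ℂ] fockDomain m s where
  toFun Ψ := ⟨gen m a A Ψ, IsFockVector.gen hm hA Ψ.2⟩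
  map_add' Φ Ψ := Subtype.ext (gen_add (IsFockVector.isTestVector Φ.2)
    (IsFockVector.isTestVector Ψ.2))
  map_smul' c Ψ := Subtype.ext (gen_smul (IsFockVector.isTestVector Ψ.2) c)

theorem isGenerator_generator (hm : 0 < m) (a : Spacetime) {A : Matrix (Fin 4) (Fin 4) ℝ}
    (hA : IsLorentzGen A) : IsGenerator m
      (fun t => wignerU m (t • a) (NormedSpace.exp (t • A))) (generator hm s a hA) :=
  ⟨fun t Ψ => IsFockVector.wignerU_exp hm hA Ψ.2 t,
    fun Φ Ψ => IsTestVector.fockInner_gen_symm hm hA (IsFockVector.isTestVector Φ.2)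
      (IsFockVector.isTestVector Ψ.2),
    fun Ψ => tendsto_fockInner_slope hm hA (IsFockVector.isTestVector Ψ.2)⟩

end Proca

theorem propositionp (m : ℝ) (hm : 0 < m) (s : ℕ) :
    ∃ (P : Fin 4 → fockDomain m s →ₗ[ℂ] fockDomain m s)
      (M : Fin 4 → Fin 4 → fockDomain m s →ₗ[ℂ] fockDomain m s),
      -- `P_σ` and `M_{στ}` are the generators of the translations and Lorentz transformations
      (∀ σ, IsGenerator m (fun t => wignerU m (Pi.single σ t) 1) (P σ)) ∧
      (∀ σ τ, IsGenerator m
        (fun t => wignerU m 0 (NormedSpace.exp (t • lorentzGen σ τ))) (M σ τ)) ∧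
      -- they are given by spatial integrals at any time `t`
      (∀ (σ : Fin 4) (t : ℝ) (Φ Ψ : fockDomain m s),
        Integrable (fun x : Space => momentumDensity m (Φ : WaveFun s) Ψ σ (point t x)) ∧
        fockInner m (Φ : WaveFun s) (P σ Ψ) =
          ∫ x : Space, momentumDensity m (Φ : WaveFun s) Ψ σ (point t x)) ∧
      (∀ (σ τ : Fin 4) (t : ℝ) (Φ Ψ : fockDomain m s),
        Integrable (fun x : Space => lorentzDensity m (Φ : WaveFun s) Ψ σ τ (point t x)) ∧
        fockInner m (Φ : WaveFun s) (M σ τ Ψ) =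
          ∫ x : Space, lorentzDensity m (Φ : WaveFun s) Ψ σ τ (point t x)) ∧
      -- `[P_σ, A_ν(y)] = -i ∂_σ A_ν(y)`
      (∀ (σ : Fin 4) (ν : Fin s → Fin 4) (y : Spacetime) (Φ Ψ : fockDomain m s),
        fieldForm m (P σ Φ : WaveFun s) Ψ ν y - fieldForm m (Φ : WaveFun s) (P σ Ψ) ν y =
          -Complex.I * pd σ (fieldForm m (Φ : WaveFun s) Ψ ν) y) ∧
      -- `[M_{στ}, A_ν(y)] = -i (y_σ ∂_τ - y_τ ∂_σ) A_ν(y)`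
      -- `  - i ∑_k (η_{σν_k} A_{ν_1…τ…ν_s}(y) - η_{τν_k} A_{ν_1…σ…ν_s}(y))`
      (∀ (σ τ : Fin 4) (ν : Fin s → Fin 4) (y : Spacetime) (Φ Ψ : fockDomain m s),
        fieldForm m (M σ τ Φ : WaveFun s) Ψ ν y - fieldForm m (Φ : WaveFun s) (M σ τ Ψ) ν y =
          -Complex.I * (lowerIndex y σ * pd τ (fieldForm m (Φ : WaveFun s) Ψ ν) y
            - lowerIndex y τ * pd σ (fieldForm m (Φ : WaveFun s) Ψ ν) y)
          - Complex.I * ∑ k, (η σ (ν k) *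
                fieldForm m (Φ : WaveFun s) Ψ (Function.update ν k τ) y
              - η τ (ν k) * fieldForm m (Φ : WaveFun s) Ψ (Function.update ν k σ) y)) ∧
      -- they are the moments of the reduced stress-energy tensor at any time `t`
      (∀ (σ : Fin 4) (t : ℝ) (Φ Ψ : fockDomain m s),
        Integrable (fun x : Space => Tred m (Φ : WaveFun s) Ψ 0 σ (point t x)) ∧
        fockInner m (Φ : WaveFun s) (P σ Ψ) =
          ∫ x : Space, Tred m (Φ : WaveFun s) Ψ 0 σ (point t x)) ∧
      (∀ (σ τ : Fin 4) (t : ℝ) (Φ Ψ : fockDomain m s),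
        Integrable (fun x : Space =>
          lowerIndex (point t x) σ * Tred m (Φ : WaveFun s) Ψ 0 τ (point t x)
            - lowerIndex (point t x) τ * Tred m (Φ : WaveFun s) Ψ 0 σ (point t x)) ∧
        fockInner m (Φ : WaveFun s) (M σ τ Ψ) =
          ∫ x : Space, (lowerIndex (point t x) σ * Tred m (Φ : WaveFun s) Ψ 0 τ (point t x)
            - lowerIndex (point t x) τ * Tred m (Φ : WaveFun s) Ψ 0 σ (point t x))) := by
  have hT : ∀ Ψ : fockDomain m s, IsTestVector (Ψ : WaveFun s) := fun Ψ =>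
    IsFockVector.isTestVector Ψ.2
  refine ⟨fun σ => generator hm s (Pi.single σ 1) isLorentzGen_zero,
    fun σ τ => generator hm s 0 (isLorentzGen_lorentzGen σ τ), fun σ => ?_, fun σ τ => ?_,
    fun σ t Φ Ψ => integral_momentumDensity hm (hT Φ) (hT Ψ) σ t,
    fun σ τ t Φ Ψ => integral_lorentzDensity hm Φ.2 Ψ.2 σ τ t, fun σ ν y Φ Ψ => ?_,
    fun σ τ ν y Φ Ψ => ?_, fun σ t Φ Ψ => ?_, fun σ τ t Φ Ψ => ?_⟩
  · have h := isGenerator_generator (s := s) hm (Pi.single σ 1) isLorentzGen_zero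
    simpa only [smul_zero, NormedSpace.exp_zero, ← Pi.single_smul', smul_eq_mul, mul_one] using h
  · have h := isGenerator_generator (s := s) hm 0 (isLorentzGen_lorentzGen σ τ)
    simpa only [smul_zero] using h
  · refine (fieldForm_gen hm isLorentzGen_zero (hT Φ) (hT Ψ) ν y).trans ?_
    rw [Matrix.zero_mulVec, add_zero, Finset.sum_eq_single σ]
    · simp
    · intro ρ _ hρ
      simp [Pi.single_eq_of_ne hρ]
    · simp
  · refine (fieldForm_gen hm (isLorentzGen_lorentzGen σ τ) (hT Φ) (hT Ψ) ν y).trans ?_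
    have h : ∀ α β γ δ : Fin 4, ∀ c d : ℝ, ((((if α = β then c else 0) -
        (if γ = δ then d else 0) : ℝ)) : ℂ) =
        (if α = β then (c : ℂ) else 0) - (if γ = δ then (d : ℂ) else 0) := by
      intro α β γ δ c d
      split_ifs <;> simp
    simp only [zero_add, lorentzGen_mulVec, lorentzGen_apply, h, sub_mul, ite_mul, zero_mul,
      Finset.sum_sub_distrib, Finset.sum_ite_eq', Finset.mem_univ, if_true]
  · have h := integral_Tred hm (hT Φ) (hT Ψ) σ t
    exact ⟨h.1, (integral_momentumDensity hm (hT Φ) (hT Ψ) σ t).2.trans h.2.symm⟩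
  · have h := integral_moment_Tred hm (hT Φ) (hT Ψ) σ τ t
    exact ⟨h.1, (integral_lorentzDensity hm Φ.2 Ψ.2 σ τ t).2.trans h.2.symm⟩
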